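/- Let $(M,\widetilde g)$ be a smooth Riemannian manifold of dimension $m$, let $f:\mathbb{R}\to(0,\infty)$ be smooth, and let $N=\mathbb{R}\times M$ carry the Lorentzian metric $\overline g=-dt^2+f(t)^2\widetilde g$ (a generalized Robertson--Walker space-time). Let $J\subset\mathbb{R}$ be an interval of positive length, for instance $[0,T]$, let $\mathcal H:M\to\mathbb{R}$ be a function, and let $F:M\times J\to N$ be of class $C^3$ such that every $F(s)=F(\cdot,s)$ is a space-like immersion, i.e. $g=g(s)=F(s)^*\overline g$ is a Riemannian metric on $M$. Let $\mu$ be the future oriented unit normal of $F(s)$, so $\overline g(\mu,\mu)=-1$ and $-\overline g(\partial_t,\mu)>0$. Let $h(X,Y)=\overline g\bigl(\nabla^{F^*TN}_X DF(Y)-DF(\nabla_XY),\mu\bigr)$ be the scalar second fundamental form, $\|h\|^2=g^{ik}g^{jl}h_{ij}h_{kl}$, and $H=g^{ij}h_{ij}$ the mean curvature. Suppose that $F$ is a prescribed mean curvature flow, $$\partial_sF=-(H-\mathcal H)\,\mu\qquad\text{on } M\times J .$$ Let $\nabla$, $|\cdot|$ and $\Delta=-\operatorname{div}\nabla$ be the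 gradient, the norm and the positive Laplace--Beltrami operator of $g(s)$, and let $\mathrm{Ric}^N$ be the Ricci tensor of $(N,\overline g)$. Then $H-\mathcal H$ is $C^2$ on $M$ for each $s\in J$ and differentiable in $s$ (one-sidedly at end points of $J$), and on $M\times J$ $$(\partial_s+\Delta)(H-\mathcal H)=-(H-\mathcal H)\bigl(\|h\|^2+\mathrm{Ric}^N(\mu,\mu)\bigr),$$ $$(\partial_s+\Delta)(H-\mathcal H)^2=-2(H-\mathcal H)^2\bigl(\|h\|^2+\mathrm{Ric}^N(\mu,\mu)\bigr)-2\,|\nabla(H-\mathcal H)|^2 .$$ -/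

import Mathlib

open scoped Manifold ContDiff

noncomputable section

namespace PrescribedMCF

/-! ### Metrics in local coordinates

`G : V → Matrix ι ι ℝ` is the matrix of a (pseudo-)Riemannian metric on an open set of a
finite-dimensional space `V`, in the linear coordinates given by the basis `b` of `V`. -/

section Coordinates

variable {V W ι : Type*} [NormedAddCommGroup V] [NormedSpace ℝ V]
  [NormedAddCommGroup W] [NormedSpace ℝ W] [Fintype ι] [DecidableEq ι]

/-- The partial derivative `∂ᵢ φ`. -/
def pderiv (b : Module.Basis ι ℝ V) (i : ι) (φ : V → W) (z : V) : W := fderiv ℝ φ z (b i)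

/-- The Christoffel symbol `Γᵏᵢⱼ` of the metric `G`. -/
def christoffel (b : Module.Basis ι ℝ V) (G : V → Matrix ι ι ℝ) (z : V) (k i j : ι) : ℝ :=
  (1 / 2) * ∑ l, (G z)⁻¹ k l *
    (pderiv b i (fun y => G y j l) z + pderiv b j (fun y => G y i l) z
      - pderiv b l (fun y => G y i j) z)

/-- The components of the curvature tensor, `R(∂ₐ, ∂_c) ∂_d = R_{acd}ᵉ ∂ₑ`. -/
def riemannCoord (b : Module.Basis ι ℝ V) (G : V → Matrix ι ι ℝ) (z : V) (a c d e : ι) : ℝ :=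
  pderiv b a (fun y => christoffel b G y e c d) z
    - pderiv b c (fun y => christoffel b G y e a d) z
    + ∑ r, (christoffel b G z r c d * christoffel b G z e a r
      - christoffel b G z r a d * christoffel b G z e c r)

/-- The components `Ric_{ac} = R_{dac}ᵈ` of the Ricci tensor. -/
def ricciCoord (b : Module.Basis ι ℝ V) (G : V → Matrix ι ι ℝ) (z : V) (a c : ι) : ℝ :=
  ∑ d, riemannCoord b G z d a c d

end Coordinates

/-! ### Metrics on a manifold

Mathlib identifies the tangent space at `q` with the model space `V` by means of the preferred
chart at `q`; so the vector of `T_q X` with components `vⁱ` in that chart is `∑ vⁱ b i`. -/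

section Manifold

variable {V H X ι : Type*} [NormedAddCommGroup V] [NormedSpace ℝ V]
  [TopologicalSpace H] [TopologicalSpace X] [ChartedSpace H X] [Fintype ι] [DecidableEq ι]

/-- The coordinate vector field `∂ᵢ` of the chart at `q₀`, at the point with coordinates `z`. -/
def coordVector (I : ModelWithCorners ℝ V H) (b : Module.Basis ι ℝ V) (q₀ : X) (z : V) (i : ι) :
    TangentSpace I ((extChartAt I q₀).symm z) :=
  mfderiv 𝓘(ℝ, V) I (extChartAt I q₀).symm z (b i)

/-- The matrix `g(∂ᵢ, ∂ⱼ)` of a metric in the chart at `q₀`. -/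
def coordMetric (I : ModelWithCorners ℝ V H) (b : Module.Basis ι ℝ V)
    (g : ∀ q : X, TangentSpace I q → TangentSpace I q → ℝ) (q₀ : X) (z : V) : Matrix ι ι ℝ :=
  Matrix.of fun i j =>
    g ((extChartAt I q₀).symm z) (coordVector I b q₀ z i) (coordVector I b q₀ z j)

/-- The Christoffel symbol `Γᵏᵢⱼ` of `g` in the chart at `q`, at the point `q`. -/
def christoffelAt (I : ModelWithCorners ℝ V H) (b : Module.Basis ι ℝ V)
    (g : ∀ q : X, TangentSpace I q → TangentSpace I q → ℝ) (q : X) (k i j : ι) : ℝ :=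
  christoffel b (coordMetric I b g q) (extChartAt I q q) k i j

/-- The inverse matrix `gⁱʲ` of `g` in the chart at `q`, at the point `q`. -/
def inverseMetric (I : ModelWithCorners ℝ V H) (b : Module.Basis ι ℝ V)
    (g : ∀ q : X, TangentSpace I q → TangentSpace I q → ℝ) (q : X) : Matrix ι ι ℝ :=
  (coordMetric I b g q (extChartAt I q q))⁻¹

/-- The Ricci tensor of the metric `g`. -/
def ricci (I : ModelWithCorners ℝ V H) (b : Module.Basis ι ℝ V)
    (g : ∀ q : X, TangentSpace I q → TangentSpace I q → ℝ) (q : X)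
    (Y Z : TangentSpace I q) : ℝ :=
  ∑ i, ∑ j, ricciCoord b (coordMetric I b g q) (extChartAt I q q) i j * b.repr Y i * b.repr Z j

/-- The positive Laplace-Beltrami operator `Δ w = - div ∇ w = - gⁱʲ (∂ᵢ∂ⱼ w - Γᵏᵢⱼ ∂ₖ w)`. -/
def laplacian (I : ModelWithCorners ℝ V H) (b : Module.Basis ι ℝ V)
    (g : ∀ q : X, TangentSpace I q → TangentSpace I q → ℝ) (w : X → ℝ) (q : X) : ℝ :=
  -∑ i, ∑ j, inverseMetric I b g q i j *
    (pderiv b i (pderiv b j (w ∘ (extChartAt I q).symm)) (extChartAt I q q)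
      - ∑ k, christoffelAt I b g q k i j *
          pderiv b k (w ∘ (extChartAt I q).symm) (extChartAt I q q))

/-- The squared norm `|∇ w|² = gⁱʲ ∂ᵢ w ∂ⱼ w` of the gradient. -/
def gradNormSq (I : ModelWithCorners ℝ V H) (b : Module.Basis ι ℝ V)
    (g : ∀ q : X, TangentSpace I q → TangentSpace I q → ℝ) (w : X → ℝ) (q : X) : ℝ :=
  ∑ i, ∑ j, inverseMetric I b g q i j *
    pderiv b i (w ∘ (extChartAt I q).symm) (extChartAt I q q) *
    pderiv b j (w ∘ (extChartAt I q).symm) (extChartAt I q q)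

end Manifold

/-! ### Generalized Robertson-Walker space-times and their space-like hypersurfaces -/

/-- The coordinate space of `M`. -/
abbrev E (m : ℕ) : Type := EuclideanSpace ℝ (Fin m)

/-- The model of the space-time `ℝ × M`. -/
abbrev modelN (m : ℕ) : ModelWithCorners ℝ (ℝ × E m) (ModelProd ℝ (E m)) := 𝓘(ℝ, ℝ).prod (𝓡 m)

/-- The standard basis of the coordinate space of `M`. -/
def basisM (m : ℕ) : Module.Basis (Fin m) ℝ (E m) := (EuclideanSpace.basisFun (Fin m) ℝ).toBasis

/-- The standard basis of the coordinate space of `ℝ × M`; the index `Sum.inl ()` is that of `t`. -/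
def basisN (m : ℕ) : Module.Basis (Unit ⊕ Fin m) ℝ (ℝ × E m) :=
  (Module.Basis.singleton Unit ℝ).prod (basisM m)

/-- Linear algebra behind the existence and uniqueness of the unit normal. -/
theorem existsUnique_normal {V W : Type*} [AddCommGroup V] [Module ℝ V] [FiniteDimensional ℝ V]
    [AddCommGroup W] [Module ℝ W] [FiniteDimensional ℝ W]
    (hdim : Module.finrank ℝ W = Module.finrank ℝ V + 1)
    (B : W →ₗ[ℝ] W →ₗ[ℝ] ℝ) (hB : ∀ x y, B x y = B y x) (L : V →ₗ[ℝ] W)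
    (hL : ∀ y, y ≠ 0 → 0 < B (L y) (L y)) (e : W) (he : B e e = -1) :
    ∃! n : W, (∀ y, B n (L y) = 0) ∧ B n n = -1 ∧ 0 < -B e n := by
  have hinj : Function.Injective (B.compl₁₂ L L) := by
    rw [← LinearMap.ker_eq_bot, LinearMap.ker_eq_bot']
    intro y hy
    by_contra h
    have h1 := hL y h
    have h2 : B.compl₁₂ L L y y = 0 := by rw [hy]; rfl
    simp only [LinearMap.compl₁₂_apply] at h2
    linarith
  have hsurj : Function.Surjective (B.compl₁₂ L L) :=
    (LinearMap.injective_iff_surjective_of_finrank_eq_finrank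
      (Subspace.dual_finrank_eq (K := ℝ) (V := V)).symm).1 hinj
  have hLnn : ∀ y, 0 ≤ B (L y) (L y) := fun y => by
    by_cases h : y = 0
    · simp [h]
    · exact (hL y h).le
  obtain ⟨v, hv⟩ := hsurj (-(B e).comp L)
  have hv' : ∀ y, B (L v) (L y) = -B e (L y) := fun y => by
    have := LinearMap.congr_fun hv y
    simpa using this
  have horth : ∀ y, B (e + L v) (L y) = 0 := fun y => by
    rw [map_add, LinearMap.add_apply, hv' y]; ring
  set q := B (L v) (L v) with hq
  have hq0 : 0 ≤ q := hLnn v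
  have hev : B e (L v) = -q := by have := hv' v; linarith
  have hee : B e (e + L v) = -(1 + q) := by rw [map_add, he, hev]; ring
  have hnn : B (e + L v) (e + L v) = -(1 + q) := by
    have h1 := horth v
    rw [map_add (B (e + L v)) e (L v), h1, hB, hee]; ring
  set r := Real.sqrt (1 + q) with hr
  have hr0 : 0 < r := Real.sqrt_pos.2 (by linarith)
  have hrr : r * r = 1 + q := Real.mul_self_sqrt (by linarith)
  set n₀ := r⁻¹ • (e + L v) with hn₀
  have c1 : ∀ y, B n₀ (L y) = 0 := fun y => by
    rw [hn₀, map_smul, LinearMap.smul_apply, horth, smul_zero]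
  have c2 : B n₀ n₀ = -1 := by
    rw [hn₀, LinearMap.map_smul₂, map_smul, hnn, ← hrr, smul_eq_mul, smul_eq_mul]
    field_simp
  have c3 : 0 < -B e n₀ := by
    rw [hn₀, map_smul, hee, ← hrr, smul_eq_mul]
    have : -(r⁻¹ * -(r * r)) = r := by field_simp
    rw [this]; exact hr0
  refine ⟨n₀, ⟨c1, c2, c3⟩, ?_⟩
  rintro n ⟨d1, d2, d3⟩
  have hTinj : Function.Injective (L.coprod (LinearMap.toSpanSingleton ℝ W n₀)) := by
    rw [← LinearMap.ker_eq_bot, LinearMap.ker_eq_bot']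
    rintro ⟨y, c⟩ hyc
    simp only [LinearMap.coprod_apply, LinearMap.toSpanSingleton_apply] at hyc
    have hc : c = 0 := by
      have h := congrArg (B n₀) hyc
      rw [map_add, c1, map_smul, c2, map_zero, smul_eq_mul] at h
      linarith
    have hy : y = 0 := by
      by_contra hy
      have h1 := hL y hy
      rw [hc, zero_smul, add_zero] at hyc
      rw [hyc, map_zero] at h1
      exact lt_irrefl _ h1
    rw [hc, hy]; rfl
  have hTsurj := (LinearMap.injective_iff_surjective_of_finrank_eq_finrank
    (by rw [hdim, Module.finrank_prod, Module.finrank_self])).1 hTinj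
  obtain ⟨⟨y, c⟩, hyc⟩ := hTsurj n
  simp only [LinearMap.coprod_apply, LinearMap.toSpanSingleton_apply] at hyc
  have hy : y = 0 := by
    by_contra hy
    have h1 := hL y hy
    have h2 := d1 y
    rw [← hyc, map_add, LinearMap.add_apply, map_smul, LinearMap.smul_apply, c1, smul_zero,
      add_zero] at h2
    linarith
  rw [hy, map_zero, zero_add] at hyc
  have hcc : c * c = 1 := by
    rw [← hyc, LinearMap.map_smul₂, map_smul, c2, smul_eq_mul, smul_eq_mul] at d2
    linarith
  have hc : 0 < c := by
    rw [← hyc, map_smul, smul_eq_mul] at d3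
    by_contra h
    nlinarith
  have hc1 : c = 1 := by nlinarith
  rw [← hyc, hc1, one_smul]

section Hypersurface

variable {m : ℕ} {M : Type*} [TopologicalSpace M] [ChartedSpace (E m) M] [IsManifold (𝓡 m) ∞ M]

/-- The Lorentzian metric `-dt² + f(t)² g̃` on `ℝ × M`. -/
def warpedMetric (f : ℝ → ℝ)
    (gt : Bundle.ContMDiffRiemannianMetric (𝓡 m) ∞ (E m) (fun x : M => TangentSpace (𝓡 m) x))
    (q : ℝ × M) (Y Z : TangentSpace (modelN m) q) : ℝ :=
  -((Y : ℝ × E m).1 * (Z : ℝ × E m).1)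
    + f q.1 ^ 2 * gt.inner q.2 (Y : ℝ × E m).2 (Z : ℝ × E m).2

variable (f : ℝ → ℝ)
  (gt : Bundle.ContMDiffRiemannianMetric (𝓡 m) ∞ (E m) (fun x : M => TangentSpace (𝓡 m) x))
  (Φ : M → ℝ × M)

/-- The metric `g = Φ^* ḡ` induced on `M` by `Φ : M → ℝ × M`. -/
def inducedMetric (p : M) (Y Z : TangentSpace (𝓡 m) p) : ℝ :=
  warpedMetric f gt (Φ p) (mfderiv (𝓡 m) (modelN m) Φ p Y) (mfderiv (𝓡 m) (modelN m) Φ p Z)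

/-- The map `Φ` is a space-like immersion: the induced metric is Riemannian. -/
def IsSpacelike : Prop :=
  ∀ (p : M) (Y : TangentSpace (𝓡 m) p), Y ≠ 0 → 0 < inducedMetric f gt Φ p Y Y

/-- `n` is normal to `Φ` at `p`, has `ḡ(n, n) = -1` and is future oriented, `-ḡ(∂ₜ, n) > 0`. -/
def IsFutureUnitNormal (p : M) (n : TangentSpace (modelN m) (Φ p)) : Prop :=
  (∀ Y : TangentSpace (𝓡 m) p,
    warpedMetric f gt (Φ p) n (mfderiv (𝓡 m) (modelN m) Φ p Y) = 0) ∧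
  warpedMetric f gt (Φ p) n n = -1 ∧
  0 < -warpedMetric f gt (Φ p) ((1, 0) : ℝ × E m) n

/-- The future oriented unit normal `μ` of `Φ` at `p`. -/
def unitNormal (p : M) : TangentSpace (modelN m) (Φ p) :=
  Classical.epsilon (IsFutureUnitNormal f gt Φ p)

/-- A space-like immersion has exactly one future oriented unit normal at each point. -/
theorem existsUnique_unitNormal (hΦ : IsSpacelike f gt Φ) (p : M) :
    ∃! n, IsFutureUnitNormal f gt Φ p n := by
  let A : E m →ₗ[ℝ] E m →ₗ[ℝ] ℝ :=
    { toFun := fun y => (gt.inner (Φ p).2 y : E m →L[ℝ] ℝ).toLinearMap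
      map_add' := fun y z => LinearMap.ext fun w => by
        exact congrArg (fun T => T w) ((gt.inner (Φ p).2).map_add y z)
      map_smul' := fun c y => LinearMap.ext fun w => by
        exact congrArg (fun T => T w) ((gt.inner (Φ p).2).map_smul c y) }
  let B : (ℝ × E m) →ₗ[ℝ] (ℝ × E m) →ₗ[ℝ] ℝ :=
    -(LinearMap.mul ℝ ℝ).compl₁₂ (LinearMap.fst ℝ ℝ (E m)) (LinearMap.fst ℝ ℝ (E m))
      + f (Φ p).1 ^ 2 • A.compl₁₂ (LinearMap.snd ℝ ℝ (E m)) (LinearMap.snd ℝ ℝ (E m))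
  have hBw : ∀ y z : ℝ × E m, B y z = warpedMetric f gt (Φ p) y z := fun y z => by
    simp only [B, A, warpedMetric, LinearMap.add_apply, LinearMap.neg_apply,
      LinearMap.smul_apply, LinearMap.compl₁₂_apply, smul_eq_mul]
    rfl
  have hsym : ∀ y z, B y z = B z y := fun y z => by
    rw [hBw, hBw]
    unfold warpedMetric
    have h := gt.symm (Φ p).2 (y : ℝ × E m).2 (z : ℝ × E m).2
    exact congrArg₂ (fun a c => -a + f (Φ p).1 ^ 2 * c) (mul_comm _ _) h
  have he : B (1, 0) (1, 0) = -1 := by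
    simp [B]
  let L : E m →L[ℝ] ℝ × E m := mfderiv (𝓡 m) (modelN m) Φ p
  have := existsUnique_normal (V := E m) (W := ℝ × E m)
    (by rw [Module.finrank_prod, Module.finrank_self, add_comm]) B hsym
    L.toLinearMap
    (fun y hy => by rw [hBw]; exact hΦ p y hy) (1, 0) he
  simp only [hBw] at this
  exact this

/-- The defining properties of `unitNormal`. -/
theorem unitNormal_spec (hΦ : IsSpacelike f gt Φ) (p : M) :
    IsFutureUnitNormal f gt Φ p (unitNormal f gt Φ p) :=
  Classical.epsilon_spec (existsUnique_unitNormal f gt Φ hΦ p).exists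

/-- The map `Φ` in the charts at `p` and at `Φ p`. -/
def coordRep (p : M) : E m → ℝ × E m :=
  extChartAt (modelN m) (Φ p) ∘ Φ ∘ (extChartAt (𝓡 m) p).symm

/-- The pull-back covariant derivative `∇_{∂ᵢ} (DΦ(∂ⱼ))` at `p`, a vector tangent to `ℝ × M` at
`Φ p`: its components are `∂ᵢ∂ⱼ Φᶜ + Γ̄ᶜₐₑ ∂ᵢ Φᵃ ∂ⱼ Φᵉ`. -/
def pullbackHessian (p : M) (i j : Fin m) : TangentSpace (modelN m) (Φ p) :=
  pderiv (basisM m) i (pderiv (basisM m) j (coordRep Φ p)) (extChartAt (𝓡 m) p p)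
    + ∑ c, (∑ a, ∑ e,
        christoffelAt (modelN m) (basisN m) (warpedMetric f gt) (Φ p) c a e
          * (basisN m).repr (pderiv (basisM m) i (coordRep Φ p) (extChartAt (𝓡 m) p p)) a
          * (basisN m).repr (pderiv (basisM m) j (coordRep Φ p) (extChartAt (𝓡 m) p p)) e)
      • basisN m c

/-- The vector valued second fundamental form `∇_{∂ᵢ} (DΦ(∂ⱼ)) - DΦ(∇_{∂ᵢ} ∂ⱼ)` at `p`. -/
def secondFundamentalForm (p : M) (i j : Fin m) : TangentSpace (modelN m) (Φ p) :=
  pullbackHessian f gt Φ p i j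
    - ∑ k, christoffelAt (𝓡 m) (basisM m) (inducedMetric f gt Φ) p k i j
      • mfderiv (𝓡 m) (modelN m) Φ p (basisM m k)

/-- The scalar second fundamental form `hᵢⱼ = ḡ(∇_{∂ᵢ} (DΦ(∂ⱼ)) - DΦ(∇_{∂ᵢ} ∂ⱼ), μ)`. -/
def scalarSFF (p : M) (i j : Fin m) : ℝ :=
  warpedMetric f gt (Φ p) (secondFundamentalForm f gt Φ p i j) (unitNormal f gt Φ p)

/-- The mean curvature `H = gⁱʲ hᵢⱼ`. -/
def meanCurvature (p : M) : ℝ :=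
  ∑ i, ∑ j, inverseMetric (𝓡 m) (basisM m) (inducedMetric f gt Φ) p i j * scalarSFF f gt Φ p i j

/-- The squared norm `‖h‖² = gⁱᵏ gʲˡ hᵢⱼ hₖₗ` of the second fundamental form. -/
def normSqSFF (p : M) : ℝ :=
  ∑ i, ∑ j, ∑ k, ∑ l,
    inverseMetric (𝓡 m) (basisM m) (inducedMetric f gt Φ) p i k
      * inverseMetric (𝓡 m) (basisM m) (inducedMetric f gt Φ) p j l
      * scalarSFF f gt Φ p i j * scalarSFF f gt Φ p k l

/-- The value `Ric^N(μ, μ)` at `Φ p` of the Ricci tensor of the space-time. -/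
def ricciNormal (p : M) : ℝ :=
  ricci (modelN m) (basisN m) (warpedMetric f gt) (Φ p)
    (unitNormal f gt Φ p) (unitNormal f gt Φ p)

/-- The family `F s : M → ℝ × M`, `s ∈ J`, of space-like immersions is a prescribed mean curvature
flow with prescribing function `ℋ` on `M`: `∂ₛ F = -(H - ℋ) μ`. -/
structure IsPrescribedMCF (J : Set ℝ) (ℋ : M → ℝ) (F : ℝ → M → ℝ × M) : Prop where
  regular : ContMDiffOn ((𝓡 m).prod 𝓘(ℝ, ℝ)) (modelN m) 3
    (fun z : M × ℝ => F z.2 z.1) (Set.univ ×ˢ J)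
  spacelike : ∀ s ∈ J, IsSpacelike f gt (F s)
  evolution : ∀ s ∈ J, ∀ p : M,
    HasMFDerivWithinAt 𝓘(ℝ, ℝ) (modelN m) (fun r : ℝ => F r p) J s
      (ContinuousLinearMap.toSpanSingleton ℝ
        (-(meanCurvature f gt (F s) p - ℋ p) • unitNormal f gt (F s) p))

end Hypersurface

end PrescribedMCF

end

/-!
The evolution equations are local, so the flow is read in the chart of `M` at a point `p` and in the
chart of the space-time at `F s p`. There it is a family `u` of maps into an open set of a vector
space with a metric `G` and a Christoffel form `Γ` (`IsLeviCivita`), which moves in normal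
direction, `∂ₛu = -w n` with `w = H - ℋ` (`NormalFlow`, `IsPrescribedMCF.normalFlow`). Let `∇` be
the covariant derivative along `u`. It is compatible with `G`, satisfies `∇ₐ ∂_c u = ∇_c ∂ₐ u`, and
`∇ₐ` and `∇_c` commute up to the curvature.

The unit normal `n` is obtained by normalizing the normal part of `∂ₜ`, an expression in the first
derivatives of `u`; so it is `C²` (`contDiffOn_unitNormal`). Hence `w = G(∂ₛu, n)` is `C²`, whatever
`ℋ` is, and `hᵢⱼ = G(∇ᵢ ∂ⱼu, n) = -G(∇ᵢ n, ∂ⱼu)` is `C¹`. Differentiating the relations `G(n, n) =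
-1` and `G(n, ∂ⱼu) = 0` gives `∂ₛ gᵢⱼ = 2 w hᵢⱼ` and `G(∇ₛ n, ∂ⱼu) = -∂ⱼw`. Then `∂ₛ hᵢⱼ = -∂ₛ G(∇ᵢ
n, ∂ⱼu)` is computed by exchanging `∇ₛ` and `∇ᵢ` (`NormalFlow.dirDeriv_sff`): `∂ₛ hᵢⱼ = ∇ᵢ ∇ⱼ w + w
gᵏˡ hᵢₖ hⱼₗ - w G(R(∂ᵢu, n) n, ∂ⱼu)`. The trace of this and the derivative `-2 w gⁱᵃ gʲᵇ hₐᵦ` of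
`gⁱʲ` give `∂ₛ H = -Δ w - w (‖h‖² + tr R(·, n) n)` (`NormalFlow.dirDeriv_meanCurvature`), and the
trace is `Ric(n, n)` (`trace_curvatureMap`). As `ℋ` does not depend on `s`, this is `∂ₛ w`.

Three facts identify the expressions in charts with the invariant ones. The second fundamental form
does not depend on the chart of the space-time, because transition maps are isometries
(`IsLeviCivita.covDeriv_isometry`, `scalarSFF_chart`); this matters since the flow is followed in
the fixed chart at `F s p`, while `scalarSFF` at time `r` refers to the chart at `F r p`. The
Christoffel symbols of the induced metric are the tangential components of `∇ᵢ ∂ⱼu`, by the Koszul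
formula (`IsPrescribedMCF.christoffelAt_eq`). The coordinate formula for the Ricci tensor is a
trace. The equation for `w²` follows from that for `w` by the product rule `Δ(w²) = 2 w Δw - 2
|∇w|²` (`laplacian_sq`).
-/

namespace PrescribedMCF

open Set

/-! ### Directional derivatives within a set -/

section DirDeriv

variable {X W W₁ W₂ W₃ : Type*} [NormedAddCommGroup X] [NormedSpace ℝ X]
  [NormedAddCommGroup W] [NormedSpace ℝ W] [NormedAddCommGroup W₁] [NormedSpace ℝ W₁]
  [NormedAddCommGroup W₂] [NormedSpace ℝ W₂] [NormedAddCommGroup W₃] [NormedSpace ℝ W₃]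

/-- The derivative of `φ` within `S` in the direction of the constant vector `ξ`. The derivative is
taken within `S` because the parameter domain of a flow may contain its initial or final time. -/
noncomputable def dirDeriv (S : Set X) (ξ : X) (φ : X → W) (x : X) : W := fderivWithin ℝ φ S x ξ

variable {S : Set X} {Ω : Set W} {x : X}

theorem dirDeriv_congr {φ ψ : X → W} (h : EqOn φ ψ S) (hx : x ∈ S) (ξ : X) :
    dirDeriv S ξ φ x = dirDeriv S ξ ψ x := by
  unfold dirDeriv
  rw [fderivWithin_congr h (h hx)]

theorem dirDeriv_add {φ ψ : X → W} (hS : UniqueDiffOn ℝ S) (hx : x ∈ S)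
    (hφ : DifferentiableWithinAt ℝ φ S x) (hψ : DifferentiableWithinAt ℝ ψ S x) (ξ : X) :
    dirDeriv S ξ (φ + ψ) x = dirDeriv S ξ φ x + dirDeriv S ξ ψ x := by
  unfold dirDeriv
  rw [fderivWithin_add (hS x hx) hφ hψ]
  rfl

theorem dirDeriv_smul {c : X → ℝ} {φ : X → W} (hS : UniqueDiffOn ℝ S) (hx : x ∈ S)
    (hc : DifferentiableWithinAt ℝ c S x) (hφ : DifferentiableWithinAt ℝ φ S x) (ξ : X) :
    dirDeriv S ξ (fun y => c y • φ y) x = c x • dirDeriv S ξ φ x + dirDeriv S ξ c x • φ x := by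
  unfold dirDeriv
  rw [fderivWithin_fun_smul (hS x hx) hc hφ]
  rfl

theorem dirDeriv_mul {c φ : X → ℝ} (hS : UniqueDiffOn ℝ S) (hx : x ∈ S)
    (hc : DifferentiableWithinAt ℝ c S x) (hφ : DifferentiableWithinAt ℝ φ S x) (ξ : X) :
    dirDeriv S ξ (fun y => c y * φ y) x = c x * dirDeriv S ξ φ x + dirDeriv S ξ c x * φ x :=
  dirDeriv_smul hS hx hc hφ ξ

theorem dirDeriv_neg {φ : X → W} (hS : UniqueDiffOn ℝ S) (hx : x ∈ S) (ξ : X) :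
    dirDeriv S ξ (fun y => -φ y) x = -dirDeriv S ξ φ x := by
  unfold dirDeriv
  rw [fderivWithin_fun_neg (hS x hx)]
  rfl

theorem dirDeriv_const (c : W) (ξ : X) : dirDeriv S ξ (fun _ => c) x = 0 := by
  simp [dirDeriv]

theorem dirDeriv_sum {κ : Type*} (t : Finset κ) {φ : κ → X → W} (hS : UniqueDiffOn ℝ S)
    (hx : x ∈ S) (hφ : ∀ k ∈ t, DifferentiableWithinAt ℝ (φ k) S x) (ξ : X) :
    dirDeriv S ξ (fun y => ∑ k ∈ t, φ k y) x = ∑ k ∈ t, dirDeriv S ξ (φ k) x := by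
  unfold dirDeriv
  rw [fderivWithin_fun_sum (hS x hx) hφ]
  simp

theorem _root_.ContDiffOn.dirDeriv {φ : X → W} {k n : ℕ∞ω} (hφ : ContDiffOn ℝ n φ S)
    (hS : UniqueDiffOn ℝ S) (hk : k + 1 ≤ n) (ξ : X) : ContDiffOn ℝ k (dirDeriv S ξ φ) S :=
  (hφ.fderivWithin hS hk).clm_apply contDiffOn_const

/-- Directional derivatives of a `C²` map commute up to the boundary of its domain. -/
theorem dirDeriv_comm {φ : X → W} (hS : UniqueDiffOn ℝ S) (hS' : S ⊆ closure (interior S))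
    (hφ : ContDiffOn ℝ 2 φ S) (hx : x ∈ S) (ξ η : X) :
    dirDeriv S ξ (dirDeriv S η φ) x = dirDeriv S η (dirDeriv S ξ φ) x := by
  have hd : DifferentiableWithinAt ℝ (fderivWithin ℝ φ S) S x :=
    ((hφ.fderivWithin (m := 1) hS (by norm_num)).differentiableOn (by norm_num)) x hx
  have key : ∀ ζ ζ' : X, dirDeriv S ζ (dirDeriv S ζ' φ) x
      = fderivWithin ℝ (fderivWithin ℝ φ S) S x ζ ζ' := fun ζ ζ' => by
    unfold dirDeriv
    rw [fderivWithin_clm_apply (hS x hx) hd (differentiableWithinAt_const _)]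
    simp
  rw [key, key]
  exact (hφ x hx).isSymmSndFDerivWithinAt (by simp) hS (hS' hx) hx ξ η

/-- The chain rule. `V` and `B` are explicit because unification does not find them when `V` is a
space of linear maps. -/
theorem hasFDerivWithinAt_comp_of_differentiableAt (V : Type*) [NormedAddCommGroup V]
    [NormedSpace ℝ V] (B : W → V) {u : X → W} (hB : DifferentiableAt ℝ B (u x))
    (hu : DifferentiableWithinAt ℝ u S x) :
    HasFDerivWithinAt (fun y => B (u y)) ((fderiv ℝ B (u x)).comp (fderivWithin ℝ u S x)) S x :=
  hB.hasFDerivAt.comp_hasFDerivWithinAt x hu.hasFDerivWithinAt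

/-- The product rule for a bilinear form which depends on the base point. -/
theorem dirDeriv_bilin {B : W → W₁ →L[ℝ] W₂ →L[ℝ] W₃} {u : X → W} {Y : X → W₁} {Z : X → W₂}
    (hS : UniqueDiffOn ℝ S) (hx : x ∈ S) (hB : DifferentiableAt ℝ B (u x))
    (hu : DifferentiableWithinAt ℝ u S x)
    (hY : DifferentiableWithinAt ℝ Y S x) (hZ : DifferentiableWithinAt ℝ Z S x) (ξ : X) :
    dirDeriv S ξ (fun y => B (u y) (Y y) (Z y)) x
      = fderiv ℝ B (u x) (dirDeriv S ξ u x) (Y x) (Z x)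
        + B (u x) (dirDeriv S ξ Y x) (Z x) + B (u x) (Y x) (dirDeriv S ξ Z x) := by
  have h1 : HasFDerivWithinAt (fun y => B (u y)) ((fderiv ℝ B (u x)).comp (fderivWithin ℝ u S x))
      S x :=
    hasFDerivWithinAt_comp_of_differentiableAt (W₁ →L[ℝ] W₂ →L[ℝ] W₃) B hB hu
  have h2 := (h1.clm_apply hY.hasFDerivWithinAt).clm_apply hZ.hasFDerivWithinAt
  unfold dirDeriv
  rw [HasFDerivWithinAt.fderivWithin h2 (hS x hx)]
  simp
  abel

theorem _root_.ContDiffOn.bilin {B : W → W₁ →L[ℝ] W₂ →L[ℝ] W₃} {u : X → W} {Y : X → W₁}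
    {Z : X → W₂} {k : ℕ∞ω} (hB : ContDiffOn ℝ k B Ω) (hu : ContDiffOn ℝ k u S)
    (hΩ : MapsTo u S Ω) (hY : ContDiffOn ℝ k Y S) (hZ : ContDiffOn ℝ k Z S) :
    ContDiffOn ℝ k (fun y => B (u y) (Y y) (Z y)) S :=
  ((hB.comp hu hΩ).clm_apply hY).clm_apply hZ

end DirDeriv

/-! ### Levi-Civita connections on open sets of a vector space -/

section Calculus

variable {X W : Type*} [NormedAddCommGroup X] [NormedSpace ℝ X]
  [NormedAddCommGroup W] [NormedSpace ℝ W]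

/-- `Γ` is the Christoffel form, on the open set `Ω` of a vector space, of the Levi-Civita
connection of the pseudo-Riemannian metric `G`. Nondegeneracy of `G` is not part of the
definition. -/
structure IsLeviCivita (Ω : Set W) (G : W → W →L[ℝ] W →L[ℝ] ℝ) (Γ : W → W →L[ℝ] W →L[ℝ] W) :
    Prop where
  isOpen : IsOpen Ω
  contDiffOn_metric : ContDiffOn ℝ ∞ G Ω
  contDiffOn_form : ContDiffOn ℝ ∞ Γ Ω
  metric_symm : ∀ z ∈ Ω, ∀ a b, G z a b = G z b a
  form_symm : ∀ z ∈ Ω, ∀ a b, Γ z a b = Γ z b a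
  fderiv_metric : ∀ z ∈ Ω, ∀ a b c,
    fderiv ℝ G z a b c = G z (Γ z a b) c + G z b (Γ z a c)

/-- The covariant derivative along the map `u : S → W`, in the direction `ξ`, of the vector field
`Y` along `u`. -/
noncomputable def covDeriv (Γ : W → W →L[ℝ] W →L[ℝ] W) (S : Set X) (u : X → W) (ξ : X)
    (Y : X → W) (x : X) : W :=
  dirDeriv S ξ Y x + Γ (u x) (dirDeriv S ξ u x) (Y x)

/-- The curvature `R(a, b) c` of the connection with Christoffel form `Γ`. -/
noncomputable def curvature (Γ : W → W →L[ℝ] W →L[ℝ] W) (z a b c : W) : W :=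
  fderiv ℝ Γ z a b c - fderiv ℝ Γ z b a c + Γ z a (Γ z b c) - Γ z b (Γ z a c)

variable {S : Set X} {Ω : Set W} {G : W → W →L[ℝ] W →L[ℝ] ℝ} {Γ : W → W →L[ℝ] W →L[ℝ] W}
  {u Y Z : X → W} {x : X}

theorem IsLeviCivita.differentiableAt_metric (h : IsLeviCivita Ω G Γ) {z : W} (hz : z ∈ Ω) :
    DifferentiableAt ℝ G z :=
  (h.contDiffOn_metric.contDiffAt (h.isOpen.mem_nhds hz)).differentiableAt (by simp)

theorem IsLeviCivita.differentiableAt_form (h : IsLeviCivita Ω G Γ) {z : W} (hz : z ∈ Ω) :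
    DifferentiableAt ℝ Γ z :=
  (h.contDiffOn_form.contDiffAt (h.isOpen.mem_nhds hz)).differentiableAt (by simp)

theorem covDeriv_congr (h : EqOn Y Z S) (hx : x ∈ S) (ξ : X) :
    covDeriv Γ S u ξ Y x = covDeriv Γ S u ξ Z x := by
  unfold covDeriv
  rw [dirDeriv_congr h hx, h hx]

theorem covDeriv_contDiffOn (h : IsLeviCivita Ω G Γ) (hS : UniqueDiffOn ℝ S) {k n : ℕ∞ω}
    (hk : k + 1 ≤ n) (hkt : k ≤ ∞) (hu : ContDiffOn ℝ n u S) (hΩ : MapsTo u S Ω)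
    (hY : ContDiffOn ℝ n Y S) (ξ : X) : ContDiffOn ℝ k (covDeriv Γ S u ξ Y) S := by
  have hkn : k ≤ n := le_trans le_self_add hk
  exact (hY.dirDeriv hS hk ξ).add ((h.contDiffOn_form.of_le hkt).bilin (hu.of_le hkn) hΩ
    (hu.dirDeriv hS hk ξ) (hY.of_le hkn))

/-- The Levi-Civita connection is compatible with the metric. -/
theorem IsLeviCivita.dirDeriv_metric (h : IsLeviCivita Ω G Γ) (hS : UniqueDiffOn ℝ S)
    (hΩ : MapsTo u S Ω) (hx : x ∈ S) (hu : DifferentiableWithinAt ℝ u S x)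
    (hY : DifferentiableWithinAt ℝ Y S x) (hZ : DifferentiableWithinAt ℝ Z S x) (ξ : X) :
    dirDeriv S ξ (fun y => G (u y) (Y y) (Z y)) x
      = G (u x) (covDeriv Γ S u ξ Y x) (Z x) + G (u x) (Y x) (covDeriv Γ S u ξ Z x) := by
  rw [dirDeriv_bilin hS hx (h.differentiableAt_metric (hΩ hx)) hu hY hZ,
    h.fderiv_metric _ (hΩ hx)]
  simp only [covDeriv, map_add, add_apply]
  ring

/-- The Levi-Civita connection is torsion free. -/
theorem IsLeviCivita.covDeriv_dirDeriv_comm (h : IsLeviCivita Ω G Γ) (hS : UniqueDiffOn ℝ S)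
    (hS' : S ⊆ closure (interior S)) (hΩ : MapsTo u S Ω) (hu : ContDiffOn ℝ 2 u S) (hx : x ∈ S)
    (ξ η : X) :
    covDeriv Γ S u ξ (dirDeriv S η u) x = covDeriv Γ S u η (dirDeriv S ξ u) x := by
  unfold covDeriv
  rw [dirDeriv_comm hS hS' hu hx, h.form_symm _ (hΩ hx)]

/-- Covariant derivatives along a map commute up to the curvature. -/
theorem IsLeviCivita.covDeriv_comm (h : IsLeviCivita Ω G Γ) (hS : UniqueDiffOn ℝ S)
    (hS' : S ⊆ closure (interior S)) (hΩ : MapsTo u S Ω) (hu : ContDiffOn ℝ 2 u S)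
    (hY : ContDiffOn ℝ 2 Y S) (hx : x ∈ S) (ξ η : X) :
    covDeriv Γ S u ξ (covDeriv Γ S u η Y) x = covDeriv Γ S u η (covDeriv Γ S u ξ Y) x
      + curvature Γ (u x) (dirDeriv S ξ u x) (dirDeriv S η u x) (Y x) := by
  have key : ∀ ζ ζ' : X, covDeriv Γ S u ζ (covDeriv Γ S u ζ' Y) x
      = dirDeriv S ζ (dirDeriv S ζ' Y) x
        + (fderiv ℝ Γ (u x) (dirDeriv S ζ u x) (dirDeriv S ζ' u x) (Y x)
          + Γ (u x) (dirDeriv S ζ (dirDeriv S ζ' u) x) (Y x)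
          + Γ (u x) (dirDeriv S ζ' u x) (dirDeriv S ζ Y x))
        + Γ (u x) (dirDeriv S ζ u x) (dirDeriv S ζ' Y x)
        + Γ (u x) (dirDeriv S ζ u x) (Γ (u x) (dirDeriv S ζ' u x) (Y x)) := fun ζ ζ' => by
    have hY1 := (hY.dirDeriv (k := 1) hS (by norm_num) ζ')
    have hu1 := (hu.dirDeriv (k := 1) hS (by norm_num) ζ')
    have hΓ : ContDiffOn ℝ 1 (fun y => Γ (u y) (dirDeriv S ζ' u y) (Y y)) S :=
      (h.contDiffOn_form.of_le (by simp)).bilin (hu.of_le (by norm_num)) hΩ hu1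
        (hY.of_le (by norm_num))
    have hb := dirDeriv_bilin hS hx (h.differentiableAt_form (hΩ hx))
      (hu.differentiableOn (by norm_num) x hx) (hu1.differentiableOn (by norm_num) x hx)
      (hY.differentiableOn (by norm_num) x hx) ζ
    have ha : dirDeriv S ζ (covDeriv Γ S u ζ' Y) x = dirDeriv S ζ (dirDeriv S ζ' Y) x
        + dirDeriv S ζ (fun y => Γ (u y) (dirDeriv S ζ' u y) (Y y)) x := by
      have : covDeriv Γ S u ζ' Y
          = dirDeriv S ζ' Y + fun y => Γ (u y) (dirDeriv S ζ' u y) (Y y) := rfl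
      rw [this]
      exact dirDeriv_add hS hx (hY1.differentiableOn (by norm_num) x hx)
        (hΓ.differentiableOn (by norm_num) x hx) ζ
    have hc : covDeriv Γ S u ζ (covDeriv Γ S u ζ' Y) x
      = dirDeriv S ζ (covDeriv Γ S u ζ' Y) x
        + Γ (u x) (dirDeriv S ζ u x) (covDeriv Γ S u ζ' Y x) := rfl
    rw [hc, ha, hb]
    simp only [covDeriv, map_add]
    abel
  rw [key, key, dirDeriv_comm hS hS' hY hx ξ η, dirDeriv_comm hS hS' hu hx ξ η]
  unfold curvature
  abel

/-- The Koszul formula for the metric `G(∂u, ∂u)` pulled back by the map `u`. -/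
theorem IsLeviCivita.koszul (h : IsLeviCivita Ω G Γ) (hS : UniqueDiffOn ℝ S)
    (hS' : S ⊆ closure (interior S)) (hΩ : MapsTo u S Ω) (hu : ContDiffOn ℝ 2 u S) (hx : x ∈ S)
    (a b c : X) :
    dirDeriv S a (fun y => G (u y) (dirDeriv S b u y) (dirDeriv S c u y)) x
      + dirDeriv S b (fun y => G (u y) (dirDeriv S a u y) (dirDeriv S c u y)) x
      - dirDeriv S c (fun y => G (u y) (dirDeriv S a u y) (dirDeriv S b u y)) x
      = 2 * G (u x) (covDeriv Γ S u a (dirDeriv S b u) x) (dirDeriv S c u x) := by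
  have hd : ∀ v, DifferentiableWithinAt ℝ (dirDeriv S v u) S x := fun v =>
    (hu.dirDeriv (k := 1) hS (by norm_num) v).differentiableOn (by norm_num) x hx
  have hu0 := hu.differentiableOn (by norm_num) x hx
  have hc := h.covDeriv_dirDeriv_comm hS hS' hΩ hu hx
  simp only [h.dirDeriv_metric hS hΩ hx hu0 (hd _) (hd _)]
  rw [hc b a, hc c a, hc c b, h.metric_symm _ (hΩ hx) (dirDeriv S b u x),
    h.metric_symm _ (hΩ hx) (dirDeriv S a u x)]
  ring

end Calculus

/-! ### Frames made of tangent vectors and a time-like unit normal -/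

section FrameAlgebra

variable {W ι : Type*} [AddCommGroup W] [Module ℝ W] [FiniteDimensional ℝ W]
  [Fintype ι] [DecidableEq ι]

/-- Expansion of a vector in the frame made of vectors `f i` with invertible Gram matrix and of a
unit time-like vector `n` orthogonal to them. -/
theorem frame_expansion (B : W →ₗ[ℝ] W →ₗ[ℝ] ℝ) (f : ι → W) (n : W)
    (hdim : Module.finrank ℝ W = Fintype.card ι + 1)
    (hdet : (Matrix.of fun i j => B (f i) (f j)).det ≠ 0)
    (hfn : ∀ i, B (f i) n = 0) (hnf : ∀ i, B n (f i) = 0) (hnn : B n n = -1) (x : W) :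
    x = ∑ i, (∑ j, B x (f j) * (Matrix.of fun i j => B (f i) (f j))⁻¹ j i) • f i
      - B x n • n := by
  set g : Matrix ι ι ℝ := Matrix.of fun i j => B (f i) (f j) with hg
  have hginv : g⁻¹ * g = 1 := Matrix.nonsing_inv_mul g (isUnit_iff_ne_zero.2 hdet)
  let L : W →ₗ[ℝ] (ι → ℝ) × ℝ :=
    (LinearMap.pi fun j => B.flip (f j)).prod (B.flip n)
  -- `R` is a right inverse of `L`
  have hR : ∀ (c : ι → ℝ) (d : ℝ),
      L (∑ i, (∑ j, c j * g⁻¹ j i) • f i - d • n) = (c, d) := by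
    intro c d
    refine Prod.ext (funext fun k => ?_) ?_
    · have h1 : ∑ i, (∑ j, c j * g⁻¹ j i) * g i k = c k := by
        have : Matrix.vecMul (Matrix.vecMul c g⁻¹) g k = c k := by
          rw [Matrix.vecMul_vecMul, hginv, Matrix.vecMul_one]
        simpa [Matrix.vecMul, dotProduct] using this
      have h2 : (L (∑ i, (∑ j, c j * g⁻¹ j i) • f i - d • n)).1 k
          = ∑ i, (∑ j, c j * g⁻¹ j i) * B (f i) (f k) - d * B n (f k) := by
        simp [L, LinearMap.sum_apply]
      rw [h2, hnf]
      simpa [hg] using h1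
    · have h2 : (L (∑ i, (∑ j, c j * g⁻¹ j i) • f i - d • n)).2
          = ∑ i, (∑ j, c j * g⁻¹ j i) * B (f i) n - d * B n n := by
        simp [L, LinearMap.sum_apply]
      rw [h2, hnn]
      simp [hfn]
  have hsurj : Function.Surjective L := fun y => ⟨_, hR y.1 y.2⟩
  have hinj : Function.Injective L :=
    (LinearMap.injective_iff_surjective_of_finrank_eq_finrank (by simp [hdim])).2 hsurj
  refine hinj ?_
  rw [hR]
  rfl

/-- Parseval's identity in the frame of `frame_expansion`. -/
theorem frame_inner (B : W →ₗ[ℝ] W →ₗ[ℝ] ℝ) (f : ι → W) (n : W)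
    (hdim : Module.finrank ℝ W = Fintype.card ι + 1)
    (hdet : (Matrix.of fun i j => B (f i) (f j)).det ≠ 0)
    (hfn : ∀ i, B (f i) n = 0) (hnf : ∀ i, B n (f i) = 0) (hnn : B n n = -1) (x y : W) :
    B x y = ∑ i, ∑ j, (Matrix.of fun i j => B (f i) (f j))⁻¹ i j * B x (f i) * B (f j) y
      - B x n * B n y := by
  have h := congrArg (fun v => B v y) (frame_expansion B f n hdim hdet hfn hnf hnn x)
  simp only [map_sub, map_sum, map_smul, LinearMap.sub_apply, LinearMap.sum_apply,
    LinearMap.smul_apply, smul_eq_mul] at h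
  rw [h, Finset.sum_comm]
  congr 1
  refine Finset.sum_congr rfl fun i _ => ?_
  rw [Finset.sum_mul]
  exact Finset.sum_congr rfl fun j _ => by ring

/-- The trace of an endomorphism, computed in the frame of `frame_expansion`. For
`T = R(·, n) n` the normal term vanishes, which expresses `Ric(n, n)` by tangential components. -/
theorem trace_eq_frame (B : W →ₗ[ℝ] W →ₗ[ℝ] ℝ) (f : ι → W) (n : W)
    (hdim : Module.finrank ℝ W = Fintype.card ι + 1)
    (hdet : (Matrix.of fun i j => B (f i) (f j)).det ≠ 0)
    (hfn : ∀ i, B (f i) n = 0) (hnf : ∀ i, B n (f i) = 0) (hnn : B n n = -1) (T : W →ₗ[ℝ] W) :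
    LinearMap.trace ℝ W T
      = ∑ i, ∑ j, (Matrix.of fun i j => B (f i) (f j))⁻¹ i j * B (T (f j)) (f i)
        - B (T n) n := by
  have h : T = ∑ i, ∑ j, (Matrix.of fun i j => B (f i) (f j))⁻¹ i j •
      (B.flip (f i)).smulRight (T (f j)) - (B.flip n).smulRight (T n) := by
    refine LinearMap.ext fun x => ?_
    conv_lhs => rw [frame_expansion B f n hdim hdet hfn hnf hnn x]
    simp only [map_sub, map_sum, map_smul, LinearMap.sub_apply, LinearMap.sum_apply,
      LinearMap.smul_apply, LinearMap.smulRight_apply, LinearMap.flip_apply]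
    rw [Finset.sum_comm]
    congr 1
    refine Finset.sum_congr rfl fun i _ => ?_
    rw [Finset.sum_smul]
    refine Finset.sum_congr rfl fun j _ => ?_
    rw [smul_smul, mul_comm]
  conv_lhs => rw [h]
  simp only [map_sub, map_sum, map_smul, LinearMap.trace_smulRight, LinearMap.flip_apply,
    smul_eq_mul]

end FrameAlgebra

/-! ### Derivatives of inverse matrices -/

section MatrixInverse

variable {X ι : Type*} [NormedAddCommGroup X] [NormedSpace ℝ X] [Fintype ι] [DecidableEq ι]
  {S : Set X} {A : X → Matrix ι ι ℝ} {k : ℕ∞ω} {x : X}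

theorem contDiffOn_matrix_det (hA : ∀ i j, ContDiffOn ℝ k (fun x => A x i j) S) :
    ContDiffOn ℝ k (fun x => (A x).det) S := by
  simp only [Matrix.det_apply]
  exact ContDiffOn.sum fun σ _ => (contDiffOn_prod fun i _ => hA _ _).const_smul _

theorem contDiffOn_matrix_inv (hA : ∀ i j, ContDiffOn ℝ k (fun x => A x i j) S)
    (hdet : ∀ x ∈ S, (A x).det ≠ 0) (i j : ι) : ContDiffOn ℝ k (fun x => (A x)⁻¹ i j) S := by
  simp only [Matrix.inv_def, Ring.inverse_eq_inv', Matrix.smul_apply, smul_eq_mul,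
    Matrix.adjugate_apply]
  refine ((contDiffOn_matrix_det hA).inv hdet).mul (contDiffOn_matrix_det fun a b => ?_)
  by_cases h : a = j
  · subst h
    simpa using contDiffOn_const
  · simpa [Matrix.updateRow_ne h] using hA a b

theorem dirDeriv_matrix_inv (hS : UniqueDiffOn ℝ S) (hx : x ∈ S) (hk : k ≠ 0)
    (hA : ∀ i j, ContDiffOn ℝ k (fun x => A x i j) S)
    (hdet : ∀ x ∈ S, (A x).det ≠ 0) (ξ : X) (i j : ι) :
    dirDeriv S ξ (fun x => (A x)⁻¹ i j) x
      = -∑ a, ∑ b, (A x)⁻¹ i a * dirDeriv S ξ (fun x => A x a b) x * (A x)⁻¹ b j := by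
  have hAd := fun i j => (hA i j).differentiableOn hk x hx
  have hPd := fun i j => (contDiffOn_matrix_inv hA hdet i j).differentiableOn hk x hx
  let DA : Matrix ι ι ℝ := Matrix.of fun i j => dirDeriv S ξ (fun x => A x i j) x
  let DP : Matrix ι ι ℝ := Matrix.of fun i j => dirDeriv S ξ (fun x => (A x)⁻¹ i j) x
  have h1 : (A x)⁻¹ * DA + DP * A x = 0 := by
    ext i j
    have hc : EqOn (fun y => ∑ k, (A y)⁻¹ i k * A y k j) (fun _ => (1 : Matrix ι ι ℝ) i j) S :=
      fun y hy => by
        have := congrFun (congrFun (Matrix.nonsing_inv_mul (A y)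
          (isUnit_iff_ne_zero.2 (hdet y hy))) i) j
        rwa [Matrix.mul_apply] at this
    have h2 := dirDeriv_congr hc hx ξ
    rw [dirDeriv_const, dirDeriv_sum (φ := fun k y => (A y)⁻¹ i k * A y k j) _ hS hx
      (fun k _ => (hPd i k).mul (hAd k j))] at h2
    simp only [dirDeriv_mul hS hx (hPd _ _) (hAd _ _), Finset.sum_add_distrib] at h2
    simpa [Matrix.mul_apply, DA, DP] using h2
  have h3 : DP = -((A x)⁻¹ * DA * (A x)⁻¹) := by
    have h4 : DP * A x * (A x)⁻¹ = DP :=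
      Matrix.mul_nonsing_inv_cancel_right _ _ (isUnit_iff_ne_zero.2 (hdet x hx))
    rw [← h4, eq_neg_of_add_eq_zero_right h1, Matrix.neg_mul]
  have h5 := congrFun (congrFun h3 i) j
  simp only [DP, DA, Matrix.of_apply, Matrix.neg_apply, Matrix.mul_apply, Finset.sum_mul] at h5
  rw [h5, Finset.sum_comm]

end MatrixInverse

/-! ### Hypersurfaces moving in normal direction, in coordinates -/

section NormalFlow

variable {X W ι : Type*} [NormedAddCommGroup X] [NormedSpace ℝ X]
  [NormedAddCommGroup W] [NormedSpace ℝ W] [Fintype ι] [DecidableEq ι]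

/-- The Gram matrix of the coordinate vector fields `∂u/∂eᵢ`. -/
noncomputable def gram (G : W → W →L[ℝ] W →L[ℝ] ℝ) (S : Set X) (e : ι → X) (u : X → W) (x : X) :
    Matrix ι ι ℝ :=
  Matrix.of fun i j => G (u x) (dirDeriv S (e i) u x) (dirDeriv S (e j) u x)

/-- The second fundamental form of `u`, restricted to the directions `eᵢ`, with respect to the
normal field `n`. -/
noncomputable def sff (G : W → W →L[ℝ] W →L[ℝ] ℝ) (Γ : W → W →L[ℝ] W →L[ℝ] W) (S : Set X)
    (e : ι → X) (u n : X → W) (i j : ι) (x : X) : ℝ :=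
  G (u x) (covDeriv Γ S u (e i) (dirDeriv S (e j) u) x) (n x)

/-- A family of hypersurfaces in local coordinates, which moves in normal direction: the
parameter domain `S` has the spatial coordinate directions `eᵢ` and the time direction `es`, the
hypersurfaces are parametrized by `u`, have the time-like unit normal `n`, and move with
velocity `-w n`. -/
structure NormalFlow (S : Set X) (Ω : Set W) (G : W → W →L[ℝ] W →L[ℝ] ℝ)
    (Γ : W → W →L[ℝ] W →L[ℝ] W) (e : ι → X) (es : X) (u n : X → W) (w : X → ℝ) : Prop where
  leviCivita : IsLeviCivita Ω G Γ
  uniqueDiffOn : UniqueDiffOn ℝ S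
  subset_closure : S ⊆ closure (interior S)
  mapsTo : MapsTo u S Ω
  contDiffOn_map : ContDiffOn ℝ 3 u S
  contDiffOn_normal : ContDiffOn ℝ 2 n S
  velocity : ∀ x ∈ S, dirDeriv S es u x = -(w x • n x)
  normal_orthogonal : ∀ x ∈ S, ∀ i, G (u x) (n x) (dirDeriv S (e i) u x) = 0
  normal_unit : ∀ x ∈ S, G (u x) (n x) (n x) = -1
  det_gram : ∀ x ∈ S, (gram G S e u x).det ≠ 0
  finrank_eq : Module.finrank ℝ W = Fintype.card ι + 1

namespace NormalFlow

variable {S : Set X} {Ω : Set W} {G : W → W →L[ℝ] W →L[ℝ] ℝ} {Γ : W → W →L[ℝ] W →L[ℝ] W}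
  {e : ι → X} {es : X} {u n : X → W} {w : X → ℝ} {x : X}

theorem contDiffOn_tangent (h : NormalFlow S Ω G Γ e es u n w) (ξ : X) :
    ContDiffOn ℝ 2 (dirDeriv S ξ u) S :=
  h.contDiffOn_map.dirDeriv h.uniqueDiffOn (by norm_num) ξ

theorem contDiffOn_map_two (h : NormalFlow S Ω G Γ e es u n w) : ContDiffOn ℝ 2 u S :=
  h.contDiffOn_map.of_le (by norm_num)

theorem differentiable_map (h : NormalFlow S Ω G Γ e es u n w) (hx : x ∈ S) :
    DifferentiableWithinAt ℝ u S x :=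
  h.contDiffOn_map.differentiableOn (by norm_num) x hx

theorem differentiable_tangent (h : NormalFlow S Ω G Γ e es u n w) (hx : x ∈ S) (ξ : X) :
    DifferentiableWithinAt ℝ (dirDeriv S ξ u) S x :=
  (h.contDiffOn_tangent ξ).differentiableOn (by norm_num) x hx

theorem differentiable_normal (h : NormalFlow S Ω G Γ e es u n w) (hx : x ∈ S) :
    DifferentiableWithinAt ℝ n S x :=
  h.contDiffOn_normal.differentiableOn (by norm_num) x hx

theorem speed_eq (h : NormalFlow S Ω G Γ e es u n w) (hx : x ∈ S) :
    w x = G (u x) (dirDeriv S es u x) (n x) := by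
  rw [h.velocity x hx]
  simp [h.normal_unit x hx]

/-- The equation of motion gives the speed as `G(∂u/∂s, n)`, so that it is as regular as `∂u/∂s` and
`n`; its definition through the mean curvature would only give `C¹`. -/
theorem contDiffOn_speed (h : NormalFlow S Ω G Γ e es u n w) : ContDiffOn ℝ 2 w S :=
  ((h.leviCivita.contDiffOn_metric.of_le (by norm_cast)).bilin h.contDiffOn_map_two
    h.mapsTo (h.contDiffOn_tangent es) h.contDiffOn_normal).congr fun _ hx => h.speed_eq hx

theorem differentiable_speed (h : NormalFlow S Ω G Γ e es u n w) (hx : x ∈ S) :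
    DifferentiableWithinAt ℝ w S x :=
  h.contDiffOn_speed.differentiableOn (by norm_num) x hx

theorem contDiffOn_gram (h : NormalFlow S Ω G Γ e es u n w) (i j : ι) :
    ContDiffOn ℝ 2 (fun x => gram G S e u x i j) S :=
  (h.leviCivita.contDiffOn_metric.of_le (by norm_cast)).bilin h.contDiffOn_map_two
    h.mapsTo (h.contDiffOn_tangent _) (h.contDiffOn_tangent _)

theorem contDiffOn_sff (h : NormalFlow S Ω G Γ e es u n w) (i j : ι) :
    ContDiffOn ℝ 1 (sff G Γ S e u n i j) S :=
  (h.leviCivita.contDiffOn_metric.of_le (by norm_cast)).bilin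
    (h.contDiffOn_map.of_le (by norm_num)) h.mapsTo
    (covDeriv_contDiffOn h.leviCivita h.uniqueDiffOn (n := 2) (by norm_num)
      (by norm_cast) h.contDiffOn_map_two h.mapsTo (h.contDiffOn_tangent _) _)
    (h.contDiffOn_normal.of_le (by norm_num))

theorem sff_symm (h : NormalFlow S Ω G Γ e es u n w) (hx : x ∈ S) (i j : ι) :
    sff G Γ S e u n i j x = sff G Γ S e u n j i x := by
  unfold sff
  rw [h.leviCivita.covDeriv_dirDeriv_comm h.uniqueDiffOn h.subset_closure h.mapsTo
    h.contDiffOn_map_two hx]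

/-- The Weingarten equation. -/
theorem sff_eq_neg (h : NormalFlow S Ω G Γ e es u n w) (hx : x ∈ S) (i j : ι) :
    sff G Γ S e u n i j x
      = -G (u x) (covDeriv Γ S u (e i) n x) (dirDeriv S (e j) u x) := by
  have h1 := h.leviCivita.dirDeriv_metric h.uniqueDiffOn h.mapsTo hx (h.differentiable_map hx)
    (h.differentiable_normal hx) (h.differentiable_tangent hx (e j)) (e i)
  rw [dirDeriv_congr (ψ := fun _ => (0 : ℝ)) (fun y hy => h.normal_orthogonal y hy j) hx,
    dirDeriv_const, h.leviCivita.metric_symm _ (h.mapsTo hx) (n x)] at h1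
  unfold sff
  linarith

/-- The derivatives of the unit normal are tangential. -/
theorem covDeriv_normal_normal (h : NormalFlow S Ω G Γ e es u n w) (hx : x ∈ S) (ξ : X) :
    G (u x) (covDeriv Γ S u ξ n x) (n x) = 0 := by
  have h1 := h.leviCivita.dirDeriv_metric h.uniqueDiffOn h.mapsTo hx (h.differentiable_map hx)
    (h.differentiable_normal hx) (h.differentiable_normal hx) ξ
  rw [dirDeriv_congr (ψ := fun _ => (-1 : ℝ)) (fun y hy => h.normal_unit y hy) hx,
    dirDeriv_const, h.leviCivita.metric_symm _ (h.mapsTo hx) (n x)] at h1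
  linarith

/-- The time derivative of the coordinate vector fields: `∇ₛ ∂ᵢu = ∇ᵢ ∂ₛu = -∇ᵢ(w n)`. -/
theorem covDeriv_time_tangent (h : NormalFlow S Ω G Γ e es u n w) (hx : x ∈ S) (i : ι) :
    covDeriv Γ S u es (dirDeriv S (e i) u) x
      = -(w x • covDeriv Γ S u (e i) n x + dirDeriv S (e i) w x • n x) := by
  rw [h.leviCivita.covDeriv_dirDeriv_comm h.uniqueDiffOn h.subset_closure h.mapsTo
    h.contDiffOn_map_two hx, covDeriv_congr (fun y hy => h.velocity y hy) hx]
  unfold covDeriv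
  rw [dirDeriv_neg h.uniqueDiffOn hx, dirDeriv_smul h.uniqueDiffOn hx (h.differentiable_speed hx)
    (h.differentiable_normal hx)]
  simp only [map_neg, map_smul, smul_add]
  abel

/-- The evolution of the induced metric. -/
theorem dirDeriv_gram (h : NormalFlow S Ω G Γ e es u n w) (hx : x ∈ S) (i j : ι) :
    dirDeriv S es (fun y => gram G S e u y i j) x = 2 * w x * sff G Γ S e u n i j x := by
  have h1 := h.leviCivita.dirDeriv_metric h.uniqueDiffOn h.mapsTo hx (h.differentiable_map hx)
    (h.differentiable_tangent hx (e i)) (h.differentiable_tangent hx (e j)) es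
  rw [h.covDeriv_time_tangent hx, h.covDeriv_time_tangent hx,
    h.leviCivita.metric_symm _ (h.mapsTo hx) (dirDeriv S (e i) u x)] at h1
  simp only [map_neg, map_add, map_smul, neg_apply, add_apply, smul_apply,
    h.normal_orthogonal x hx, smul_eq_mul] at h1
  have h2 := h.sff_eq_neg hx i j
  have h3 := h.sff_eq_neg hx j i
  rw [h.sff_symm hx j i] at h3
  simp only [gram, Matrix.of_apply]
  rw [h1]
  linear_combination (-w x) * h2 - w x * h3

/-- The time derivative of the normal is minus the gradient of the speed. -/
theorem covDeriv_time_normal (h : NormalFlow S Ω G Γ e es u n w) (hx : x ∈ S) (k : ι) :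
    G (u x) (covDeriv Γ S u es n x) (dirDeriv S (e k) u x) = -dirDeriv S (e k) w x := by
  have h1 := h.leviCivita.dirDeriv_metric h.uniqueDiffOn h.mapsTo hx (h.differentiable_map hx)
    (h.differentiable_normal hx) (h.differentiable_tangent hx (e k)) es
  rw [dirDeriv_congr (ψ := fun _ => (0 : ℝ)) (fun y hy => h.normal_orthogonal y hy k) hx,
    dirDeriv_const, h.covDeriv_time_tangent hx,
    h.leviCivita.metric_symm _ (h.mapsTo hx) (n x)] at h1
  simp only [map_neg, map_add, map_smul, neg_apply, add_apply, smul_apply,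
    h.covDeriv_normal_normal hx, h.normal_unit x hx, smul_eq_mul] at h1
  linarith

theorem finiteDimensional (h : NormalFlow S Ω G Γ e es u n w) : FiniteDimensional ℝ W :=
  FiniteDimensional.of_finrank_pos (by rw [h.finrank_eq]; exact Nat.succ_pos _)

theorem inner_eq_frame (h : NormalFlow S Ω G Γ e es u n w) (hx : x ∈ S) (a b : W) :
    G (u x) a b = ∑ i, ∑ j, (gram G S e u x)⁻¹ i j * G (u x) a (dirDeriv S (e i) u x)
      * G (u x) (dirDeriv S (e j) u x) b - G (u x) a (n x) * G (u x) (n x) b :=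
  have := h.finiteDimensional
  frame_inner (ContinuousLinearMap.toLinearMap₁₂ (G (u x)))
    (fun i => dirDeriv S (e i) u x) (n x) h.finrank_eq (h.det_gram x hx)
    (fun i => (h.leviCivita.metric_symm _ (h.mapsTo hx) _ _).trans (h.normal_orthogonal x hx i))
    (h.normal_orthogonal x hx) (h.normal_unit x hx) a b

theorem trace_eq (h : NormalFlow S Ω G Γ e es u n w) (hx : x ∈ S) (T : W →ₗ[ℝ] W) :
    LinearMap.trace ℝ W T = ∑ i, ∑ j, (gram G S e u x)⁻¹ i j *
      G (u x) (T (dirDeriv S (e j) u x)) (dirDeriv S (e i) u x) - G (u x) (T (n x)) (n x) :=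
  have := h.finiteDimensional
  trace_eq_frame (ContinuousLinearMap.toLinearMap₁₂ (G (u x)))
    (fun i => dirDeriv S (e i) u x) (n x) h.finrank_eq (h.det_gram x hx)
    (fun i => (h.leviCivita.metric_symm _ (h.mapsTo hx) _ _).trans (h.normal_orthogonal x hx i))
    (h.normal_orthogonal x hx) (h.normal_unit x hx) T

/-- The evolution of the second fundamental form: its time derivative is the Hessian of the speed,
plus a term quadratic in the second fundamental form, minus a curvature term. Since the second
fundamental form is only `C¹`, the Weingarten equation is differentiated, and `∇ₛ ∇ᵢ n` is replaced
by `∇ᵢ ∇ₛ n` and the curvature. -/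
theorem dirDeriv_sff (h : NormalFlow S Ω G Γ e es u n w) (hx : x ∈ S) (i j : ι) :
    dirDeriv S es (sff G Γ S e u n i j) x
      = dirDeriv S (e i) (dirDeriv S (e j) w) x
        - ∑ k, ∑ l, (gram G S e u x)⁻¹ k l * dirDeriv S (e k) w x *
          G (u x) (dirDeriv S (e l) u x) (covDeriv Γ S u (e i) (dirDeriv S (e j) u) x)
        + w x * ∑ k, ∑ l, (gram G S e u x)⁻¹ k l * sff G Γ S e u n i k x * sff G Γ S e u n j l x
        - w x * G (u x) (curvature Γ (u x) (dirDeriv S (e i) u x) (n x) (n x))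
          (dirDeriv S (e j) u x) := by
  have hLC := h.leviCivita
  have hsym := hLC.metric_symm _ (h.mapsTo hx)
  have hcn : ∀ ξ, ContDiffOn ℝ 1 (covDeriv Γ S u ξ n) S := fun ξ =>
    covDeriv_contDiffOn hLC h.uniqueDiffOn (n := 2) (by norm_num)
      (by norm_cast) h.contDiffOn_map_two h.mapsTo h.contDiffOn_normal _
  have hdn : ∀ ξ, DifferentiableWithinAt ℝ (covDeriv Γ S u ξ n) S x := fun ξ =>
    (hcn ξ).differentiableOn (by norm_num) x hx
  have h1 : dirDeriv S es (sff G Γ S e u n i j) x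
      = -(G (u x) (covDeriv Γ S u es (covDeriv Γ S u (e i) n) x) (dirDeriv S (e j) u x)
        + G (u x) (covDeriv Γ S u (e i) n x) (covDeriv Γ S u es (dirDeriv S (e j) u) x)) := by
    rw [dirDeriv_congr (fun y hy => h.sff_eq_neg hy i j) hx, dirDeriv_neg h.uniqueDiffOn hx,
      hLC.dirDeriv_metric h.uniqueDiffOn h.mapsTo hx (h.differentiable_map hx)
        (hdn _) (h.differentiable_tangent hx (e j))]
  have h2 : G (u x) (covDeriv Γ S u (e i) (covDeriv Γ S u es n) x) (dirDeriv S (e j) u x)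
      = -dirDeriv S (e i) (dirDeriv S (e j) w) x
        - G (u x) (covDeriv Γ S u es n x) (covDeriv Γ S u (e i) (dirDeriv S (e j) u) x) := by
    have h3 := hLC.dirDeriv_metric h.uniqueDiffOn h.mapsTo hx (h.differentiable_map hx)
      (hdn es) (h.differentiable_tangent hx (e j)) (e i)
    rw [dirDeriv_congr (fun y hy => h.covDeriv_time_normal hy j) hx,
      dirDeriv_neg h.uniqueDiffOn hx] at h3
    linarith
  have h4 : G (u x) (covDeriv Γ S u es n x) (covDeriv Γ S u (e i) (dirDeriv S (e j) u) x)
      = -∑ k, ∑ l, (gram G S e u x)⁻¹ k l * dirDeriv S (e k) w x *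
          G (u x) (dirDeriv S (e l) u x) (covDeriv Γ S u (e i) (dirDeriv S (e j) u) x) := by
    rw [h.inner_eq_frame hx, h.covDeriv_normal_normal hx, zero_mul, sub_zero,
      ← Finset.sum_neg_distrib]
    refine Finset.sum_congr rfl fun k _ => ?_
    rw [← Finset.sum_neg_distrib]
    refine Finset.sum_congr rfl fun l _ => ?_
    rw [h.covDeriv_time_normal hx]
    ring
  have h5 : G (u x) (covDeriv Γ S u (e i) n x) (covDeriv Γ S u (e j) n x)
      = ∑ k, ∑ l, (gram G S e u x)⁻¹ k l * sff G Γ S e u n i k x * sff G Γ S e u n j l x := by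
    rw [h.inner_eq_frame hx, h.covDeriv_normal_normal hx, zero_mul, sub_zero]
    refine Finset.sum_congr rfl fun k _ => Finset.sum_congr rfl fun l _ => ?_
    rw [h.sff_eq_neg hx, h.sff_eq_neg hx, hsym (dirDeriv S (e l) u x)]
    ring
  have hcurv : curvature Γ (u x) (dirDeriv S es u x) (dirDeriv S (e i) u x) (n x)
      = w x • curvature Γ (u x) (dirDeriv S (e i) u x) (n x) (n x) := by
    rw [h.velocity x hx]
    simp only [curvature, map_neg, map_smul, neg_apply, smul_apply, smul_add, smul_sub]
    abel
  rw [h1, hLC.covDeriv_comm h.uniqueDiffOn h.subset_closure h.mapsTo h.contDiffOn_map_two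
    h.contDiffOn_normal hx, hcurv, h.covDeriv_time_tangent hx]
  simp only [map_neg, map_add, map_smul, add_apply, smul_apply, smul_eq_mul,
    h.covDeriv_normal_normal hx]
  rw [h2, h4, h5]
  ring

theorem gram_inv_symm (h : NormalFlow S Ω G Γ e es u n w) (hx : x ∈ S) (i j : ι) :
    (gram G S e u x)⁻¹ i j = (gram G S e u x)⁻¹ j i := by
  have h1 : (gram G S e u x).transpose = gram G S e u x := by
    ext i j
    exact h.leviCivita.metric_symm _ (h.mapsTo hx) _ _
  have h2 := congrFun (congrFun (Matrix.transpose_nonsing_inv (gram G S e u x)) j) i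
  rwa [h1] at h2

theorem contDiffOn_gram_inv (h : NormalFlow S Ω G Γ e es u n w) (i j : ι) :
    ContDiffOn ℝ 2 (fun x => (gram G S e u x)⁻¹ i j) S :=
  contDiffOn_matrix_inv h.contDiffOn_gram h.det_gram i j

theorem contDiffOn_meanCurvature (h : NormalFlow S Ω G Γ e es u n w) :
    ContDiffOn ℝ 1 (fun y => ∑ i, ∑ j, (gram G S e u y)⁻¹ i j * sff G Γ S e u n i j y) S :=
  ContDiffOn.sum fun i _ => ContDiffOn.sum fun j _ =>
    ((h.contDiffOn_gram_inv i j).of_le (by norm_num)).mul (h.contDiffOn_sff i j)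

/-- The evolution of the mean curvature, in local coordinates: minus the Laplacian of the speed `w`,
minus `w` times the squared norm of the second fundamental form plus the trace of `R(·, n) n`. The
Christoffel symbols of the hypersurface appear as tangential components of `∇ᵢ ∂ⱼu`. -/
theorem dirDeriv_meanCurvature (h : NormalFlow S Ω G Γ e es u n w) (hx : x ∈ S) (T : W →ₗ[ℝ] W)
    (hT : ∀ a, T a = curvature Γ (u x) a (n x) (n x)) :
    dirDeriv S es
        (fun y => ∑ i, ∑ j, (gram G S e u y)⁻¹ i j * sff G Γ S e u n i j y) x
      = ∑ i, ∑ j, (gram G S e u x)⁻¹ i j * (dirDeriv S (e i) (dirDeriv S (e j) w) x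
          - ∑ k, (∑ l, (gram G S e u x)⁻¹ k l * G (u x) (dirDeriv S (e l) u x)
            (covDeriv Γ S u (e i) (dirDeriv S (e j) u) x)) * dirDeriv S (e k) w x)
        - w x * (∑ i, ∑ j, ∑ k, ∑ l, (gram G S e u x)⁻¹ i k * (gram G S e u x)⁻¹ j l
            * sff G Γ S e u n i j x * sff G Γ S e u n k l x + LinearMap.trace ℝ W T) := by
  have hPd : ∀ i j, DifferentiableWithinAt ℝ (fun x => (gram G S e u x)⁻¹ i j) S x := fun i j =>
    (h.contDiffOn_gram_inv i j).differentiableOn (by norm_num) x hx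
  have hsd : ∀ i j, DifferentiableWithinAt ℝ (sff G Γ S e u n i j) S x := fun i j =>
    (h.contDiffOn_sff i j).differentiableOn (by norm_num) x hx
  have hTn : T (n x) = 0 := by
    rw [hT, curvature]
    abel
  have hsum : dirDeriv S es
        (fun y => ∑ i, ∑ j, (gram G S e u y)⁻¹ i j * sff G Γ S e u n i j y) x
      = ∑ i, ∑ j, ((gram G S e u x)⁻¹ i j * dirDeriv S es (sff G Γ S e u n i j) x
        + dirDeriv S es (fun y => (gram G S e u y)⁻¹ i j) x * sff G Γ S e u n i j x) := by
    rw [dirDeriv_sum (φ := fun i y => ∑ j, (gram G S e u y)⁻¹ i j * sff G Γ S e u n i j y) _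
      h.uniqueDiffOn hx (fun i _ => DifferentiableWithinAt.fun_sum fun j _ =>
        (hPd i j).mul (hsd i j))]
    refine Finset.sum_congr rfl fun i _ => ?_
    rw [dirDeriv_sum (φ := fun j y => (gram G S e u y)⁻¹ i j * sff G Γ S e u n i j y) _
      h.uniqueDiffOn hx (fun j _ => (hPd i j).mul (hsd i j))]
    exact Finset.sum_congr rfl fun j _ => dirDeriv_mul h.uniqueDiffOn hx (hPd i j) (hsd i j) es
  have hinv : ∀ i j, dirDeriv S es (fun y => (gram G S e u y)⁻¹ i j) x
      = -(2 * w x * ∑ a, ∑ b, (gram G S e u x)⁻¹ i a * (gram G S e u x)⁻¹ j b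
        * sff G Γ S e u n a b x) := fun i j => by
    rw [dirDeriv_matrix_inv h.uniqueDiffOn hx (k := 2) (by norm_num) h.contDiffOn_gram
      h.det_gram es i j, Finset.mul_sum]
    congr 1
    refine Finset.sum_congr rfl fun a _ => ?_
    rw [Finset.mul_sum]
    refine Finset.sum_congr rfl fun b _ => ?_
    rw [h.dirDeriv_gram hx, h.gram_inv_symm hx b j]
    ring
  set P := (gram G S e u x)⁻¹ with hP
  set A := sff G Γ S e u n with hA
  -- The second fundamental form contributes a Hessian, a quadratic and a curvature term; the
  -- inverse Gram matrix contributes minus twice the same quadratic term, after summation.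
  have hlap : ∀ i j, P i j * dirDeriv S es (A i j) x
      + dirDeriv S es (fun y => (gram G S e u y)⁻¹ i j) x * A i j x
      = P i j * (dirDeriv S (e i) (dirDeriv S (e j) w) x
          - ∑ k, (∑ l, P k l * G (u x) (dirDeriv S (e l) u x)
            (covDeriv Γ S u (e i) (dirDeriv S (e j) u) x)) * dirDeriv S (e k) w x)
        + w x * (∑ k, ∑ l, P i j * P k l * A i k x * A j l x)
        - 2 * w x * (∑ k, ∑ l, P i k * P j l * A i j x * A k l x)
        - w x * (P i j * G (u x) (T (dirDeriv S (e i) u x)) (dirDeriv S (e j) u x)) := by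
    intro i j
    rw [h.dirDeriv_sff hx i j, hinv, hT]
    have e1 : ∑ k, (∑ l, P k l * G (u x) (dirDeriv S (e l) u x)
            (covDeriv Γ S u (e i) (dirDeriv S (e j) u) x)) * dirDeriv S (e k) w x
        = ∑ k, ∑ l, P k l * dirDeriv S (e k) w x * G (u x) (dirDeriv S (e l) u x)
            (covDeriv Γ S u (e i) (dirDeriv S (e j) u) x) := by
      refine Finset.sum_congr rfl fun k _ => ?_
      rw [Finset.sum_mul]
      exact Finset.sum_congr rfl fun l _ => by ring
    have e2 : ∑ k, ∑ l, P i j * P k l * A i k x * A j l x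
        = P i j * ∑ k, ∑ l, P k l * A i k x * A j l x := by
      simp only [Finset.mul_sum]
      exact Finset.sum_congr rfl fun k _ => Finset.sum_congr rfl fun l _ => by ring
    have e3 : ∑ k, ∑ l, P i k * P j l * A i j x * A k l x
        = (∑ k, ∑ l, P i k * P j l * A k l x) * A i j x := by
      simp only [Finset.sum_mul]
      exact Finset.sum_congr rfl fun k _ => Finset.sum_congr rfl fun l _ => by ring
    rw [e1, e2, e3]
    ring
  have hquad : ∑ i, ∑ j, ∑ k, ∑ l, P i j * P k l * A i k x * A j l x
      = ∑ i, ∑ j, ∑ k, ∑ l, P i k * P j l * A i j x * A k l x := by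
    refine Finset.sum_congr rfl fun i _ => ?_
    rw [Finset.sum_comm]
  have htr : LinearMap.trace ℝ W T = ∑ i, ∑ j,
      P i j * G (u x) (T (dirDeriv S (e i) u x)) (dirDeriv S (e j) u x) := by
    rw [h.trace_eq hx T, hTn, map_zero, zero_apply, sub_zero, Finset.sum_comm]
    refine Finset.sum_congr rfl fun i _ => Finset.sum_congr rfl fun j _ => ?_
    rw [h.gram_inv_symm hx j i]
  rw [hsum, htr]
  simp only [hlap, Finset.sum_add_distrib, Finset.sum_sub_distrib, ← Finset.mul_sum]
  rw [hquad]
  ring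

end NormalFlow

end NormalFlow

/-! ### Christoffel symbols and Ricci curvature as multilinear maps -/

theorem contDiffOn_smul_const {V W : Type*} [NormedAddCommGroup V] [NormedSpace ℝ V]
    [NormedAddCommGroup W] [NormedSpace ℝ W] {φ : V → ℝ} {Ω : Set V} {k : ℕ∞ω}
    (hφ : ContDiffOn ℝ k φ Ω) (c : W) : ContDiffOn ℝ k (fun z => φ z • c) Ω :=
  hφ.smul contDiffOn_const

theorem contDiffOn_pderiv {V W ι : Type*} [NormedAddCommGroup V] [NormedSpace ℝ V]
    [NormedAddCommGroup W] [NormedSpace ℝ W] {b : Module.Basis ι ℝ V} {Ω : Set V} {φ : V → W}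
    {k n : ℕ∞ω} (hΩ : IsOpen Ω) (hφ : ContDiffOn ℝ n φ Ω) (hk : k + 1 ≤ n) (i : ι) :
    ContDiffOn ℝ k (pderiv b i φ) Ω :=
  (hφ.fderiv_of_isOpen hΩ hk).clm_apply contDiffOn_const

theorem fderiv_apply_apply {V₁ V₂ V₃ V₄ : Type*} [NormedAddCommGroup V₁] [NormedSpace ℝ V₁]
    [NormedAddCommGroup V₂] [NormedSpace ℝ V₂] [NormedAddCommGroup V₃] [NormedSpace ℝ V₃]
    [NormedAddCommGroup V₄] [NormedSpace ℝ V₄]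
    {B : V₁ → V₂ →L[ℝ] V₃ →L[ℝ] V₄} {z : V₁} (hB : DifferentiableAt ℝ B z) (a : V₁) (x : V₂)
    (y : V₃) : fderiv ℝ (fun v => B v x y) z a = fderiv ℝ B z a x y := by
  rw [fderiv_clm_apply (hB.clm_apply (differentiableAt_const _)) (differentiableAt_const _),
    fderiv_clm_apply hB (differentiableAt_const _)]
  simp

/-- The linear map `a ↦ R(a, y) c`, whose trace is `Ric(y, c)`. -/
noncomputable def curvatureMap {W : Type*} [NormedAddCommGroup W] [NormedSpace ℝ W]
    (Γ : W → W →L[ℝ] W →L[ℝ] W) (z y c : W) : W →ₗ[ℝ] W where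
  toFun a := curvature Γ z a y c
  map_add' a a' := by
    simp only [curvature, map_add, add_apply]
    abel
  map_smul' r a := by
    simp only [curvature, map_smul, smul_apply, RingHom.id_apply, smul_add, smul_sub]

section Christoffel

variable {V ι : Type*} [NormedAddCommGroup V] [NormedSpace ℝ V] [Fintype ι] [DecidableEq ι]
  {Ω : Set V} {b : Module.Basis ι ℝ V} {G : V → Matrix ι ι ℝ}

theorem contDiffOn_christoffel (hΩ : IsOpen Ω)
    (hG : ∀ i j, ContDiffOn ℝ ∞ (fun z => G z i j) Ω) (hdet : ∀ z ∈ Ω, (G z).det ≠ 0)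
    (k i j : ι) : ContDiffOn ℝ ∞ (fun z => christoffel b G z k i j) Ω := by
  have hp : ∀ a i j, ContDiffOn ℝ ∞ (pderiv b a fun y => G y i j) Ω := fun a i j =>
    contDiffOn_pderiv hΩ (hG i j) (by simp) a
  exact contDiffOn_const.mul (ContDiffOn.sum fun l _ =>
    (contDiffOn_matrix_inv hG hdet k l).mul (((hp i j l).add (hp j i l)).sub (hp l i j)))

/-- Lowering the upper index of the Christoffel symbols. -/
theorem sum_metric_mul_christoffel {z : V} (hdet : (G z).det ≠ 0) (k i j : ι) :
    ∑ l, G z k l * christoffel b G z l i j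
      = (1 / 2) * (pderiv b i (fun y => G y j k) z + pderiv b j (fun y => G y i k) z
        - pderiv b k (fun y => G y i j) z) := by
  have h := congrFun (Matrix.mulVec_mulVec (fun l => pderiv b i (fun y => G y j l) z
    + pderiv b j (fun y => G y i l) z - pderiv b l (fun y => G y i j) z) (G z) (G z)⁻¹) k
  rw [Matrix.mul_nonsing_inv _ (isUnit_iff_ne_zero.2 hdet), Matrix.one_mulVec] at h
  simp only [Matrix.mulVec, dotProduct] at h
  rw [← h, Finset.mul_sum]
  refine Finset.sum_congr rfl fun l _ => ?_
  rw [christoffel]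
  ring

end Christoffel

section MetricForm

variable {V ι : Type*} [NormedAddCommGroup V] [NormedSpace ℝ V] [FiniteDimensional ℝ V]
  [Fintype ι]

/-- The bilinear form with matrix `G z` in the basis `b`. -/
noncomputable def metricForm (b : Module.Basis ι ℝ V) (G : V → Matrix ι ι ℝ) (z : V) :
    V →L[ℝ] V →L[ℝ] ℝ :=
  ∑ i, ∑ j, G z i j • (LinearMap.toContinuousLinearMap (b.coord i)).smulRight
    (LinearMap.toContinuousLinearMap (b.coord j))

theorem metricForm_apply (b : Module.Basis ι ℝ V) (G : V → Matrix ι ι ℝ) (z x y : V) :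
    metricForm b G z x y = ∑ i, ∑ j, G z i j * b.repr x i * b.repr y j := by
  simp only [metricForm, sum_apply, smul_apply, ContinuousLinearMap.smulRight_apply,
    LinearMap.coe_toContinuousLinearMap', Module.Basis.coord_apply, smul_eq_mul, mul_assoc]

theorem metricForm_basis (b : Module.Basis ι ℝ V) (G : V → Matrix ι ι ℝ) (z : V) (i j : ι) :
    metricForm b G z (b i) (b j) = G z i j := by
  classical
  rw [metricForm_apply, Finset.sum_eq_single i, Finset.sum_eq_single j]
  · simp
  · intro k _ hk
    simp [Finsupp.single_eq_of_ne hk]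
  · simp
  · intro k _ hk
    simp [Finsupp.single_eq_of_ne hk]
  · simp

theorem contDiffOn_metricForm {Ω : Set V} {b : Module.Basis ι ℝ V} {G : V → Matrix ι ι ℝ}
    (hG : ∀ i j, ContDiffOn ℝ ∞ (fun z => G z i j) Ω) :
    ContDiffOn ℝ ∞ (metricForm b G) Ω :=
  ContDiffOn.sum fun i _ => ContDiffOn.sum fun j _ => contDiffOn_smul_const (hG i j) _

end MetricForm

section CoordinateForms

variable {V ι : Type*} [NormedAddCommGroup V] [NormedSpace ℝ V] [FiniteDimensional ℝ V]
  [Fintype ι] [DecidableEq ι]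

/-- The bilinear map whose components in the basis `b` are the Christoffel symbols. -/
noncomputable def christoffelForm (b : Module.Basis ι ℝ V) (G : V → Matrix ι ι ℝ) (z : V) :
    V →L[ℝ] V →L[ℝ] V :=
  ∑ k, ∑ i, ∑ j, christoffel b G z k i j • (LinearMap.toContinuousLinearMap (b.coord i)).smulRight
    ((LinearMap.toContinuousLinearMap (b.coord j)).smulRight (b k))

theorem christoffelForm_apply (b : Module.Basis ι ℝ V) (G : V → Matrix ι ι ℝ) (z x y : V) :
    christoffelForm b G z x y
      = ∑ k, (∑ i, ∑ j, christoffel b G z k i j * b.repr x i * b.repr y j) • b k := by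
  simp only [christoffelForm, sum_apply, smul_apply,
    ContinuousLinearMap.smulRight_apply, LinearMap.coe_toContinuousLinearMap',
    Module.Basis.coord_apply, smul_smul, Finset.sum_smul, mul_assoc]

theorem christoffelForm_basis (b : Module.Basis ι ℝ V) (G : V → Matrix ι ι ℝ) (z : V) (i j : ι) :
    christoffelForm b G z (b i) (b j) = ∑ k, christoffel b G z k i j • b k := by
  rw [christoffelForm_apply]
  refine Finset.sum_congr rfl fun k _ => ?_
  congr 1
  rw [Finset.sum_eq_single i, Finset.sum_eq_single j]
  · simp
  · intro k _ hk
    simp [Finsupp.single_eq_of_ne hk]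
  · simp
  · intro k _ hk
    simp [Finsupp.single_eq_of_ne hk]
  · simp

theorem repr_christoffelForm_basis (b : Module.Basis ι ℝ V) (G : V → Matrix ι ι ℝ) (z : V)
    (i j k : ι) : b.repr (christoffelForm b G z (b i) (b j)) k = christoffel b G z k i j := by
  rw [christoffelForm_basis, b.repr_sum_self]

variable {Ω : Set V} {b : Module.Basis ι ℝ V} {G : V → Matrix ι ι ℝ}

theorem contDiffOn_christoffelForm (hΩ : IsOpen Ω)
    (hG : ∀ i j, ContDiffOn ℝ ∞ (fun z => G z i j) Ω) (hdet : ∀ z ∈ Ω, (G z).det ≠ 0) :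
    ContDiffOn ℝ ∞ (christoffelForm b G) Ω :=
  ContDiffOn.sum fun k _ => ContDiffOn.sum fun i _ => ContDiffOn.sum fun j _ =>
    contDiffOn_smul_const (contDiffOn_christoffel hΩ hG hdet k i j) _

/-- The Christoffel symbols of a metric define its Levi-Civita connection. -/
theorem isLeviCivita_coordinates (hΩ : IsOpen Ω)
    (hG : ∀ i j, ContDiffOn ℝ ∞ (fun z => G z i j) Ω) (hdet : ∀ z ∈ Ω, (G z).det ≠ 0)
    (hsymm : ∀ z ∈ Ω, ∀ i j, G z i j = G z j i) :
    IsLeviCivita Ω (metricForm b G) (christoffelForm b G) where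
  isOpen := hΩ
  contDiffOn_metric := contDiffOn_metricForm hG
  contDiffOn_form := contDiffOn_christoffelForm hΩ hG hdet
  metric_symm z hz x y := by
    rw [metricForm_apply, metricForm_apply, Finset.sum_comm]
    refine Finset.sum_congr rfl fun i _ => Finset.sum_congr rfl fun j _ => ?_
    rw [hsymm z hz j i]
    ring
  form_symm z hz x y := by
    have hp : ∀ l i j, pderiv b l (fun y => G y i j) z = pderiv b l (fun y => G y j i) z := by
      intro l i j
      have : (fun y => G y i j) =ᶠ[nhds z] fun y => G y j i :=
        Filter.eventually_of_mem (hΩ.mem_nhds hz) fun y hy => hsymm y hy i j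
      rw [pderiv, pderiv, this.fderiv_eq]
    have hc : ∀ k i j, christoffel b G z k i j = christoffel b G z k j i := by
      intro k i j
      unfold christoffel
      congr 1
      refine Finset.sum_congr rfl fun l _ => ?_
      rw [hp l i j]
      ring
    rw [christoffelForm_apply, christoffelForm_apply]
    refine Finset.sum_congr rfl fun k _ => ?_
    rw [Finset.sum_comm]
    congr 1
    refine Finset.sum_congr rfl fun i _ => Finset.sum_congr rfl fun j _ => ?_
    rw [hc k j i]
    ring
  fderiv_metric z hz := by
    have hd : DifferentiableAt ℝ (metricForm b G) z :=
      ((contDiffOn_metricForm hG).contDiffAt (hΩ.mem_nhds hz)).differentiableAt (by simp)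
    have hp : ∀ l i j, pderiv b l (fun y => G y i j) z = pderiv b l (fun y => G y j i) z := by
      intro l i j
      have : (fun y => G y i j) =ᶠ[nhds z] fun y => G y j i :=
        Filter.eventually_of_mem (hΩ.mem_nhds hz) fun y hy => hsymm y hy i j
      rw [pderiv, pderiv, this.fderiv_eq]
    have h0 : ∀ a i j, fderiv ℝ (metricForm b G) z (b a) (b i) (b j)
        = metricForm b G z (christoffelForm b G z (b a) (b i)) (b j)
          + metricForm b G z (b i) (christoffelForm b G z (b a) (b j)) := by
      intro a i j
      rw [← fderiv_apply_apply hd]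
      simp only [christoffelForm_basis, map_sum, map_smul, sum_apply, smul_apply,
        metricForm_basis, smul_eq_mul]
      have h1 : ∑ l, christoffel b G z l a i * G z l j
          = ∑ l, G z j l * christoffel b G z l a i :=
        Finset.sum_congr rfl fun l _ => by rw [hsymm z hz l j]; ring
      have h2 : ∑ l, christoffel b G z l a j * G z i l
          = ∑ l, G z i l * christoffel b G z l a j :=
        Finset.sum_congr rfl fun l _ => mul_comm _ _
      rw [h1, h2, sum_metric_mul_christoffel (hdet z hz), sum_metric_mul_christoffel (hdet z hz),
        hp i a j, hp j a i, hp a j i, pderiv, pderiv, pderiv]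
      ring
    -- both sides are linear in each argument
    have h1 : ∀ a i c, fderiv ℝ (metricForm b G) z (b a) (b i) c
        = metricForm b G z (christoffelForm b G z (b a) (b i)) c
          + metricForm b G z (b i) (christoffelForm b G z (b a) c) := fun a i c =>
      LinearMap.congr_fun (b.ext (f₁ := (fderiv ℝ (metricForm b G) z (b a) (b i)).toLinearMap)
        (f₂ := (metricForm b G z (christoffelForm b G z (b a) (b i))
          + (metricForm b G z (b i)).comp (christoffelForm b G z (b a))).toLinearMap)
        fun j => h0 a i j) c
    have h2 : ∀ a v c, fderiv ℝ (metricForm b G) z (b a) v c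
        = metricForm b G z (christoffelForm b G z (b a) v) c
          + metricForm b G z v (christoffelForm b G z (b a) c) := fun a v c =>
      LinearMap.congr_fun (b.ext
        (f₁ := ((fderiv ℝ (metricForm b G) z (b a)).flip c).toLinearMap)
        (f₂ := (((metricForm b G z).flip c).comp (christoffelForm b G z (b a))
          + (metricForm b G z).flip (christoffelForm b G z (b a) c)).toLinearMap)
        fun j => h1 a j c) v
    exact fun a v c => LinearMap.congr_fun (b.ext
        (f₁ := (((fderiv ℝ (metricForm b G) z).flip v).flip c).toLinearMap)
        (f₂ := (((metricForm b G z).flip c).comp ((christoffelForm b G z).flip v)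
          + (metricForm b G z v).comp ((christoffelForm b G z).flip c)).toLinearMap)
        fun j => h2 j v c) a

/-- The coordinate formula for the curvature tensor agrees with the curvature of the connection. -/
theorem repr_curvature (hΩ : IsOpen Ω)
    (hG : ∀ i j, ContDiffOn ℝ ∞ (fun z => G z i j) Ω) (hdet : ∀ z ∈ Ω, (G z).det ≠ 0) {z : V}
    (hz : z ∈ Ω) (a c d k : ι) :
    b.repr (curvature (christoffelForm b G) z (b a) (b c) (b d)) k
      = riemannCoord b G z a c d k := by
  have hd : DifferentiableAt ℝ (christoffelForm b G) z :=
    ((contDiffOn_christoffelForm hΩ hG hdet).contDiffAt (hΩ.mem_nhds hz)).differentiableAt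
      (by simp)
  have h1 : ∀ i j l, b.repr (fderiv ℝ (christoffelForm b G) z (b i) (b j) (b l)) k
      = pderiv b i (fun y => christoffel b G y k j l) z := by
    intro i j l
    have h2 : (fun y => christoffel b G y k j l)
        = fun y => LinearMap.toContinuousLinearMap (b.coord k)
          (christoffelForm b G y (b j) (b l)) :=
      funext fun y => (repr_christoffelForm_basis b G y j l k).symm
    rw [h2, pderiv, ← fderiv_apply_apply hd]
    have h3 : DifferentiableAt ℝ (fun y => christoffelForm b G y (b j) (b l)) z :=
      (hd.clm_apply (differentiableAt_const _)).clm_apply (differentiableAt_const _)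
    have h4 := ((LinearMap.toContinuousLinearMap (b.coord k)).hasFDerivAt.comp z
      h3.hasFDerivAt).fderiv
    exact (congrArg (fun T => T (b i)) h4).symm
  have h5 : ∀ i j l, b.repr (christoffelForm b G z (b i) (christoffelForm b G z (b j) (b l))) k
      = ∑ r, christoffel b G z r j l * christoffel b G z k i r := by
    intro i j l
    rw [christoffelForm_basis b G z j l]
    simp only [map_sum, map_smul, Finsupp.coe_finsetSum, Finset.sum_apply, Finsupp.smul_apply,
      repr_christoffelForm_basis, smul_eq_mul]
  simp only [curvature, map_add, map_sub, Finsupp.add_apply, Finsupp.sub_apply, h1, h5,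
    riemannCoord, Finset.sum_sub_distrib]
  ring

/-- The coordinate formula for the Ricci tensor is the trace of the curvature. -/
theorem trace_curvatureMap (hΩ : IsOpen Ω)
    (hG : ∀ i j, ContDiffOn ℝ ∞ (fun z => G z i j) Ω) (hdet : ∀ z ∈ Ω, (G z).det ≠ 0) {z : V}
    (hz : z ∈ Ω) (x y : V) :
    LinearMap.trace ℝ V (curvatureMap (christoffelForm b G) z x y)
      = ∑ i, ∑ j, ricciCoord b G z i j * b.repr x i * b.repr y j := by
  have h1 : ∀ a, curvature (christoffelForm b G) z a x y
      = ∑ i, ∑ j, (b.repr x i * b.repr y j) •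
        curvature (christoffelForm b G) z a (b i) (b j) := by
    intro a
    conv_lhs => rw [← b.sum_repr x, ← b.sum_repr y]
    simp only [curvature, map_sum, map_smul, sum_apply, smul_apply, smul_add, smul_sub,
      Finset.smul_sum, smul_smul, Finset.sum_add_distrib, Finset.sum_sub_distrib]
    refine congrArg₂ _ (congrArg₂ _ (congrArg₂ _ ?_ ?_) ?_) ?_ <;>
    · refine Finset.sum_comm.trans ?_
      exact Finset.sum_congr rfl fun i _ => Finset.sum_congr rfl fun j _ => by rw [mul_comm]
  rw [LinearMap.trace_eq_matrix_trace ℝ b, Matrix.trace]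
  have h2 : ∀ d, Matrix.diag (LinearMap.toMatrix b b
      (curvatureMap (christoffelForm b G) z x y)) d
      = ∑ i, ∑ j, riemannCoord b G z d i j d * b.repr x i * b.repr y j := by
    intro d
    rw [Matrix.diag_apply, LinearMap.toMatrix_apply]
    change b.repr (curvature (christoffelForm b G) z (b d) x y) d = _
    rw [h1]
    simp only [map_sum, map_smul, Finsupp.coe_finsetSum, Finset.sum_apply, Finsupp.smul_apply,
      repr_curvature hΩ hG hdet hz, smul_eq_mul]
    exact Finset.sum_congr rfl fun i _ => Finset.sum_congr rfl fun j _ => by ring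
  simp only [h2, ricciCoord, Finset.sum_mul]
  rw [Finset.sum_comm]
  exact Finset.sum_congr rfl fun i _ => Finset.sum_comm

end CoordinateForms

/-! ### Tangent vectors in charts -/

section ChartTangent

variable {V H X : Type*} [NormedAddCommGroup V] [NormedSpace ℝ V]
  [TopologicalSpace H] [TopologicalSpace X] [ChartedSpace H X]

/-- The derivative of a map between manifolds, as a linear map between the model spaces: Mathlib's
tangent spaces are, by definition, copies of the model space. -/
noncomputable def modelDeriv {V' H' M : Type*} [NormedAddCommGroup V'] [NormedSpace ℝ V']
    [TopologicalSpace H'] [TopologicalSpace M] [ChartedSpace H' M] (I' : ModelWithCorners ℝ V' H')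
    (I : ModelWithCorners ℝ V H) (Φ : M → X) (p : M) : V' →L[ℝ] V :=
  mfderiv I' I Φ p

/-- The linear map which sends the components, in the chart at `q₀`, of a vector tangent to the
point with coordinates `z`, to its components in the preferred chart at that point. -/
noncomputable def chartTangent (I : ModelWithCorners ℝ V H) (q₀ : X) (z : V) : V →L[ℝ] V :=
  modelDeriv 𝓘(ℝ, V) I (extChartAt I q₀).symm z

variable {I : ModelWithCorners ℝ V H} [IsManifold I ∞ X]

theorem mdifferentiableAt_extChartAt_source {q₀ q : X} (hq : q ∈ (extChartAt I q₀).source) :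
    MDifferentiableAt I 𝓘(ℝ, V) (extChartAt I q₀) q := by
  have : IsManifold I 1 X := IsManifold.of_le (n := ∞) (by norm_cast)
  exact mdifferentiableAt_extChartAt (by rwa [← extChartAt_source (I := I)])

theorem contDiffOn_chart_change (q₀ q₁ : X) :
    ContDiffOn ℝ ∞ (extChartAt I q₁ ∘ (extChartAt I q₀).symm)
      ((extChartAt I q₀).target ∩ (extChartAt I q₀).symm ⁻¹' (extChartAt I q₁).source) := by
  rw [← contMDiffOn_iff_contDiffOn]
  refine (contMDiffOn_extChartAt (I := I) (x := q₁) (n := ∞)).comp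
    ((contMDiffOn_extChartAt_symm q₀).mono inter_subset_left) fun z hz => ?_
  rw [← extChartAt_source (I := I)]
  exact hz.2

theorem hasDerivWithinAt_extChartAt_comp {γ : ℝ → X} {J : Set ℝ} {s : ℝ} {q₀ : X} {v : V}
    (hγ : HasMFDerivWithinAt 𝓘(ℝ, ℝ) I γ J s (ContinuousLinearMap.toSpanSingleton ℝ v))
    (hq : γ s ∈ (extChartAt I q₀).source) :
    HasDerivWithinAt (fun r => extChartAt I q₀ (γ r))
      (modelDeriv I 𝓘(ℝ, V) (extChartAt I q₀) (γ s) v) J s := by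
  have h1 := (mdifferentiableAt_extChartAt_source hq).hasMFDerivAt.comp_hasMFDerivWithinAt s hγ
  have h2 : HasFDerivWithinAt (fun r => extChartAt I q₀ (γ r))
      ((modelDeriv I 𝓘(ℝ, V) (extChartAt I q₀) (γ s)).comp
        (ContinuousLinearMap.toSpanSingleton ℝ v)) J s :=
    hasMFDerivWithinAt_iff_hasFDerivWithinAt.1 h1
  have h3 := h2.hasDerivWithinAt
  rwa [ContinuousLinearMap.comp_apply, ContinuousLinearMap.toSpanSingleton_apply, one_smul] at h3

variable [I.Boundaryless]

theorem mdifferentiableAt_extChartAt_symm_target {q₀ : X} {z : V}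
    (hz : z ∈ (extChartAt I q₀).target) :
    MDifferentiableAt 𝓘(ℝ, V) I (extChartAt I q₀).symm z := by
  have : IsManifold I 1 X := IsManifold.of_le (n := ∞) (by norm_cast)
  have h := mdifferentiableWithinAt_extChartAt_symm hz
  rwa [I.range_eq_univ, mdifferentiableWithinAt_univ] at h

/-- In the preferred chart at `q` a vector tangent at `q` is its own component vector. -/
theorem chartTangent_self (q : X) (v : V) : chartTangent I q (extChartAt I q q) v = v := by
  have : IsManifold I 1 X := IsManifold.of_le (n := ∞) (by norm_cast)
  have h := mfderivWithin_range_extChartAt_symm (I := I) (x := q)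
  rw [I.range_eq_univ, mfderivWithin_univ] at h
  exact congrArg (fun T : V →L[ℝ] V => T v) h

theorem chartTangent_modelDeriv {q₀ q : X} (hq : q ∈ (extChartAt I q₀).source) (v : V) :
    chartTangent I q₀ (extChartAt I q₀ q) (modelDeriv I 𝓘(ℝ, V) (extChartAt I q₀) q v) = v := by
  have : IsManifold I 1 X := IsManifold.of_le (n := ∞) (by norm_cast)
  have h := mfderivWithin_extChartAt_symm_comp_mfderiv_extChartAt' (I := I) hq
  rw [I.range_eq_univ, mfderivWithin_univ] at h
  exact congrArg (fun T : V →L[ℝ] V => T v) h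

theorem modelDeriv_chartTangent {q₀ : X} {z : V} (hz : z ∈ (extChartAt I q₀).target) (v : V) :
    modelDeriv I 𝓘(ℝ, V) (extChartAt I q₀) ((extChartAt I q₀).symm z)
      (chartTangent I q₀ z v) = v := by
  have : IsManifold I 1 X := IsManifold.of_le (n := ∞) (by norm_cast)
  have h := mfderiv_extChartAt_comp_mfderivWithin_extChartAt_symm (I := I) hz
  rw [I.range_eq_univ, mfderivWithin_univ] at h
  exact congrArg (fun T : V →L[ℝ] V => T v) h

theorem chartTangent_injective {q₀ : X} {z : V} (hz : z ∈ (extChartAt I q₀).target) :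
    Function.Injective (chartTangent I q₀ z) :=
  Function.LeftInverse.injective (modelDeriv_chartTangent hz)

variable {V' H' M : Type*} [NormedAddCommGroup V'] [NormedSpace ℝ V']
  [TopologicalSpace H'] [TopologicalSpace M] [ChartedSpace H' M]
  {I' : ModelWithCorners ℝ V' H'} [I'.Boundaryless] [IsManifold I' ∞ M]

/-- The chain rule for a map read in charts. -/
theorem modelDeriv_comp_chartTangent {Φ : M → X} {p : M} {q₀ : X} {z : V'}
    (hz : z ∈ (extChartAt I' p).target)
    (hq : Φ ((extChartAt I' p).symm z) ∈ (extChartAt I q₀).source)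
    (hΦ : MDifferentiableAt I' I Φ ((extChartAt I' p).symm z)) (v : V') :
    modelDeriv I' I Φ ((extChartAt I' p).symm z) (chartTangent I' p z v)
      = chartTangent I q₀ (extChartAt I q₀ (Φ ((extChartAt I' p).symm z)))
        (fderiv ℝ (extChartAt I q₀ ∘ Φ ∘ (extChartAt I' p).symm) z v) := by
  have h1 := (hΦ.hasMFDerivAt.comp z
    (mdifferentiableAt_extChartAt_symm_target hz).hasMFDerivAt)
  have h2 := (mdifferentiableAt_extChartAt_source hq).hasMFDerivAt.comp z h1
  have h3 : HasFDerivAt (extChartAt I q₀ ∘ Φ ∘ (extChartAt I' p).symm)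
      ((modelDeriv I 𝓘(ℝ, V) (extChartAt I q₀) (Φ ((extChartAt I' p).symm z))).comp
        ((modelDeriv I' I Φ ((extChartAt I' p).symm z)).comp (chartTangent I' p z))) z :=
    hasMFDerivAt_iff_hasFDerivAt.1 h2
  rw [h3.fderiv]
  exact (chartTangent_modelDeriv hq _).symm

/-- Components of tangent vectors under a change of charts. -/
theorem chartTangent_change {q₀ q₁ : X} {z : V} (hz : z ∈ (extChartAt I q₀).target)
    (hq : (extChartAt I q₀).symm z ∈ (extChartAt I q₁).source) (v : V) :
    chartTangent I q₀ z v
      = chartTangent I q₁ (extChartAt I q₁ ((extChartAt I q₀).symm z))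
        (fderiv ℝ (extChartAt I q₁ ∘ (extChartAt I q₀).symm) z v) := by
  have h := modelDeriv_comp_chartTangent (I := I) (I' := I) (Φ := id) hz hq mdifferentiableAt_id v
  rw [modelDeriv, mfderiv_id] at h
  exact h

theorem contMDiffOn_chartTangent (q₀ : X) (v : V) :
    ContMDiffOn 𝓘(ℝ, V) (I.prod 𝓘(ℝ, V)) ∞
      (fun z => (Bundle.TotalSpace.mk' V (E := fun q : X => TangentSpace I q)
        ((extChartAt I q₀).symm z) (chartTangent I q₀ z v)))
      (extChartAt I q₀).target := by
  have ho := isOpen_extChartAt_target (I := I) q₀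
  have : IsManifold I 1 X := IsManifold.of_le (n := ∞) (by norm_cast)
  have h1 := (contMDiffOn_extChartAt_symm (I := I) (n := ∞) q₀).contMDiffOn_tangentMapWithin
    (m := ∞) (by simp) ho.uniqueMDiffOn
  have h2 : ContMDiffOn 𝓘(ℝ, V) (𝓘(ℝ, V).prod 𝓘(ℝ, V)) ∞
      (fun z : V => (Bundle.TotalSpace.mk' V (E := fun q : V => TangentSpace 𝓘(ℝ, V) q) z v))
      (extChartAt I q₀).target := by
    intro z hz
    exact (contMDiffWithinAt_vectorSpace_iff_contDiffWithinAt (V := fun _ => v)).2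
      contDiffWithinAt_const
  refine (h1.comp h2 fun z hz => hz).congr fun z hz => ?_
  simp only [Function.comp, tangentMapWithin, mfderivWithin_of_isOpen ho hz]
  rfl

end ChartTangent

/-! ### The metric of the space-time in product charts -/

theorem metricForm_eq_of_basis {V ι : Type*} [NormedAddCommGroup V] [NormedSpace ℝ V]
    [FiniteDimensional ℝ V] [Fintype ι] (b : Module.Basis ι ℝ V) (G : V → Matrix ι ι ℝ) (z : V)
    (B : V →ₗ[ℝ] V →ₗ[ℝ] ℝ) (hB : ∀ i j, G z i j = B (b i) (b j)) (x y : V) :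
    metricForm b G z x y = B x y := by
  conv_rhs => rw [← b.sum_repr x, ← b.sum_repr y]
  simp only [metricForm_apply, map_sum, map_smul, LinearMap.sum_apply, LinearMap.smul_apply,
    smul_eq_mul, hB, Finset.mul_sum]
  rw [Finset.sum_comm]
  exact Finset.sum_congr rfl fun i _ => Finset.sum_congr rfl fun j _ => by ring

section ProductChart

variable {m : ℕ} {M : Type*} [TopologicalSpace M] [ChartedSpace (E m) M]

theorem extChartAt_prod_apply (q₀ q : ℝ × M) :
    extChartAt (modelN m) q₀ q = (q.1, extChartAt (𝓡 m) q₀.2 q.2) := by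
  rw [extChartAt_prod]
  rfl

theorem extChartAt_prod_symm_apply (q₀ : ℝ × M) (z : ℝ × E m) :
    (extChartAt (modelN m) q₀).symm z = (z.1, (extChartAt (𝓡 m) q₀.2).symm z.2) := by
  rw [extChartAt_prod]
  rfl

theorem mem_extChartAt_prod_target {q₀ : ℝ × M} {z : ℝ × E m} :
    z ∈ (extChartAt (modelN m) q₀).target ↔ z.2 ∈ (extChartAt (𝓡 m) q₀.2).target := by
  rw [extChartAt_prod]
  simp [PartialEquiv.prod_target, chartAt_self_eq]

end ProductChart

section Warped

variable {m : ℕ} {M : Type*} [TopologicalSpace M] [ChartedSpace (E m) M] [IsManifold (𝓡 m) ∞ M]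
  (f : ℝ → ℝ)
  (gt : Bundle.ContMDiffRiemannianMetric (𝓡 m) ∞ (E m) (fun x : M => TangentSpace (𝓡 m) x))

/-- The Riemannian metric of `M`, as a bilinear form on the coordinate space. -/
noncomputable def riemannianForm (x : M) : E m →L[ℝ] E m →L[ℝ] ℝ := gt.inner x

theorem riemannianForm_symm (x : M) (v w : E m) :
    riemannianForm gt x v w = riemannianForm gt x w v := gt.symm x v w

theorem riemannianForm_pos (x : M) {v : E m} (hv : v ≠ 0) : 0 < riemannianForm gt x v v :=
  gt.pos x v hv

/-- The Lorentzian metric of the space-time, as a bilinear form on the coordinate space. -/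
noncomputable def warpedForm (q : ℝ × M) : (ℝ × E m) →ₗ[ℝ] (ℝ × E m) →ₗ[ℝ] ℝ :=
  LinearMap.mk₂ ℝ
    (fun y z : ℝ × E m => -(y.1 * z.1) + f q.1 ^ 2 * riemannianForm gt q.2 y.2 z.2)
    (by
      intro a b c
      simp only [Prod.fst_add, Prod.snd_add, map_add, add_apply]
      ring)
    (by
      intro r a b
      simp only [Prod.smul_fst, Prod.smul_snd, map_smul, smul_apply, smul_eq_mul]
      ring)
    (by
      intro a b c
      simp only [Prod.fst_add, Prod.snd_add, map_add]
      ring)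
    (by
      intro r a b
      simp only [Prod.smul_fst, Prod.smul_snd, map_smul, smul_eq_mul]
      ring)

theorem warpedForm_apply (q : ℝ × M) (y z : ℝ × E m) :
    warpedForm f gt q y z = -(y.1 * z.1) + f q.1 ^ 2 * riemannianForm gt q.2 y.2 z.2 := rfl

/-- Components in a product chart are computed factor by factor. -/
theorem chartTangent_prod {q₀ : ℝ × M} {z : ℝ × E m}
    (hz : z ∈ (extChartAt (modelN m) q₀).target) (v : ℝ × E m) :
    chartTangent (modelN m) q₀ z v = (v.1, chartTangent (𝓡 m) q₀.2 z.2 v.2) := by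
  have hz2 := mem_extChartAt_prod_target.1 hz
  set x := (extChartAt (𝓡 m) q₀.2).symm z.2 with hx
  have hq : (extChartAt (modelN m) q₀).symm z = (z.1, x) := extChartAt_prod_symm_apply q₀ z
  rw [chartTangent_change (q₁ := ((z.1, x) : ℝ × M)) hz
      (by rw [hq]; exact mem_extChartAt_source _), hq, chartTangent_self,
    chartTangent_change (q₁ := x) hz2 (mem_extChartAt_source _), ← hx, chartTangent_self]
  have h1 : DifferentiableAt ℝ (extChartAt (𝓡 m) x ∘ (extChartAt (𝓡 m) q₀.2).symm) z.2 := by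
    have ho : IsOpen ((extChartAt (𝓡 m) q₀.2).target ∩
        (extChartAt (𝓡 m) q₀.2).symm ⁻¹' (extChartAt (𝓡 m) x).source) :=
      (continuousOn_extChartAt_symm q₀.2).isOpen_inter_preimage (isOpen_extChartAt_target _)
        (isOpen_extChartAt_source _)
    exact ((contDiffOn_chart_change q₀.2 x).contDiffAt
      (ho.mem_nhds ⟨hz2, mem_extChartAt_source _⟩)).differentiableAt (by simp)
  have h2 : (extChartAt (modelN m) ((z.1, x) : ℝ × M) ∘ (extChartAt (modelN m) q₀).symm)
      = Prod.map id (extChartAt (𝓡 m) x ∘ (extChartAt (𝓡 m) q₀.2).symm) := by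
    funext y
    simp only [Function.comp, extChartAt_prod_symm_apply, extChartAt_prod_apply]
    rfl
  rw [h2, ((hasFDerivAt_id z.1).prodMap z h1.hasFDerivAt).fderiv]
  rfl

/-- The metric of the space-time in the chart at `q₀`. -/
noncomputable def chartMetric (q₀ : ℝ × M) : ℝ × E m → (ℝ × E m) →L[ℝ] (ℝ × E m) →L[ℝ] ℝ :=
  metricForm (basisN m) (coordMetric (modelN m) (basisN m) (warpedMetric f gt) q₀)

/-- The Christoffel form of the space-time in the chart at `q₀`. -/
noncomputable def chartChristoffel (q₀ : ℝ × M) :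
    ℝ × E m → (ℝ × E m) →L[ℝ] (ℝ × E m) →L[ℝ] (ℝ × E m) :=
  christoffelForm (basisN m) (coordMetric (modelN m) (basisN m) (warpedMetric f gt) q₀)

theorem coordMetric_warped (q₀ : ℝ × M) (z : ℝ × E m) (i j : Unit ⊕ Fin m) :
    coordMetric (modelN m) (basisN m) (warpedMetric f gt) q₀ z i j
      = warpedForm f gt ((extChartAt (modelN m) q₀).symm z)
        (chartTangent (modelN m) q₀ z (basisN m i)) (chartTangent (modelN m) q₀ z (basisN m j)) :=
  rfl

theorem chartMetric_apply (q₀ : ℝ × M) (z x y : ℝ × E m) :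
    chartMetric f gt q₀ z x y = warpedForm f gt ((extChartAt (modelN m) q₀).symm z)
      (chartTangent (modelN m) q₀ z x) (chartTangent (modelN m) q₀ z y) :=
  metricForm_eq_of_basis (basisN m) _ z
    ((warpedForm f gt ((extChartAt (modelN m) q₀).symm z)).compl₁₂
      (chartTangent (modelN m) q₀ z).toLinearMap (chartTangent (modelN m) q₀ z).toLinearMap)
    (coordMetric_warped f gt q₀ z) x y

theorem contDiffOn_riemannianForm (x₀ : M) (v w : E m) :
    ContDiffOn ℝ ∞ (fun z => riemannianForm gt ((extChartAt (𝓡 m) x₀).symm z)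
      (chartTangent (𝓡 m) x₀ z v) (chartTangent (𝓡 m) x₀ z w)) (extChartAt (𝓡 m) x₀).target := by
  rw [← contMDiffOn_iff_contDiffOn]
  intro z hz
  have hb := contMDiffOn_extChartAt_symm (I := 𝓡 m) (n := ∞) x₀ z hz
  have : ContMDiffWithinAt 𝓘(ℝ, E m) ((𝓡 m).prod 𝓘(ℝ)) ∞
      (fun z => Bundle.TotalSpace.mk' ℝ (E := Bundle.Trivial M ℝ) ((extChartAt (𝓡 m) x₀).symm z)
        (gt.inner ((extChartAt (𝓡 m) x₀).symm z)
          (chartTangent (𝓡 m) x₀ z v) (chartTangent (𝓡 m) x₀ z w)))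
      (extChartAt (𝓡 m) x₀).target z := by
    apply ContMDiffWithinAt.clm_bundle_apply₂ (F₁ := E m) (F₂ := E m)
    · exact ContMDiffAt.comp_contMDiffWithinAt z gt.contMDiff.contMDiffAt hb
    · exact contMDiffOn_chartTangent x₀ v z hz
    · exact contMDiffOn_chartTangent x₀ w z hz
  exact (Bundle.contMDiffWithinAt_totalSpace.1 this).2

variable {f}

theorem contDiffOn_coordMetric (hf : ContDiff ℝ ∞ f) (q₀ : ℝ × M) (i j : Unit ⊕ Fin m) :
    ContDiffOn ℝ ∞ (fun z => coordMetric (modelN m) (basisN m) (warpedMetric f gt) q₀ z i j)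
      (extChartAt (modelN m) q₀).target := by
  have h1 : ContDiffOn ℝ ∞ (fun z : ℝ × E m =>
      -((basisN m i).1 * (basisN m j).1) + f z.1 ^ 2 *
        riemannianForm gt ((extChartAt (𝓡 m) q₀.2).symm z.2)
          (chartTangent (𝓡 m) q₀.2 z.2 (basisN m i).2)
          (chartTangent (𝓡 m) q₀.2 z.2 (basisN m j).2)) (extChartAt (modelN m) q₀).target := by
    refine contDiffOn_const.add (ContDiffOn.mul ((hf.comp contDiff_fst).contDiffOn.pow 2) ?_)
    exact (contDiffOn_riemannianForm gt q₀.2 _ _).comp contDiff_snd.contDiffOn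
      fun z hz => mem_extChartAt_prod_target.1 hz
  refine h1.congr fun z hz => ?_
  rw [coordMetric_warped, chartTangent_prod hz, chartTangent_prod hz, extChartAt_prod_symm_apply,
    warpedForm_apply]

/-- The Lorentzian metric of the space-time is nondegenerate. -/
theorem det_coordMetric_ne_zero (hf_pos : ∀ t, 0 < f t) (q₀ : ℝ × M) {z : ℝ × E m}
    (hz : z ∈ (extChartAt (modelN m) q₀).target) :
    (coordMetric (modelN m) (basisN m) (warpedMetric f gt) q₀ z).det ≠ 0 := by
  intro hdet
  obtain ⟨c, hc, hc0⟩ := Matrix.exists_mulVec_eq_zero_iff.2 hdet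
  set x : ℝ × E m := ∑ i, c i • basisN m i with hx
  have hrepr : ∀ i, (basisN m).repr x i = c i := fun i => by rw [hx, (basisN m).repr_sum_self]
  have h0 : ∀ y, chartMetric f gt q₀ z y x = 0 := by
    intro y
    rw [chartMetric, metricForm_apply]
    refine Finset.sum_eq_zero fun i _ => ?_
    have h1 := congrFun hc0 i
    simp only [Matrix.mulVec, dotProduct, Pi.zero_apply] at h1
    have h2 : ∑ j, coordMetric (modelN m) (basisN m) (warpedMetric f gt) q₀ z i j
        * (basisN m).repr y i * (basisN m).repr x j
        = (basisN m).repr y i *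
          ∑ j, coordMetric (modelN m) (basisN m) (warpedMetric f gt) q₀ z i j * c j := by
      rw [Finset.mul_sum]
      exact Finset.sum_congr rfl fun j _ => by rw [hrepr]; ring
    rw [h2, h1, mul_zero]
  -- testing with the reflected vector makes both terms of the metric nonnegative
  have h1 := h0 (-x.1, x.2)
  rw [chartMetric_apply, chartTangent_prod hz, chartTangent_prod hz, warpedForm_apply] at h1
  have hf2 : ∀ t, 0 < f t ^ 2 := fun t => pow_pos (hf_pos t) 2
  have hA : chartTangent (𝓡 m) q₀.2 z.2 x.2 = 0 := by
    by_contra hne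
    have h2 := mul_pos (hf2 ((extChartAt (modelN m) q₀).symm z).1)
      (riemannianForm_pos gt ((extChartAt (modelN m) q₀).symm z).2 hne)
    have h3 := mul_self_nonneg x.1
    simp only at h1
    linarith
  have hx2 : x.2 = 0 := chartTangent_injective (mem_extChartAt_prod_target.1 hz)
    (by rw [hA, map_zero])
  have hx1 : x.1 = 0 := by
    simp only [hA, map_zero, mul_zero, add_zero, neg_mul, neg_neg] at h1
    exact mul_self_eq_zero.1 h1
  have hx0 : x = 0 := Prod.ext hx1 hx2
  refine hc (funext fun i => ?_)
  rw [← hrepr i, hx0]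
  simp

theorem warpedForm_symm (q : ℝ × M) (x y : ℝ × E m) :
    warpedForm f gt q x y = warpedForm f gt q y x := by
  rw [warpedForm_apply, warpedForm_apply, riemannianForm_symm, mul_comm x.1]

theorem isLeviCivita_chart (hf : ContDiff ℝ ∞ f) (hf_pos : ∀ t, 0 < f t) (q₀ : ℝ × M) :
    IsLeviCivita (extChartAt (modelN m) q₀).target (chartMetric f gt q₀)
      (chartChristoffel f gt q₀) :=
  isLeviCivita_coordinates (isOpen_extChartAt_target q₀) (contDiffOn_coordMetric gt hf q₀)
    (fun _ hz => det_coordMetric_ne_zero gt hf_pos q₀ hz) fun z _ i j => by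
      rw [coordMetric_warped, warpedForm_symm, coordMetric_warped]

theorem ricci_eq_trace (hf : ContDiff ℝ ∞ f) (hf_pos : ∀ t, 0 < f t) (q : ℝ × M)
    (x y : ℝ × E m) :
    ricci (modelN m) (basisN m) (warpedMetric f gt) q x y
      = LinearMap.trace ℝ (ℝ × E m)
        (curvatureMap (chartChristoffel f gt q) (extChartAt (modelN m) q q) x y) :=
  (trace_curvatureMap (isOpen_extChartAt_target q) (contDiffOn_coordMetric gt hf q)
    (fun _ hz => det_coordMetric_ne_zero gt hf_pos q hz) (mem_extChartAt_target q) x y).symm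

end Warped

/-! ### Behaviour under isometries -/

section CoordinateChange

variable {X W W' : Type*} [NormedAddCommGroup X] [NormedSpace ℝ X]
  [NormedAddCommGroup W] [NormedSpace ℝ W] [NormedAddCommGroup W'] [NormedSpace ℝ W']

theorem dirDeriv_clm_apply {S : Set X} {x : X} {T : W → W →L[ℝ] W'} {u Y : X → W}
    (hS : UniqueDiffOn ℝ S) (hx : x ∈ S) (hT : DifferentiableAt ℝ T (u x))
    (hu : DifferentiableWithinAt ℝ u S x) (hY : DifferentiableWithinAt ℝ Y S x) (ξ : X) :
    dirDeriv S ξ (fun y => T (u y) (Y y)) x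
      = fderiv ℝ T (u x) (dirDeriv S ξ u x) (Y x) + T (u x) (dirDeriv S ξ Y x) := by
  have h1 : HasFDerivWithinAt (fun y => T (u y)) ((fderiv ℝ T (u x)).comp (fderivWithin ℝ u S x))
      S x := hasFDerivWithinAt_comp_of_differentiableAt (W →L[ℝ] W') T hT hu
  unfold dirDeriv
  rw [HasFDerivWithinAt.fderivWithin (h1.clm_apply hY.hasFDerivWithinAt) (hS x hx)]
  simp
  abel

theorem dirDeriv_isOpen {Ω : Set W} (hΩ : IsOpen Ω) {z : W} (hz : z ∈ Ω) (a : W) (φ : W → W') :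
    dirDeriv Ω a φ z = fderiv ℝ φ z a := by
  rw [dirDeriv, fderivWithin_of_isOpen hΩ hz]

theorem IsLeviCivita.mono {Ω Ω₁ : Set W} {G : W → W →L[ℝ] W →L[ℝ] ℝ}
    {Γ : W → W →L[ℝ] W →L[ℝ] W} (h : IsLeviCivita Ω G Γ) (hs : Ω₁ ⊆ Ω) (hΩ₁ : IsOpen Ω₁) :
    IsLeviCivita Ω₁ G Γ where
  isOpen := hΩ₁
  contDiffOn_metric := h.contDiffOn_metric.mono hs
  contDiffOn_form := h.contDiffOn_form.mono hs
  metric_symm z hz := h.metric_symm z (hs hz)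
  form_symm z hz := h.form_symm z (hs hz)
  fderiv_metric z hz := h.fderiv_metric z (hs hz)

variable {Ω : Set W} {Ω' : Set W'} {G : W → W →L[ℝ] W →L[ℝ] ℝ} {Γ : W → W →L[ℝ] W →L[ℝ] W}
  {G' : W' → W' →L[ℝ] W' →L[ℝ] ℝ} {Γ' : W' → W' →L[ℝ] W' →L[ℝ] W'} {τ : W → W'}

/-- The transformation law of the Christoffel symbols under an isometry `τ`. -/
theorem IsLeviCivita.christoffel_isometry (h : IsLeviCivita Ω G Γ) (h' : IsLeviCivita Ω' G' Γ')
    (hτ : ContDiffOn ℝ ∞ τ Ω) (hΩ : MapsTo τ Ω Ω')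
    (hG : ∀ z ∈ Ω, ∀ a b : W, G z a b = G' (τ z) (fderiv ℝ τ z a) (fderiv ℝ τ z b))
    {z : W} (hz : z ∈ Ω) (a b c : W) :
    G' (τ z) (fderiv ℝ (fderiv ℝ τ) z a b + Γ' (τ z) (fderiv ℝ τ z a) (fderiv ℝ τ z b))
      (fderiv ℝ τ z c) = G z (Γ z a b) c := by
  have hS : UniqueDiffOn ℝ Ω := h.isOpen.uniqueDiffOn
  have hS' : Ω ⊆ closure (interior Ω) := by rw [h.isOpen.interior_eq]; exact subset_closure
  have hd : ∀ v y, y ∈ Ω → dirDeriv Ω v τ y = fderiv ℝ τ y v := fun v y hy =>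
    dirDeriv_isOpen h.isOpen hy v τ
  have hid : ∀ v y, y ∈ Ω → dirDeriv Ω v (id : W → W) y = v := fun v y hy => by
    rw [dirDeriv_isOpen h.isOpen hy, fderiv_id]
    rfl
  have k1 := h'.koszul hS hS' hΩ (hτ.of_le (by norm_cast)) hz a b c
  have k2 := h.koszul (u := id) hS hS' (mapsTo_id Ω) contDiffOn_id hz a b c
  have hc : ∀ v w r, dirDeriv Ω v (fun y => G' (τ y) (dirDeriv Ω w τ y) (dirDeriv Ω r τ y)) z
      = dirDeriv Ω v (fun y => G (id y) (dirDeriv Ω w id y) (dirDeriv Ω r id y)) z :=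
    fun v w r => dirDeriv_congr (fun y hy => by
      simp only [hd _ y hy, hid _ y hy, id, hG y hy]) hz v
  rw [hc, hc, hc, k2] at k1
  have k3 := mul_left_cancel₀ two_ne_zero k1
  have e1 : covDeriv Γ Ω id a (dirDeriv Ω b id) z = Γ z a b := by
    unfold covDeriv
    rw [dirDeriv_congr (ψ := fun _ => b) (fun y hy => hid b y hy) hz, dirDeriv_const, hid a z hz,
      hid b z hz, zero_add]
    rfl
  have hfd : DifferentiableAt ℝ (fderiv ℝ τ) z :=
    ((hτ.fderiv_of_isOpen (m := ∞) h.isOpen (by simp)).contDiffAt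
      (h.isOpen.mem_nhds hz)).differentiableAt (by simp)
  have e2 : covDeriv Γ' Ω τ a (dirDeriv Ω b τ) z
      = fderiv ℝ (fderiv ℝ τ) z a b + Γ' (τ z) (fderiv ℝ τ z a) (fderiv ℝ τ z b) := by
    unfold covDeriv
    rw [dirDeriv_congr (fun y hy => hd b y hy) hz, hd a z hz, hd b z hz,
      dirDeriv_isOpen h.isOpen hz, fderiv_clm_apply hfd (differentiableAt_const _)]
    simp
  rw [e1, e2, hid c z hz, hd c z hz] at k3
  exact k3.symm

/-- The covariant derivative of the coordinate vector fields along `u` does not depend on the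
coordinates of the target. -/
theorem IsLeviCivita.covDeriv_isometry (h : IsLeviCivita Ω G Γ) (h' : IsLeviCivita Ω' G' Γ')
    (hτ : ContDiffOn ℝ ∞ τ Ω) (hΩ : MapsTo τ Ω Ω')
    (hG : ∀ z ∈ Ω, ∀ a b : W, G z a b = G' (τ z) (fderiv ℝ τ z a) (fderiv ℝ τ z b))
    {S : Set X} (hS : UniqueDiffOn ℝ S) {u : X → W} (hu : ContDiffOn ℝ 2 u S) (huS : MapsTo u S Ω)
    {x : X} (hx : x ∈ S) (ξ η : X) (y : W) :
    G' (τ (u x)) (covDeriv Γ' S (τ ∘ u) ξ (dirDeriv S η (τ ∘ u)) x) (fderiv ℝ τ (u x) y)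
      = G (u x) (covDeriv Γ S u ξ (dirDeriv S η u) x) y := by
  have hu0 : ∀ x ∈ S, DifferentiableWithinAt ℝ u S x := hu.differentiableOn (by norm_num)
  have hτd : ∀ z ∈ Ω, DifferentiableAt ℝ τ z := fun z hz =>
    (hτ.contDiffAt (h.isOpen.mem_nhds hz)).differentiableAt (by simp)
  have hfd : DifferentiableAt ℝ (fderiv ℝ τ) (u x) :=
    ((hτ.fderiv_of_isOpen (m := ∞) h.isOpen (by simp)).contDiffAt
      (h.isOpen.mem_nhds (huS hx))).differentiableAt (by simp)
  have hcomp : ∀ ζ, EqOn (dirDeriv S ζ (τ ∘ u)) (fun y => fderiv ℝ τ (u y) (dirDeriv S ζ u y)) S :=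
    fun ζ y hy => by
      unfold dirDeriv
      rw [fderiv_comp_fderivWithin y (hτd _ (huS hy)) (hu0 y hy) (hS y hy)]
      rfl
  have hdu : DifferentiableWithinAt ℝ (dirDeriv S η u) S x :=
    (hu.dirDeriv (k := 1) hS (by norm_num) η).differentiableOn (by norm_num) x hx
  have e1 : covDeriv Γ' S (τ ∘ u) ξ (dirDeriv S η (τ ∘ u)) x
      = fderiv ℝ τ (u x) (dirDeriv S ξ (dirDeriv S η u) x)
        + (fderiv ℝ (fderiv ℝ τ) (u x) (dirDeriv S ξ u x) (dirDeriv S η u x)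
          + Γ' (τ (u x)) (fderiv ℝ τ (u x) (dirDeriv S ξ u x))
            (fderiv ℝ τ (u x) (dirDeriv S η u x))) := by
    unfold covDeriv
    rw [dirDeriv_congr (hcomp η) hx, hcomp ξ hx, hcomp η hx,
      dirDeriv_clm_apply hS hx hfd (hu0 x hx) hdu]
    simp only [Function.comp]
    abel
  rw [e1, map_add, add_apply, h.christoffel_isometry h' hτ hΩ hG (huS hx), ← hG _ (huS hx)]
  simp [covDeriv]

end CoordinateChange

/-! ### Regularity of the unit normal -/

section NormalRegularity

variable {X W ι : Type*} [NormedAddCommGroup X] [NormedSpace ℝ X]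
  [NormedAddCommGroup W] [NormedSpace ℝ W] [Fintype ι] [DecidableEq ι]
  {S : Set X} {Ω : Set W} {G : W → W →L[ℝ] W →L[ℝ] ℝ} {Γ : W → W →L[ℝ] W →L[ℝ] W}
  {e : ι → X} {u n : X → W}

/-- The unit normal is as regular as the first derivatives of the parametrization: it is the
normalized normal part of any vector `t` with `G(t, n) < 0`. -/
theorem contDiffOn_unitNormal (h : IsLeviCivita Ω G Γ) (hS : UniqueDiffOn ℝ S)
    (hΩ : MapsTo u S Ω) (hu : ContDiffOn ℝ 3 u S)
    (hdim : Module.finrank ℝ W = Fintype.card ι + 1)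
    (horth : ∀ x ∈ S, ∀ i, G (u x) (n x) (dirDeriv S (e i) u x) = 0)
    (hunit : ∀ x ∈ S, G (u x) (n x) (n x) = -1)
    (hdet : ∀ x ∈ S, (gram G S e u x).det ≠ 0) (t : W)
    (ht : ∀ x ∈ S, 0 < -G (u x) t (n x)) : ContDiffOn ℝ 2 n S := by
  have hfd : FiniteDimensional ℝ W :=
    FiniteDimensional.of_finrank_pos (by rw [hdim]; exact Nat.succ_pos _)
  have hu2 : ContDiffOn ℝ 2 u S := hu.of_le (by norm_num)
  have hG2 : ContDiffOn ℝ 2 G Ω := h.contDiffOn_metric.of_le (by norm_cast)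
  have htan : ∀ i, ContDiffOn ℝ 2 (dirDeriv S (e i) u) S := fun i =>
    hu.dirDeriv hS (by norm_num) (e i)
  have hP : ∀ i j, ContDiffOn ℝ 2 (fun x => (gram G S e u x)⁻¹ i j) S :=
    contDiffOn_matrix_inv (fun i j => hG2.bilin hu2 hΩ (htan i) (htan j)) hdet
  let v : X → W := fun x => t - ∑ i, (∑ j, G (u x) t (dirDeriv S (e j) u x)
    * (gram G S e u x)⁻¹ j i) • dirDeriv S (e i) u x
  have hv : ContDiffOn ℝ 2 v S :=
    contDiffOn_const.sub (ContDiffOn.sum fun i _ => (ContDiffOn.sum fun j _ =>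
      (hG2.bilin hu2 hΩ contDiffOn_const (htan j)).mul (hP j i)).smul (htan i))
  have hvn : ∀ x ∈ S, v x = (-G (u x) t (n x)) • n x := fun x hx => by
    have h1 := frame_expansion (ContinuousLinearMap.toLinearMap₁₂ (G (u x)))
      (fun i => dirDeriv S (e i) u x) (n x) hdim (hdet x hx)
      (fun i => (h.metric_symm _ (hΩ hx) _ _).trans (horth x hx i))
      (horth x hx) (hunit x hx) t
    have h2 : t - ∑ i, (∑ j, G (u x) t (dirDeriv S (e j) u x)
        * (gram G S e u x)⁻¹ j i) • dirDeriv S (e i) u x = -(G (u x) t (n x) • n x) :=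
      sub_eq_iff_eq_add'.2 (h1.trans (sub_eq_add_neg _ _))
    rw [neg_smul]
    exact h2
  have hvv : ∀ x ∈ S, -G (u x) (v x) (v x) = (-G (u x) t (n x)) ^ 2 := fun x hx => by
    rw [hvn x hx]
    simp only [map_smul, smul_apply, smul_eq_mul, hunit x hx]
    ring
  have hpos : ∀ x ∈ S, -G (u x) (v x) (v x) ≠ 0 := fun x hx => by
    rw [hvv x hx]
    exact (pow_pos (ht x hx) 2).ne'
  have hsq : ContDiffOn ℝ 2 (fun x => √(-G (u x) (v x) (v x))) S :=
    (hG2.bilin hu2 hΩ hv hv).neg.sqrt hpos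
  refine ((hsq.inv fun x hx => ?_).smul hv).congr fun x hx => ?_
  · rw [hvv x hx, Real.sqrt_sq (ht x hx).le]
    exact (ht x hx).ne'
  · change n x = (√(-G (u x) (v x) (v x)))⁻¹ • v x
    rw [hvv x hx, Real.sqrt_sq (ht x hx).le, hvn x hx, smul_smul,
      inv_mul_cancel₀ (ht x hx).ne', one_smul]

end NormalRegularity

/-! ### Slices of functions on a space-time domain -/

section ProductDomain

variable {V W : Type*} [NormedAddCommGroup V] [NormedSpace ℝ V]
  [NormedAddCommGroup W] [NormedSpace ℝ W] {U : Set V} {K : Set ℝ} {φ : V × ℝ → W}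
  {z : V} {r : ℝ}

theorem hasFDerivAt_slice (hU : IsOpen U) (hz : z ∈ U) (hr : r ∈ K)
    (hφ : DifferentiableWithinAt ℝ φ (U ×ˢ K) (z, r)) :
    HasFDerivAt (fun y => φ (y, r))
      ((fderivWithin ℝ φ (U ×ˢ K) (z, r)).comp (ContinuousLinearMap.inl ℝ V ℝ)) z := by
  have h1 := hφ.hasFDerivWithinAt.comp z
    (hasFDerivAt_prodMk_left z r).hasFDerivWithinAt (fun y hy => mk_mem_prod hy hr)
  exact h1.hasFDerivAt (hU.mem_nhds hz)

theorem dirDeriv_slice (hU : IsOpen U) (hz : z ∈ U) (hr : r ∈ K)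
    (hφ : DifferentiableWithinAt ℝ φ (U ×ˢ K) (z, r)) (v : V) :
    dirDeriv (U ×ˢ K) (v, 0) φ (z, r) = fderiv ℝ (fun y => φ (y, r)) z v := by
  rw [(hasFDerivAt_slice hU hz hr hφ).fderiv]
  rfl

theorem hasDerivWithinAt_slice (hz : z ∈ U)
    (hφ : DifferentiableWithinAt ℝ φ (U ×ˢ K) (z, r)) :
    HasDerivWithinAt (fun t => φ (z, t)) (dirDeriv (U ×ˢ K) (0, 1) φ (z, r)) K r := by
  have h1 := hφ.hasFDerivWithinAt.comp r
    (hasFDerivAt_prodMk_right z r).hasFDerivWithinAt (fun t ht => mk_mem_prod hz ht)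
  have h2 := h1.hasDerivWithinAt
  refine h2.congr_deriv ?_
  simp [dirDeriv]

theorem contDiffOn_slice {k : ℕ∞ω} (hr : r ∈ K) (hφ : ContDiffOn ℝ k φ (U ×ˢ K)) :
    ContDiffOn ℝ k (fun y => φ (y, r)) U :=
  hφ.comp (contDiffOn_id.prodMk contDiffOn_const) fun _ hy => mk_mem_prod hy hr

end ProductDomain

section Slices

variable {V W ι : Type*} [NormedAddCommGroup V] [NormedSpace ℝ V]
  [NormedAddCommGroup W] [NormedSpace ℝ W] {U : Set V} {K : Set ℝ} {z : V} {r : ℝ}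

/-- Iterated spatial derivatives on a product domain are those of the slices at fixed time. -/
theorem dirDeriv_dirDeriv_slice {φ : V × ℝ → W} (hU : IsOpen U) (hK : UniqueDiffOn ℝ K)
    (hz : z ∈ U) (hr : r ∈ K) (hφ : ContDiffOn ℝ 2 φ (U ×ˢ K)) (v v' : V) :
    dirDeriv (U ×ˢ K) (v, 0) (dirDeriv (U ×ˢ K) (v', 0) φ) (z, r)
      = fderiv ℝ (fun y => fderiv ℝ (fun y => φ (y, r)) y v') z v := by
  have hS : UniqueDiffOn ℝ (U ×ˢ K) := hU.uniqueDiffOn.prod hK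
  have h1 : ContDiffOn ℝ 1 (dirDeriv (U ×ˢ K) (v', 0) φ) (U ×ˢ K) :=
    hφ.dirDeriv hS (by norm_num) _
  rw [dirDeriv_slice hU hz hr (h1.differentiableOn (by norm_num) _ (mk_mem_prod hz hr))]
  have h2 : (fun y => dirDeriv (U ×ˢ K) (v', 0) φ (y, r))
      =ᶠ[nhds z] fun y => fderiv ℝ (fun y => φ (y, r)) y v' :=
    Filter.eventually_of_mem (hU.mem_nhds hz) fun y hy =>
      dirDeriv_slice hU hy hr (hφ.differentiableOn (by norm_num) _ (mk_mem_prod hy hr)) v'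
  rw [h2.fderiv_eq]

end Slices

/-! ### Space-like immersions in charts -/

section ChartRep

variable {m : ℕ} {M : Type*} [TopologicalSpace M] [ChartedSpace (E m) M]

/-- The map `Φ` in the charts at `p` and at `q₀`. -/
noncomputable def chartRep (Φ : M → ℝ × M) (p : M) (q₀ : ℝ × M) : E m → ℝ × E m :=
  extChartAt (modelN m) q₀ ∘ Φ ∘ (extChartAt (𝓡 m) p).symm

theorem chartRep_mem_target {Φ : M → ℝ × M} {p : M} {q₀ : ℝ × M} {z : E m}
    (hq : Φ ((extChartAt (𝓡 m) p).symm z) ∈ (extChartAt (modelN m) q₀).source) :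
    chartRep Φ p q₀ z ∈ (extChartAt (modelN m) q₀).target :=
  (extChartAt (modelN m) q₀).map_source hq

end ChartRep

section ImmersionInCharts

variable {m : ℕ} {M : Type*} [TopologicalSpace M] [ChartedSpace (E m) M] [IsManifold (𝓡 m) ∞ M]
  {f : ℝ → ℝ}
  (gt : Bundle.ContMDiffRiemannianMetric (𝓡 m) ∞ (E m) (fun x : M => TangentSpace (𝓡 m) x))
  {Φ : M → ℝ × M} {p : M} {q₀ : ℝ × M} {z : E m}

/-- The future oriented unit normal of `Φ` as an element of the coordinate space. -/
noncomputable def modelNormal (f : ℝ → ℝ)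
    (gt : Bundle.ContMDiffRiemannianMetric (𝓡 m) ∞ (E m) (fun x : M => TangentSpace (𝓡 m) x))
    (Φ : M → ℝ × M) (p : M) : ℝ × E m :=
  unitNormal f gt Φ p

/-- The unit normal of `Φ` in the charts at `p` and at `q₀`. -/
noncomputable def chartNormal (f : ℝ → ℝ)
    (gt : Bundle.ContMDiffRiemannianMetric (𝓡 m) ∞ (E m) (fun x : M => TangentSpace (𝓡 m) x))
    (Φ : M → ℝ × M) (p : M) (q₀ : ℝ × M) (z : E m) : ℝ × E m :=
  modelDeriv (modelN m) 𝓘(ℝ, ℝ × E m) (extChartAt (modelN m) q₀)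
    (Φ ((extChartAt (𝓡 m) p).symm z)) (modelNormal f gt Φ ((extChartAt (𝓡 m) p).symm z))

theorem chartTangent_chartNormal
    (hq : Φ ((extChartAt (𝓡 m) p).symm z) ∈ (extChartAt (modelN m) q₀).source) :
    chartTangent (modelN m) q₀ (chartRep Φ p q₀ z) (chartNormal f gt Φ p q₀ z)
      = modelNormal f gt Φ ((extChartAt (𝓡 m) p).symm z) :=
  chartTangent_modelDeriv hq _

theorem chartTangent_fderiv_chartRep (hz : z ∈ (extChartAt (𝓡 m) p).target)
    (hq : Φ ((extChartAt (𝓡 m) p).symm z) ∈ (extChartAt (modelN m) q₀).source)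
    (hΦ : MDifferentiableAt (𝓡 m) (modelN m) Φ ((extChartAt (𝓡 m) p).symm z)) (v : E m) :
    chartTangent (modelN m) q₀ (chartRep Φ p q₀ z) (fderiv ℝ (chartRep Φ p q₀) z v)
      = modelDeriv (𝓡 m) (modelN m) Φ ((extChartAt (𝓡 m) p).symm z)
        (chartTangent (𝓡 m) p z v) :=
  (modelDeriv_comp_chartTangent hz hq hΦ v).symm

theorem chartMetric_chartRep
    (hq : Φ ((extChartAt (𝓡 m) p).symm z) ∈ (extChartAt (modelN m) q₀).source)
    (a b : ℝ × E m) :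
    chartMetric f gt q₀ (chartRep Φ p q₀ z) a b
      = warpedForm f gt (Φ ((extChartAt (𝓡 m) p).symm z))
        (chartTangent (modelN m) q₀ (chartRep Φ p q₀ z) a)
        (chartTangent (modelN m) q₀ (chartRep Φ p q₀ z) b) := by
  rw [chartMetric_apply]
  have : (extChartAt (modelN m) q₀).symm (chartRep Φ p q₀ z)
      = Φ ((extChartAt (𝓡 m) p).symm z) := (extChartAt (modelN m) q₀).left_inv hq
  rw [this]

/-- The map `Φ`, read in charts, induces the metric `Φ^* ḡ`. -/
theorem inducedMetric_chart (hz : z ∈ (extChartAt (𝓡 m) p).target)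
    (hq : Φ ((extChartAt (𝓡 m) p).symm z) ∈ (extChartAt (modelN m) q₀).source)
    (hΦ : MDifferentiableAt (𝓡 m) (modelN m) Φ ((extChartAt (𝓡 m) p).symm z)) (v v' : E m) :
    chartMetric f gt q₀ (chartRep Φ p q₀ z) (fderiv ℝ (chartRep Φ p q₀) z v)
        (fderiv ℝ (chartRep Φ p q₀) z v')
      = inducedMetric f gt Φ ((extChartAt (𝓡 m) p).symm z) (chartTangent (𝓡 m) p z v)
        (chartTangent (𝓡 m) p z v') := by
  rw [chartMetric_chartRep gt hq, chartTangent_fderiv_chartRep hz hq hΦ,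
    chartTangent_fderiv_chartRep hz hq hΦ]
  rfl

theorem coordMetric_induced (hz : z ∈ (extChartAt (𝓡 m) p).target)
    (hq : Φ ((extChartAt (𝓡 m) p).symm z) ∈ (extChartAt (modelN m) q₀).source)
    (hΦ : MDifferentiableAt (𝓡 m) (modelN m) Φ ((extChartAt (𝓡 m) p).symm z)) (i j : Fin m) :
    coordMetric (𝓡 m) (basisM m) (inducedMetric f gt Φ) p z i j
      = chartMetric f gt q₀ (chartRep Φ p q₀ z) (fderiv ℝ (chartRep Φ p q₀) z (basisM m i))
        (fderiv ℝ (chartRep Φ p q₀) z (basisM m j)) := by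
  rw [inducedMetric_chart gt hz hq hΦ]
  rfl

theorem normal_orthogonal_chart (hsp : IsSpacelike f gt Φ) (hz : z ∈ (extChartAt (𝓡 m) p).target)
    (hq : Φ ((extChartAt (𝓡 m) p).symm z) ∈ (extChartAt (modelN m) q₀).source)
    (hΦ : MDifferentiableAt (𝓡 m) (modelN m) Φ ((extChartAt (𝓡 m) p).symm z)) (v : E m) :
    chartMetric f gt q₀ (chartRep Φ p q₀ z) (chartNormal f gt Φ p q₀ z)
      (fderiv ℝ (chartRep Φ p q₀) z v) = 0 := by
  rw [chartMetric_chartRep gt hq, chartTangent_fderiv_chartRep hz hq hΦ,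
    chartTangent_chartNormal gt hq]
  exact (unitNormal_spec f gt Φ hsp _).1 _

theorem normal_unit_chart (hsp : IsSpacelike f gt Φ)
    (hq : Φ ((extChartAt (𝓡 m) p).symm z) ∈ (extChartAt (modelN m) q₀).source) :
    chartMetric f gt q₀ (chartRep Φ p q₀ z) (chartNormal f gt Φ p q₀ z)
      (chartNormal f gt Φ p q₀ z) = -1 := by
  rw [chartMetric_chartRep gt hq, chartTangent_chartNormal gt hq]
  exact (unitNormal_spec f gt Φ hsp _).2.1

theorem normal_future_chart (hsp : IsSpacelike f gt Φ)
    (hq : Φ ((extChartAt (𝓡 m) p).symm z) ∈ (extChartAt (modelN m) q₀).source) :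
    0 < -chartMetric f gt q₀ (chartRep Φ p q₀ z) (1, 0) (chartNormal f gt Φ p q₀ z) := by
  rw [chartMetric_chartRep gt hq, chartTangent_chartNormal gt hq,
    chartTangent_prod (chartRep_mem_target hq)]
  simp only [map_zero]
  exact (unitNormal_spec f gt Φ hsp _).2.2

/-- The matrix of a positive definite metric is invertible. -/
theorem det_coordMetric_induced_ne_zero (hsp : IsSpacelike f gt Φ)
    (hz : z ∈ (extChartAt (𝓡 m) p).target) :
    (coordMetric (𝓡 m) (basisM m) (inducedMetric f gt Φ) p z).det ≠ 0 := by
  intro hdet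
  obtain ⟨c, hc, hc0⟩ := Matrix.exists_mulVec_eq_zero_iff.2 hdet
  set x : M := (extChartAt (𝓡 m) p).symm z with hx
  set B : E m →ₗ[ℝ] E m →ₗ[ℝ] ℝ := (warpedForm f gt (Φ x)).compl₁₂
    ((modelDeriv (𝓡 m) (modelN m) Φ x).comp (chartTangent (𝓡 m) p z)).toLinearMap
    ((modelDeriv (𝓡 m) (modelN m) Φ x).comp (chartTangent (𝓡 m) p z)).toLinearMap with hB
  have hBm : ∀ i j, coordMetric (𝓡 m) (basisM m) (inducedMetric f gt Φ) p z i j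
      = B (basisM m i) (basisM m j) := fun i j => rfl
  set v : E m := ∑ i, c i • basisM m i with hv
  have hBv : B v v = 0 := by
    have h1 : B v v = ∑ i, c i * ((coordMetric (𝓡 m) (basisM m) (inducedMetric f gt Φ) p z).mulVec
        c) i := by
      have h2 : ∀ y, B y v = ∑ j, c j * B y (basisM m j) := fun y => by
        rw [hv]
        simp only [map_sum, map_smul, smul_eq_mul]
      rw [h2]
      have h3 : ∀ y, B v y = ∑ i, c i * B (basisM m i) y := fun y => by
        rw [hv]
        simp only [map_sum, map_smul, LinearMap.sum_apply, LinearMap.smul_apply, smul_eq_mul]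
      simp only [h3, Matrix.mulVec, dotProduct, hBm, Finset.mul_sum]
      rw [Finset.sum_comm]
      exact Finset.sum_congr rfl fun i _ => Finset.sum_congr rfl fun j _ => by ring
    rw [h1, hc0]
    simp
  have hv0 : v = 0 := by
    by_contra hne
    have h1 : chartTangent (𝓡 m) p z v ≠ 0 := fun h0 =>
      hne (chartTangent_injective hz (by rw [h0, map_zero]))
    exact (hsp x (chartTangent (𝓡 m) p z v) h1).ne' hBv
  refine hc (funext fun i => ?_)
  have h1 : (basisM m).repr v i = c i := by rw [hv, (basisM m).repr_sum_self]
  rw [← h1, hv0]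
  simp

/-- The transition maps of the space-time are isometries for the metrics read in the charts. -/
theorem chartMetric_change {q₀ q : ℝ × M} {y : ℝ × E m}
    (hy : y ∈ (extChartAt (modelN m) q₀).target)
    (hq : (extChartAt (modelN m) q₀).symm y ∈ (extChartAt (modelN m) q).source)
    (a b : ℝ × E m) :
    chartMetric f gt q₀ y a b
      = chartMetric f gt q ((extChartAt (modelN m) q ∘ (extChartAt (modelN m) q₀).symm) y)
        (fderiv ℝ (extChartAt (modelN m) q ∘ (extChartAt (modelN m) q₀).symm) y a)
        (fderiv ℝ (extChartAt (modelN m) q ∘ (extChartAt (modelN m) q₀).symm) y b) := by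
  rw [chartMetric_apply, chartMetric_apply, chartTangent_change hy hq, chartTangent_change hy hq]
  have : (extChartAt (modelN m) q).symm
      ((extChartAt (modelN m) q ∘ (extChartAt (modelN m) q₀).symm) y)
      = (extChartAt (modelN m) q₀).symm y := (extChartAt (modelN m) q).left_inv hq
  rw [this]
  rfl

end ImmersionInCharts

/-! ### The second fundamental form in an arbitrary chart of the space-time -/

theorem covDeriv_isOpen {V W : Type*} [NormedAddCommGroup V] [NormedSpace ℝ V]
    [NormedAddCommGroup W] [NormedSpace ℝ W] {U : Set V} (hU : IsOpen U) {z : V} (hz : z ∈ U)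
    (Γ : W → W →L[ℝ] W →L[ℝ] W) (u : V → W) (ξ η : V) :
    covDeriv Γ U u ξ (dirDeriv U η u) z
      = fderiv ℝ (fun y => fderiv ℝ u y η) z ξ + Γ (u z) (fderiv ℝ u z ξ) (fderiv ℝ u z η) := by
  unfold covDeriv
  rw [dirDeriv_congr (fun y hy => dirDeriv_isOpen hU hy η u) hz, dirDeriv_isOpen hU hz,
    dirDeriv_isOpen hU hz, dirDeriv_isOpen hU hz]

section SecondFundamentalForm

variable {m : ℕ} {M : Type*} [TopologicalSpace M] [ChartedSpace (E m) M] [IsManifold (𝓡 m) ∞ M]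
  {f : ℝ → ℝ}
  (gt : Bundle.ContMDiffRiemannianMetric (𝓡 m) ∞ (E m) (fun x : M => TangentSpace (𝓡 m) x))
  {Φ : M → ℝ × M}

/-- The covariant Hessian of `Φ` as an element of the coordinate space. -/
noncomputable def modelHessian (f : ℝ → ℝ)
    (gt : Bundle.ContMDiffRiemannianMetric (𝓡 m) ∞ (E m) (fun x : M => TangentSpace (𝓡 m) x))
    (Φ : M → ℝ × M) (p : M) (i j : Fin m) : ℝ × E m :=
  pullbackHessian f gt Φ p i j

theorem modelHessian_eq (p : M) (i j : Fin m) :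
    modelHessian f gt Φ p i j
      = fderiv ℝ (fun y => fderiv ℝ (coordRep Φ p) y (basisM m j)) (extChartAt (𝓡 m) p p)
          (basisM m i)
        + chartChristoffel f gt (Φ p) (extChartAt (modelN m) (Φ p) (Φ p))
          (fderiv ℝ (coordRep Φ p) (extChartAt (𝓡 m) p p) (basisM m i))
          (fderiv ℝ (coordRep Φ p) (extChartAt (𝓡 m) p p) (basisM m j)) := by
  rw [chartChristoffel, christoffelForm_apply]
  rfl

/-- The tangential part of the second fundamental form does not contribute to its normal
component. -/
theorem scalarSFF_eq (hsp : IsSpacelike f gt Φ) (p : M) (i j : Fin m) :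
    scalarSFF f gt Φ p i j
      = warpedForm f gt (Φ p) (modelHessian f gt Φ p i j) (modelNormal f gt Φ p) := by
  have h1 : ∀ y : E m, warpedForm f gt (Φ p) (modelDeriv (𝓡 m) (modelN m) Φ p y)
      (modelNormal f gt Φ p) = 0 := fun y => by
    rw [warpedForm_symm]
    exact (unitNormal_spec f gt Φ hsp p).1 y
  have h2 : scalarSFF f gt Φ p i j = warpedForm f gt (Φ p) (modelHessian f gt Φ p i j
      - ∑ k, christoffelAt (𝓡 m) (basisM m) (inducedMetric f gt Φ) p k i j
        • modelDeriv (𝓡 m) (modelN m) Φ p (basisM m k)) (modelNormal f gt Φ p) := rfl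
  rw [h2]
  simp only [map_sub, map_sum, map_smul, LinearMap.sub_apply, LinearMap.sum_apply,
    LinearMap.smul_apply, h1, smul_zero, Finset.sum_const_zero, sub_zero]

/-- The second fundamental form computed in the chart of the space-time at any point `q₀` near
`Φ p`. -/
theorem scalarSFF_chart (hf : ContDiff ℝ ∞ f) (hf_pos : ∀ t, 0 < f t)
    (hsp : IsSpacelike f gt Φ) {p : M} {q₀ : ℝ × M} {U : Set (E m)} (hU : IsOpen U)
    (hUt : U ⊆ (extChartAt (𝓡 m) p).target)
    (hq : ∀ z ∈ U, Φ ((extChartAt (𝓡 m) p).symm z) ∈ (extChartAt (modelN m) q₀).source)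
    (hΦ : Continuous Φ)
    (hu : ContDiffOn ℝ 2 (chartRep Φ p q₀) U) (hz : extChartAt (𝓡 m) p p ∈ U) (i j : Fin m) :
    scalarSFF f gt Φ p i j
      = chartMetric f gt q₀ (chartRep Φ p q₀ (extChartAt (𝓡 m) p p))
        (fderiv ℝ (fun y => fderiv ℝ (chartRep Φ p q₀) y (basisM m j)) (extChartAt (𝓡 m) p p)
          (basisM m i)
        + chartChristoffel f gt q₀ (chartRep Φ p q₀ (extChartAt (𝓡 m) p p))
          (fderiv ℝ (chartRep Φ p q₀) (extChartAt (𝓡 m) p p) (basisM m i))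
          (fderiv ℝ (chartRep Φ p q₀) (extChartAt (𝓡 m) p p) (basisM m j)))
        (chartNormal f gt Φ p q₀ (extChartAt (𝓡 m) p p)) := by
  set χ : PartialEquiv M (E m) := extChartAt (𝓡 m) p with hχ
  set φ : PartialEquiv (ℝ × M) (ℝ × E m) := extChartAt (modelN m) q₀ with hφ
  set φ' : PartialEquiv (ℝ × M) (ℝ × E m) := extChartAt (modelN m) (Φ p) with hφ'
  set u : E m → ℝ × E m := chartRep Φ p q₀ with hu_def
  set z := χ p with hz_def
  have hχz : χ.symm z = p := extChartAt_to_inv (I := 𝓡 m) p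
  set τ := φ' ∘ φ.symm with hτ_def
  set Ω := φ.target ∩ φ.symm ⁻¹' φ'.source with hΩ_def
  have hΩ : IsOpen Ω := (continuousOn_extChartAt_symm q₀).isOpen_inter_preimage
    (isOpen_extChartAt_target _) (isOpen_extChartAt_source _)
  -- the part of `U` which is mapped to the domain of both charts of the space-time
  set U' := U ∩ (Φ ∘ χ.symm) ⁻¹' φ'.source with hU'_def
  have hU' : IsOpen U' :=
    ((hΦ.comp_continuousOn (continuousOn_extChartAt_symm p)).mono hUt).isOpen_inter_preimage
      hU (isOpen_extChartAt_source _)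
  have hz' : z ∈ U' := by
    refine ⟨hz, ?_⟩
    rw [mem_preimage, Function.comp, hχz]
    exact mem_extChartAt_source _
  have hinv : ∀ y ∈ U, φ.symm (u y) = Φ (χ.symm y) := fun y hy => φ.left_inv (hq y hy)
  have hmaps : MapsTo u U' Ω := fun y hy => by
    refine ⟨chartRep_mem_target (hq y hy.1), ?_⟩
    rw [mem_preimage, hinv y hy.1]
    exact hy.2
  have hcomp : EqOn (τ ∘ u) (coordRep Φ p) U' := fun y hy => by
    change φ' (φ.symm (u y)) = φ' (Φ (χ.symm y))
    rw [hinv y hy.1]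
  have hτz : τ (u z) = φ' (Φ p) := by
    change φ' (φ.symm (u z)) = _
    rw [hinv z hz, hχz]
  have key := ((isLeviCivita_chart gt hf hf_pos q₀).mono inter_subset_left hΩ).covDeriv_isometry
    (isLeviCivita_chart gt hf hf_pos (Φ p)) (τ := τ) (contDiffOn_chart_change q₀ (Φ p))
    (fun y hy => φ'.map_source hy.2)
    (fun y hy a b => chartMetric_change gt hy.1 hy.2 a b) hU'.uniqueDiffOn
    (hu.mono inter_subset_left) hmaps hz' (basisM m i) (basisM m j)
    (chartNormal f gt Φ p q₀ z)
  have hev : coordRep Φ p =ᶠ[nhds z] τ ∘ u :=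
    Filter.eventually_of_mem (hU'.mem_nhds hz') fun y hy => (hcomp hy).symm
  have hhess : modelHessian f gt Φ p i j
      = covDeriv (chartChristoffel f gt (Φ p)) U' (τ ∘ u) (basisM m i)
        (dirDeriv U' (basisM m j) (τ ∘ u)) z := by
    rw [covDeriv_isOpen hU' hz', modelHessian_eq, ← hev.fderiv_eq]
    have h1 : (fun y => fderiv ℝ (coordRep Φ p) y (basisM m j))
        =ᶠ[nhds z] fun y => fderiv ℝ (τ ∘ u) y (basisM m j) :=
      (hev.fderiv (𝕜 := ℝ)).mono fun y hy => congrArg (fun T => T (basisM m j)) hy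
    rw [← h1.fderiv_eq, Function.comp, hτz]
  have hnormal : fderiv ℝ τ (u z) (chartNormal f gt Φ p q₀ z) = modelNormal f gt Φ p := by
    have h1 := chartTangent_change (hmaps hz').1 (hmaps hz').2 (chartNormal f gt Φ p q₀ z)
    rw [chartTangent_chartNormal gt (hq z hz)] at h1
    have h2 : φ' (φ.symm (u z)) = φ' (Φ p) := hτz
    rw [h2, chartTangent_self] at h1
    rw [← h1, hχz]
  rw [scalarSFF_eq gt hsp, ← covDeriv_isOpen hU' hz', ← key, hτz, ← hhess, hnormal,
    chartMetric_apply, chartTangent_self, chartTangent_self, extChartAt_to_inv]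

end SecondFundamentalForm

/-! ### Prescribed mean curvature flows in charts -/

section FlowInCharts

variable {m : ℕ} {M : Type*} [TopologicalSpace M] [ChartedSpace (E m) M] [IsManifold (𝓡 m) ∞ M]
  {f : ℝ → ℝ}
  {gt : Bundle.ContMDiffRiemannianMetric (𝓡 m) ∞ (E m) (fun x : M => TangentSpace (𝓡 m) x)}
  {J K : Set ℝ} {ℋ : M → ℝ} {F : ℝ → M → ℝ × M} {p : M} {q₀ : ℝ × M} {U : Set (E m)}

/-- The spatial coordinate directions of `E m × ℝ`. -/
noncomputable def spaceDir (m : ℕ) (i : Fin m) : E m × ℝ := (basisM m i, 0)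

/-- The time direction of `E m × ℝ`. -/
def timeDir (m : ℕ) : E m × ℝ := (0, 1)

/-- The family `F` in the charts at `p` and at `q₀`. -/
noncomputable def flowMap (F : ℝ → M → ℝ × M) (p : M) (q₀ : ℝ × M) (x : E m × ℝ) : ℝ × E m :=
  chartRep (F x.2) p q₀ x.1

/-- The unit normals of the family `F` in the charts at `p` and at `q₀`. -/
noncomputable def flowNormal (f : ℝ → ℝ)
    (gt : Bundle.ContMDiffRiemannianMetric (𝓡 m) ∞ (E m) (fun x : M => TangentSpace (𝓡 m) x))
    (F : ℝ → M → ℝ × M) (p : M) (q₀ : ℝ × M) (x : E m × ℝ) : ℝ × E m :=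
  chartNormal f gt (F x.2) p q₀ x.1

/-- The speed `H - ℋ` in the chart at `p`. -/
noncomputable def flowSpeed (f : ℝ → ℝ)
    (gt : Bundle.ContMDiffRiemannianMetric (𝓡 m) ∞ (E m) (fun x : M => TangentSpace (𝓡 m) x))
    (ℋ : M → ℝ) (F : ℝ → M → ℝ × M) (p : M) (x : E m × ℝ) : ℝ :=
  meanCurvature f gt (F x.2) ((extChartAt (𝓡 m) p).symm x.1)
    - ℋ ((extChartAt (𝓡 m) p).symm x.1)

theorem IsPrescribedMCF.contMDiff_slice (hF : IsPrescribedMCF f gt J ℋ F) {s : ℝ} (hs : s ∈ J) :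
    ContMDiff (𝓡 m) (modelN m) 3 (F s) := by
  rw [← contMDiffOn_univ]
  exact hF.regular.comp (contMDiff_id.prodMk contMDiff_const).contMDiffOn
    fun x hx => mk_mem_prod hx hs

theorem IsPrescribedMCF.contDiffOn_flowMap (hF : IsPrescribedMCF f gt J ℋ F) (hKJ : K ⊆ J)
    (hUt : U ⊆ (extChartAt (𝓡 m) p).target)
    (hq : ∀ z ∈ U, ∀ r ∈ K, F r ((extChartAt (𝓡 m) p).symm z) ∈ (extChartAt (modelN m) q₀).source) :
    ContDiffOn ℝ 3 (flowMap F p q₀) (U ×ˢ K) := by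
  have h1 : ContMDiffOn 𝓘(ℝ, E m × ℝ) ((𝓡 m).prod 𝓘(ℝ, ℝ)) 3
      (fun x : E m × ℝ => ((extChartAt (𝓡 m) p).symm x.1, x.2)) (U ×ˢ K) := by
    refine ContMDiffOn.prodMk ?_ contDiff_snd.contMDiff.contMDiffOn
    exact (contMDiffOn_extChartAt_symm (I := 𝓡 m) (n := 3) p).comp
      contDiff_fst.contMDiff.contMDiffOn fun x hx => hUt hx.1
  have h2 := hF.regular.comp h1 fun x hx => mk_mem_prod (mem_univ _) (hKJ hx.2)
  rw [← contMDiffOn_iff_contDiffOn]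
  refine (contMDiffOn_extChartAt (I := modelN m) (x := q₀) (n := 3)).comp h2 fun x hx => ?_
  rw [← extChartAt_source (I := modelN m)]
  exact hq x.1 hx.1 x.2 hx.2

theorem IsPrescribedMCF.dirDeriv_flowMap (hF : IsPrescribedMCF f gt J ℋ F) (hKJ : K ⊆ J)
    (hU : IsOpen U) (hUt : U ⊆ (extChartAt (𝓡 m) p).target)
    (hq : ∀ z ∈ U, ∀ r ∈ K, F r ((extChartAt (𝓡 m) p).symm z) ∈ (extChartAt (modelN m) q₀).source)
    {x : E m × ℝ} (hx : x ∈ U ×ˢ K) (i : Fin m) :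
    dirDeriv (U ×ˢ K) (spaceDir m i) (flowMap F p q₀) x
      = fderiv ℝ (chartRep (F x.2) p q₀) x.1 (basisM m i) :=
  dirDeriv_slice hU hx.1 hx.2
    ((hF.contDiffOn_flowMap hKJ hUt hq).differentiableOn (by norm_num) _ hx) _

/-- The Gram matrix of the flow in charts is the matrix of the induced metric. -/
theorem IsPrescribedMCF.gram_flowMap (hF : IsPrescribedMCF f gt J ℋ F) (hKJ : K ⊆ J)
    (hU : IsOpen U) (hUt : U ⊆ (extChartAt (𝓡 m) p).target)
    (hq : ∀ z ∈ U, ∀ r ∈ K, F r ((extChartAt (𝓡 m) p).symm z) ∈ (extChartAt (modelN m) q₀).source)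
    {x : E m × ℝ} (hx : x ∈ U ×ˢ K) :
    gram (chartMetric f gt q₀) (U ×ˢ K) (spaceDir m) (flowMap F p q₀) x
      = coordMetric (𝓡 m) (basisM m) (inducedMetric f gt (F x.2)) p x.1 := by
  ext i j
  rw [coordMetric_induced gt (hUt hx.1) (hq _ hx.1 _ hx.2)
    ((hF.contMDiff_slice (hKJ hx.2)).mdifferentiable (by norm_num) _), gram, Matrix.of_apply,
    hF.dirDeriv_flowMap hKJ hU hUt hq hx, hF.dirDeriv_flowMap hKJ hU hUt hq hx]
  rfl

/-- The equation of motion in charts. -/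
theorem IsPrescribedMCF.dirDeriv_time_flowMap (hF : IsPrescribedMCF f gt J ℋ F) (hKJ : K ⊆ J)
    (hK : UniqueDiffOn ℝ K) (hUt : U ⊆ (extChartAt (𝓡 m) p).target)
    (hq : ∀ z ∈ U, ∀ r ∈ K, F r ((extChartAt (𝓡 m) p).symm z) ∈ (extChartAt (modelN m) q₀).source)
    {x : E m × ℝ} (hx : x ∈ U ×ˢ K) :
    dirDeriv (U ×ˢ K) (timeDir m) (flowMap F p q₀) x
      = -(flowSpeed f gt ℋ F p x • flowNormal f gt F p q₀ x) := by
  obtain ⟨z, r⟩ := x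
  have h1 := hasDerivWithinAt_slice hx.1
    ((hF.contDiffOn_flowMap hKJ hUt hq).differentiableOn (by norm_num) _ hx)
  have h2 := (hasDerivWithinAt_extChartAt_comp (I := modelN m)
    (v := (-(flowSpeed f gt ℋ F p (z, r)) •
      modelNormal f gt (F r) ((extChartAt (𝓡 m) p).symm z) : ℝ × E m))
    (hF.evolution r (hKJ hx.2) ((extChartAt (𝓡 m) p).symm z)) (hq z hx.1 r hx.2)).mono hKJ
  have h3 := (hK r hx.2).eq_deriv _ h1 h2
  rw [map_smul, neg_smul] at h3
  exact h3

/-- A prescribed mean curvature flow, read in charts, moves in normal direction. -/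
theorem IsPrescribedMCF.normalFlow (hF : IsPrescribedMCF f gt J ℋ F) (hf : ContDiff ℝ ∞ f)
    (hf_pos : ∀ t, 0 < f t) (hKJ : K ⊆ J) (hK : UniqueDiffOn ℝ K)
    (hK' : K ⊆ closure (interior K))
    (hU : IsOpen U) (hUt : U ⊆ (extChartAt (𝓡 m) p).target)
    (hq : ∀ z ∈ U, ∀ r ∈ K,
      F r ((extChartAt (𝓡 m) p).symm z) ∈ (extChartAt (modelN m) q₀).source) :
    NormalFlow (U ×ˢ K) (extChartAt (modelN m) q₀).target (chartMetric f gt q₀)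
      (chartChristoffel f gt q₀) (spaceDir m) (timeDir m) (flowMap F p q₀)
      (flowNormal f gt F p q₀) (flowSpeed f gt ℋ F p) := by
  have hmd : ∀ x ∈ U ×ˢ K, MDifferentiableAt (𝓡 m) (modelN m) (F x.2)
      ((extChartAt (𝓡 m) p).symm x.1) := fun x hx =>
    (hF.contMDiff_slice (hKJ hx.2)).mdifferentiable (by norm_num) _
  have hLC := isLeviCivita_chart gt hf hf_pos q₀
  have hS : UniqueDiffOn ℝ (U ×ˢ K) := hU.uniqueDiffOn.prod hK
  have hmaps : MapsTo (flowMap F p q₀) (U ×ˢ K) (extChartAt (modelN m) q₀).target :=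
    fun x hx => chartRep_mem_target (hq x.1 hx.1 x.2 hx.2)
  have hsp : ∀ x ∈ U ×ˢ K, IsSpacelike f gt (F x.2) := fun x hx => hF.spacelike _ (hKJ hx.2)
  have hdim : Module.finrank ℝ (ℝ × E m) = Fintype.card (Fin m) + 1 := by
    rw [Module.finrank_prod, Module.finrank_self, add_comm]
    simp
  have horth : ∀ x ∈ U ×ˢ K, ∀ i, chartMetric f gt q₀ (flowMap F p q₀ x)
      (flowNormal f gt F p q₀ x) (dirDeriv (U ×ˢ K) (spaceDir m i) (flowMap F p q₀) x) = 0 :=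
    fun x hx i => by
      rw [hF.dirDeriv_flowMap hKJ hU hUt hq hx]
      exact normal_orthogonal_chart gt (hsp x hx) (hUt hx.1) (hq _ hx.1 _ hx.2) (hmd x hx) _
  have hunit : ∀ x ∈ U ×ˢ K, chartMetric f gt q₀ (flowMap F p q₀ x)
      (flowNormal f gt F p q₀ x) (flowNormal f gt F p q₀ x) = -1 :=
    fun x hx => normal_unit_chart gt (hsp x hx) (hq _ hx.1 _ hx.2)
  have hdet : ∀ x ∈ U ×ˢ K,
      (gram (chartMetric f gt q₀) (U ×ˢ K) (spaceDir m) (flowMap F p q₀) x).det ≠ 0 :=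
    fun x hx => by
      rw [hF.gram_flowMap hKJ hU hUt hq hx]
      exact det_coordMetric_induced_ne_zero gt (hsp x hx) (hUt hx.1)
  exact
    { leviCivita := hLC
      uniqueDiffOn := hS
      subset_closure := by
        rw [interior_prod_eq, closure_prod_eq, hU.interior_eq]
        exact prod_mono subset_closure hK'
      mapsTo := hmaps
      contDiffOn_map := hF.contDiffOn_flowMap hKJ hUt hq
      contDiffOn_normal := contDiffOn_unitNormal hLC hS hmaps (hF.contDiffOn_flowMap hKJ hUt hq)
        hdim horth hunit hdet (1, 0)
        fun x hx => normal_future_chart gt (hsp x hx) (hq _ hx.1 _ hx.2)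
      velocity := fun x hx => hF.dirDeriv_time_flowMap hKJ hK hUt hq hx
      normal_orthogonal := horth
      normal_unit := hunit
      det_gram := hdet
      finrank_eq := hdim }

/-- At the centre of the chart of `M` the second fundamental form of the flow in charts is the
scalar second fundamental form. The chart of the space-time stays the one at `q₀`, whereas
`scalarSFF` at time `r` is defined in the chart at `F r p`. -/
theorem IsPrescribedMCF.sff_flowMap (hF : IsPrescribedMCF f gt J ℋ F) (hf : ContDiff ℝ ∞ f)
    (hf_pos : ∀ t, 0 < f t) (hKJ : K ⊆ J) (hK : UniqueDiffOn ℝ K)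
    (hU : IsOpen U) (hUt : U ⊆ (extChartAt (𝓡 m) p).target)
    (hq : ∀ z ∈ U, ∀ r ∈ K,
      F r ((extChartAt (𝓡 m) p).symm z) ∈ (extChartAt (modelN m) q₀).source)
    (hz : extChartAt (𝓡 m) p p ∈ U) {r : ℝ} (hr : r ∈ K) (i j : Fin m) :
    sff (chartMetric f gt q₀) (chartChristoffel f gt q₀) (U ×ˢ K) (spaceDir m) (flowMap F p q₀)
        (flowNormal f gt F p q₀) i j (extChartAt (𝓡 m) p p, r)
      = scalarSFF f gt (F r) p i j := by
  have hx : (extChartAt (𝓡 m) p p, r) ∈ U ×ˢ K := mk_mem_prod hz hr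
  have hu := hF.contDiffOn_flowMap hKJ hUt hq
  rw [scalarSFF_chart gt hf hf_pos (hF.spacelike r (hKJ hr)) hU hUt (fun z hz => hq z hz r hr)
    (hF.contMDiff_slice (hKJ hr)).continuous ((contDiffOn_slice hr hu).of_le (by norm_num)) hz]
  unfold sff covDeriv
  rw [hF.dirDeriv_flowMap hKJ hU hUt hq hx, hF.dirDeriv_flowMap hKJ hU hUt hq hx]
  have h1 := dirDeriv_dirDeriv_slice hU hK hz hr (hu.of_le (by norm_num)) (basisM m i) (basisM m j)
  change chartMetric f gt q₀ _ (dirDeriv (U ×ˢ K) (basisM m i, 0)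
    (dirDeriv (U ×ˢ K) (basisM m j, 0) (flowMap F p q₀)) _ + _) _ = _
  rw [h1]
  rfl

end FlowInCharts

/-! ### The Laplacian of a square -/

section Laplacian

variable {V H X ι : Type*} [NormedAddCommGroup V] [NormedSpace ℝ V]
  [TopologicalSpace H] [TopologicalSpace X] [ChartedSpace H X]

theorem pderiv_sq {b : Module.Basis ι ℝ V} {v : V → ℝ} {z : V} (hv : DifferentiableAt ℝ v z)
    (i : ι) : pderiv b i (fun y => v y ^ 2) z = 2 * v z * pderiv b i v z := by
  have h := (hv.hasFDerivAt.pow 2).fderiv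
  unfold pderiv
  rw [h]
  simp

theorem pderiv_pderiv_sq {b : Module.Basis ι ℝ V} {v : V → ℝ} {z : V} (hv : ContDiffAt ℝ 2 v z)
    (i j : ι) : pderiv b i (pderiv b j fun y => v y ^ 2) z
      = 2 * v z * pderiv b i (pderiv b j v) z + 2 * pderiv b i v z * pderiv b j v z := by
  have hd : ∀ᶠ y in nhds z, DifferentiableAt ℝ v y := (hv.eventually (by simp)).mono
    fun y hy => hy.differentiableAt (by norm_num)
  have h1 : pderiv b j (fun y => v y ^ 2) =ᶠ[nhds z] fun y => 2 * v y * pderiv b j v y :=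
    hd.mono fun y hy => pderiv_sq hy j
  have h2 : DifferentiableAt ℝ (pderiv b j v) z :=
    ((hv.fderiv_right (m := 1) (by norm_num)).clm_apply contDiffAt_const).differentiableAt
      (by norm_num)
  have h3 := (((hd.self_of_nhds.hasFDerivAt.const_mul (2 : ℝ))).mul h2.hasFDerivAt).fderiv
  have h4 : fderiv ℝ (pderiv b j fun y => v y ^ 2) z
      = fderiv ℝ (fun y => 2 * v y * pderiv b j v y) z := h1.fderiv_eq
  change fderiv ℝ (pderiv b j fun y => v y ^ 2) z (b i) = _
  rw [h4]
  refine (congrArg (fun T => T (b i)) h3).trans ?_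
  simp only [add_apply, smul_apply, smul_eq_mul, pderiv]
  ring

/-- The product rule `Δ(w²) = 2 w Δw - 2 |∇w|²`. -/
theorem laplacian_sq [Fintype ι] [DecidableEq ι] (I : ModelWithCorners ℝ V H)
    (b : Module.Basis ι ℝ V) (g : ∀ q : X, TangentSpace I q → TangentSpace I q → ℝ) {w : X → ℝ}
    {q : X}
    (hw : ContDiffAt ℝ 2 (w ∘ (extChartAt I q).symm) (extChartAt I q q)) :
    laplacian I b g (fun x => w x ^ 2) q
      = 2 * w q * laplacian I b g w q - 2 * gradNormSq I b g w q := by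
  have hq : (w ∘ (extChartAt I q).symm) (extChartAt I q q) = w q := by simp
  have h1 : ∀ k, pderiv b k ((fun x => w x ^ 2) ∘ (extChartAt I q).symm) (extChartAt I q q)
      = 2 * w q * pderiv b k (w ∘ (extChartAt I q).symm) (extChartAt I q q) := fun k => by
    rw [← hq]
    exact pderiv_sq (hw.differentiableAt (by norm_num)) k
  have h2 : ∀ i j, pderiv b i (pderiv b j ((fun x => w x ^ 2) ∘ (extChartAt I q).symm))
        (extChartAt I q q)
      = 2 * w q * pderiv b i (pderiv b j (w ∘ (extChartAt I q).symm)) (extChartAt I q q)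
        + 2 * pderiv b i (w ∘ (extChartAt I q).symm) (extChartAt I q q)
          * pderiv b j (w ∘ (extChartAt I q).symm) (extChartAt I q q) := fun i j => by
    rw [← hq]
    exact pderiv_pderiv_sq hw i j
  unfold laplacian gradNormSq
  simp only [h1, h2]
  rw [mul_neg, ← neg_add', neg_inj]
  simp only [Finset.mul_sum, ← Finset.sum_add_distrib]
  refine Finset.sum_congr rfl fun i _ => Finset.sum_congr rfl fun j _ => ?_
  have h3 : ∑ k, christoffelAt I b g q k i j
        * (2 * w q * pderiv b k (w ∘ (extChartAt I q).symm) (extChartAt I q q))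
      = 2 * w q * ∑ k, christoffelAt I b g q k i j
        * pderiv b k (w ∘ (extChartAt I q).symm) (extChartAt I q q) := by
    rw [Finset.mul_sum]
    exact Finset.sum_congr rfl fun k _ => by ring
  rw [h3]
  ring

end Laplacian

/-! ### The evolution of the speed -/

section Evolution

/-- A non-trivial interval meets each ball around one of its points, end points included, in a
convex set with interior points; so derivatives within the intersection are unique. -/
theorem uniqueDiffOn_inter_ball {J : Set ℝ} (hJ : J.OrdConnected) (hJn : J.Nontrivial) {s ε : ℝ}
    (hs : s ∈ J) (hε : 0 < ε) :
    UniqueDiffOn ℝ (J ∩ Metric.ball s ε) ∧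
      J ∩ Metric.ball s ε ⊆ closure (interior (J ∩ Metric.ball s ε)) := by
  have hJc : Convex ℝ J := hJ.convex
  have hJi : (interior J).Nonempty := by
    obtain ⟨a, ha, b, hb, hab⟩ := hJn.exists_lt
    have h1 : Ioo a b ⊆ J := Ioo_subset_Icc_self.trans (hJ.out ha hb)
    exact (nonempty_Ioo.2 hab).mono (interior_maximal h1 isOpen_Ioo)
  have hKc : Convex ℝ (J ∩ Metric.ball s ε) := hJc.inter (convex_ball s ε)
  have hKi : (interior (J ∩ Metric.ball s ε)).Nonempty := by
    have h1 : s ∈ closure (interior J) := by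
      rw [hJc.closure_interior_eq_closure_of_nonempty_interior hJi]
      exact subset_closure hs
    rw [interior_inter, Metric.isOpen_ball.interior_eq, inter_comm]
    exact mem_closure_iff.1 h1 _ Metric.isOpen_ball (Metric.mem_ball_self hε)
  refine ⟨uniqueDiffOn_convex hKc hKi, ?_⟩
  rw [hKc.closure_interior_eq_closure_of_nonempty_interior hKi]
  exact subset_closure

variable {m : ℕ} {M : Type*} [TopologicalSpace M] [ChartedSpace (E m) M] [IsManifold (𝓡 m) ∞ M]
  {f : ℝ → ℝ}
  {gt : Bundle.ContMDiffRiemannianMetric (𝓡 m) ∞ (E m) (fun x : M => TangentSpace (𝓡 m) x)}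
  {J K : Set ℝ} {ℋ : M → ℝ} {F : ℝ → M → ℝ × M} {p : M} {q₀ : ℝ × M} {U : Set (E m)}

/-- Near each point and each time a prescribed mean curvature flow can be read in charts. -/
theorem IsPrescribedMCF.exists_domain (hF : IsPrescribedMCF f gt J ℋ F) (hJ : J.OrdConnected)
    (hJn : J.Nontrivial) {s : ℝ} (hs : s ∈ J) (p : M) :
    ∃ (U : Set (E m)) (K : Set ℝ), IsOpen U ∧ extChartAt (𝓡 m) p p ∈ U ∧
      U ⊆ (extChartAt (𝓡 m) p).target ∧ s ∈ K ∧ K ⊆ J ∧ K ∈ nhdsWithin s J ∧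
      UniqueDiffOn ℝ K ∧ K ⊆ closure (interior K) ∧ ∀ z ∈ U, ∀ r ∈ K,
        F r ((extChartAt (𝓡 m) p).symm z) ∈ (extChartAt (modelN m) (F s p)).source := by
  have hcont : ContinuousOn (fun x : E m × ℝ => F x.2 ((extChartAt (𝓡 m) p).symm x.1))
      ((extChartAt (𝓡 m) p).target ×ˢ J) := by
    have h1 : ContinuousOn (fun x : E m × ℝ => ((extChartAt (𝓡 m) p).symm x.1, x.2))
        ((extChartAt (𝓡 m) p).target ×ˢ J) :=
      ((continuousOn_extChartAt_symm p).comp continuousOn_fst fun x hx => hx.1).prodMk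
        continuousOn_snd
    exact hF.regular.continuousOn.comp h1 fun x hx => mk_mem_prod (mem_univ _) hx.2
  have hz := mem_extChartAt_target (I := 𝓡 m) p
  have h2 := hcont (extChartAt (𝓡 m) p p, s) (mk_mem_prod hz hs)
  have h3 : (extChartAt (modelN m) (F s p)).source
      ∈ nhds (F s ((extChartAt (𝓡 m) p).symm (extChartAt (𝓡 m) p p))) := by
    rw [extChartAt_to_inv (I := 𝓡 m) p]
    exact extChartAt_source_mem_nhds _
  have h4 := h2 h3
  rw [nhdsWithin_prod_eq, (isOpen_extChartAt_target p).nhdsWithin_eq hz, Filter.mem_map,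
    Filter.mem_prod_iff] at h4
  obtain ⟨A, hA, B, hB, hAB⟩ := h4
  obtain ⟨ε, hε, hεB⟩ := Metric.mem_nhdsWithin_iff.1 hB
  obtain ⟨U, hUA, hU, hzU⟩ := mem_nhds_iff.1
    (Filter.inter_mem hA ((isOpen_extChartAt_target (I := 𝓡 m) p).mem_nhds hz))
  obtain ⟨hK, hK'⟩ := uniqueDiffOn_inter_ball hJ hJn hs hε
  exact ⟨U, J ∩ Metric.ball s ε, hU, hzU, fun z hz => (hUA hz).2,
    ⟨hs, Metric.mem_ball_self hε⟩, inter_subset_left,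
    Filter.inter_mem self_mem_nhdsWithin (mem_nhdsWithin_of_mem_nhds (Metric.ball_mem_nhds s hε)),
    hK, hK', fun z hz r hr => hAB (mk_mem_prod (hUA hz).1 (hεB ⟨hr.2, hr.1⟩))⟩

theorem IsPrescribedMCF.inverseMetric_eq (hF : IsPrescribedMCF f gt J ℋ F) (hKJ : K ⊆ J)
    (hU : IsOpen U) (hUt : U ⊆ (extChartAt (𝓡 m) p).target)
    (hq : ∀ z ∈ U, ∀ r ∈ K, F r ((extChartAt (𝓡 m) p).symm z) ∈ (extChartAt (modelN m) q₀).source)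
    (hz : extChartAt (𝓡 m) p p ∈ U) {r : ℝ} (hr : r ∈ K) :
    inverseMetric (𝓡 m) (basisM m) (inducedMetric f gt (F r)) p
      = (gram (chartMetric f gt q₀) (U ×ˢ K) (spaceDir m) (flowMap F p q₀)
        (extChartAt (𝓡 m) p p, r))⁻¹ := by
  rw [hF.gram_flowMap hKJ hU hUt hq (mk_mem_prod hz hr)]
  rfl

/-- The Christoffel symbols of the induced metrics are the tangential components of the
covariant derivatives of the coordinate tangent fields. -/
theorem IsPrescribedMCF.christoffelAt_eq (hF : IsPrescribedMCF f gt J ℋ F)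
    (hf : ContDiff ℝ ∞ f) (hf_pos : ∀ t, 0 < f t) (hKJ : K ⊆ J)
    (hK : UniqueDiffOn ℝ K) (hK' : K ⊆ closure (interior K))
    (hU : IsOpen U) (hUt : U ⊆ (extChartAt (𝓡 m) p).target)
    (hq : ∀ z ∈ U, ∀ r ∈ K, F r ((extChartAt (𝓡 m) p).symm z) ∈ (extChartAt (modelN m) q₀).source)
    (hz : extChartAt (𝓡 m) p p ∈ U) {r : ℝ} (hr : r ∈ K) (k i j : Fin m) :
    christoffelAt (𝓡 m) (basisM m) (inducedMetric f gt (F r)) p k i j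
      = ∑ l, (gram (chartMetric f gt q₀) (U ×ˢ K) (spaceDir m) (flowMap F p q₀)
            (extChartAt (𝓡 m) p p, r))⁻¹ k l
          * chartMetric f gt q₀ (flowMap F p q₀ (extChartAt (𝓡 m) p p, r))
            (dirDeriv (U ×ˢ K) (spaceDir m l) (flowMap F p q₀) (extChartAt (𝓡 m) p p, r))
            (covDeriv (chartChristoffel f gt q₀) (U ×ˢ K) (flowMap F p q₀) (spaceDir m i)
              (dirDeriv (U ×ˢ K) (spaceDir m j) (flowMap F p q₀))
              (extChartAt (𝓡 m) p p, r)) := by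
  have h := hF.normalFlow hf hf_pos hKJ hK hK' hU hUt hq
  have hx : (extChartAt (𝓡 m) p p, r) ∈ U ×ˢ K := mk_mem_prod hz hr
  have hd : ∀ a b c, pderiv (basisM m) a
      (fun y => coordMetric (𝓡 m) (basisM m) (inducedMetric f gt (F r)) p y b c)
        (extChartAt (𝓡 m) p p)
      = dirDeriv (U ×ˢ K) (spaceDir m a) (fun x => gram (chartMetric f gt q₀) (U ×ˢ K)
        (spaceDir m) (flowMap F p q₀) x b c) (extChartAt (𝓡 m) p p, r) := fun a b c => by
    have h1 := dirDeriv_slice hU hz hr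
      ((h.contDiffOn_gram b c).differentiableOn (by norm_num) _ hx) (basisM m a)
    refine Eq.trans ?_ h1.symm
    have h2 : (fun y => coordMetric (𝓡 m) (basisM m) (inducedMetric f gt (F r)) p y b c)
        =ᶠ[nhds (extChartAt (𝓡 m) p p)] fun y => gram (chartMetric f gt q₀) (U ×ˢ K)
          (spaceDir m) (flowMap F p q₀) (y, r) b c :=
      Filter.eventually_of_mem (hU.mem_nhds hz) fun y hy =>
        (congrFun (congrFun (hF.gram_flowMap hKJ hU hUt hq (mk_mem_prod hy hr)) b) c).symm
    exact congrArg (fun T => T (basisM m a)) (h2.fderiv_eq (𝕜 := ℝ))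
  have hinv := hF.inverseMetric_eq hKJ hU hUt hq hz hr
  unfold christoffelAt christoffel
  unfold inverseMetric at hinv
  rw [hinv, Finset.mul_sum]
  refine Finset.sum_congr rfl fun l _ => ?_
  have hko := h.leviCivita.koszul h.uniqueDiffOn h.subset_closure h.mapsTo h.contDiffOn_map_two hx
    (spaceDir m i) (spaceDir m j) (spaceDir m l)
  rw [hd, hd, hd]
  simp only [gram, Matrix.of_apply]
  rw [hko, h.leviCivita.metric_symm _ (h.mapsTo hx) (dirDeriv _ (spaceDir m l) _ _)]
  ring

/-- `Ric(μ, μ)` is the trace of the curvature endomorphism `R(·, μ) μ`. -/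
theorem ricciNormal_eq_trace (hf : ContDiff ℝ ∞ f) (hf_pos : ∀ t, 0 < f t) (Φ : M → ℝ × M)
    (p : M) :
    ricciNormal f gt Φ p = LinearMap.trace ℝ (ℝ × E m)
      (curvatureMap (chartChristoffel f gt (Φ p)) (extChartAt (modelN m) (Φ p) (Φ p))
        (modelNormal f gt Φ p) (modelNormal f gt Φ p)) :=
  ricci_eq_trace gt hf hf_pos (Φ p) (modelNormal f gt Φ p) (modelNormal f gt Φ p)

/-- The normal of `Φ` at `p`, read in the preferred charts at `p` and at `Φ p`. -/
theorem chartNormal_self (Φ : M → ℝ × M) (p : M) :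
    chartNormal f gt Φ p (Φ p) (extChartAt (𝓡 m) p p) = modelNormal f gt Φ p := by
  have h0 : (extChartAt (𝓡 m) p).symm (extChartAt (𝓡 m) p p) = p := extChartAt_to_inv (I := 𝓡 m) p
  have hq : Φ ((extChartAt (𝓡 m) p).symm (extChartAt (𝓡 m) p p))
      ∈ (extChartAt (modelN m) (Φ p)).source := by
    rw [h0]
    exact mem_extChartAt_source _
  have h1 := chartTangent_chartNormal (f := f) gt hq
  have h2 : chartRep Φ p (Φ p) (extChartAt (𝓡 m) p p) = extChartAt (modelN m) (Φ p) (Φ p) := by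
    change extChartAt (modelN m) (Φ p) (Φ ((extChartAt (𝓡 m) p).symm (extChartAt (𝓡 m) p p))) = _
    rw [h0]
  rwa [h2, chartTangent_self, h0] at h1

/-- At the centre of the chart, the speed in the chart is `H - ℋ` at `p`. -/
theorem flowSpeed_center (p : M) (r : ℝ) :
    flowSpeed f gt ℋ F p (extChartAt (𝓡 m) p p, r) = meanCurvature f gt (F r) p - ℋ p := by
  unfold flowSpeed
  simp only
  rw [extChartAt_to_inv (I := 𝓡 m) p]

/-- The speed is `C²` at each time, although `ℋ` is not assumed to be continuous. -/
theorem IsPrescribedMCF.contMDiff_speed (hF : IsPrescribedMCF f gt J ℋ F) (hf : ContDiff ℝ ∞ f)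
    (hf_pos : ∀ t, 0 < f t) (hJ : J.OrdConnected) (hJn : J.Nontrivial) {s : ℝ} (hs : s ∈ J) :
    ContMDiff (𝓡 m) 𝓘(ℝ, ℝ) 2 (fun p => meanCurvature f gt (F s) p - ℋ p) := by
  intro p
  obtain ⟨U, K, hU, hz, hUt, hsK, hKJ, hKs, hK, hK', hq⟩ := hF.exists_domain hJ hJn hs p
  have h := hF.normalFlow hf hf_pos hKJ hK hK' hU hUt hq
  have h1 : ContDiffAt ℝ 2 (fun z => flowSpeed f gt ℋ F p (z, s)) (extChartAt (𝓡 m) p p) :=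
    (contDiffOn_slice hsK h.contDiffOn_speed).contDiffAt (hU.mem_nhds hz)
  have h2 := h1.contMDiffAt.comp p (contMDiffAt_extChartAt (I := 𝓡 m) (x := p) (n := 2))
  refine h2.congr_of_eventuallyEq ?_
  filter_upwards [extChartAt_source_mem_nhds (I := 𝓡 m) p] with x hx
  have h3 : (extChartAt (𝓡 m) p).symm (extChartAt (𝓡 m) p x) = x :=
    (extChartAt (𝓡 m) p).left_inv hx
  simp only [Function.comp, flowSpeed]
  rw [h3]

/-- The evolution equation of the speed. The prescribing function `ℋ` does not depend on time, so
the time derivatives of the speed and of the mean curvature agree. -/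
theorem IsPrescribedMCF.hasDerivWithinAt_speed (hF : IsPrescribedMCF f gt J ℋ F)
    (hf : ContDiff ℝ ∞ f) (hf_pos : ∀ t, 0 < f t) (hJ : J.OrdConnected) (hJn : J.Nontrivial)
    {s : ℝ} (hs : s ∈ J) (p : M) :
    HasDerivWithinAt (fun r => meanCurvature f gt (F r) p - ℋ p)
      (-laplacian (𝓡 m) (basisM m) (inducedMetric f gt (F s))
          (fun x => meanCurvature f gt (F s) x - ℋ x) p
        - (meanCurvature f gt (F s) p - ℋ p)
          * (normSqSFF f gt (F s) p + ricciNormal f gt (F s) p)) J s := by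
  obtain ⟨U, K, hU, hz, hUt, hsK, hKJ, hKs, hK, hK', hq⟩ := hF.exists_domain hJ hJn hs p
  have h := hF.normalFlow hf hf_pos hKJ hK hK' hU hUt hq
  have hx : (extChartAt (𝓡 m) p p, s) ∈ U ×ˢ K := mk_mem_prod hz hsK
  -- `H` at the fixed point `p`, as a function of time, is the trace computed in the fixed charts
  have hH : ∀ r ∈ K, ∑ i, ∑ j, (gram (chartMetric f gt (F s p)) (U ×ˢ K) (spaceDir m)
        (flowMap F p (F s p)) (extChartAt (𝓡 m) p p, r))⁻¹ i j
      * sff (chartMetric f gt (F s p)) (chartChristoffel f gt (F s p)) (U ×ˢ K) (spaceDir m)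
        (flowMap F p (F s p)) (flowNormal f gt F p (F s p)) i j (extChartAt (𝓡 m) p p, r)
      = meanCurvature f gt (F r) p := fun r hr => by
    simp only [hF.sff_flowMap hf hf_pos hKJ hK hU hUt hq hz hr]
    rw [← hF.inverseMetric_eq hKJ hU hUt hq hz hr]
    rfl
  have h1 := hasDerivWithinAt_slice hz
    (h.contDiffOn_meanCurvature.differentiableOn (by norm_num) _ hx)
  have h2 := ((h1.congr (fun r hr => (hH r hr).symm) (hH s hsK).symm).sub_const
    (ℋ p)).mono_of_mem_nhdsWithin hKs
  refine h2.congr_deriv ?_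
  have hu : flowMap F p (F s p) (extChartAt (𝓡 m) p p, s)
      = extChartAt (modelN m) (F s p) (F s p) := by
    change extChartAt (modelN m) (F s p) (F s ((extChartAt (𝓡 m) p).symm
      (extChartAt (𝓡 m) p p))) = _
    rw [extChartAt_to_inv (I := 𝓡 m) p]
  have hn : flowNormal f gt F p (F s p) (extChartAt (𝓡 m) p p, s) = modelNormal f gt (F s) p :=
    chartNormal_self (F s) p
  have hric : LinearMap.trace ℝ (ℝ × E m) (curvatureMap (chartChristoffel f gt (F s p))
      (flowMap F p (F s p) (extChartAt (𝓡 m) p p, s))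
      (flowNormal f gt F p (F s p) (extChartAt (𝓡 m) p p, s))
      (flowNormal f gt F p (F s p) (extChartAt (𝓡 m) p p, s))) = ricciNormal f gt (F s) p := by
    rw [ricciNormal_eq_trace hf hf_pos, hu, hn]
  have hnorm : ∑ i, ∑ j, ∑ k, ∑ l,
      (gram (chartMetric f gt (F s p)) (U ×ˢ K) (spaceDir m)
        (flowMap F p (F s p)) (extChartAt (𝓡 m) p p, s))⁻¹ i k
      * (gram (chartMetric f gt (F s p)) (U ×ˢ K) (spaceDir m)
        (flowMap F p (F s p)) (extChartAt (𝓡 m) p p, s))⁻¹ j l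
      * sff (chartMetric f gt (F s p)) (chartChristoffel f gt (F s p)) (U ×ˢ K) (spaceDir m)
        (flowMap F p (F s p)) (flowNormal f gt F p (F s p)) i j (extChartAt (𝓡 m) p p, s)
      * sff (chartMetric f gt (F s p)) (chartChristoffel f gt (F s p)) (U ×ˢ K) (spaceDir m)
        (flowMap F p (F s p)) (flowNormal f gt F p (F s p)) k l (extChartAt (𝓡 m) p p, s)
      = normSqSFF f gt (F s) p := by
    simp only [hF.sff_flowMap hf hf_pos hKJ hK hU hUt hq hz hsK]
    rw [← hF.inverseMetric_eq hKJ hU hUt hq hz hsK]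
    rfl
  have hp1 : ∀ k, pderiv (basisM m) k
      ((fun x => meanCurvature f gt (F s) x - ℋ x) ∘ (extChartAt (𝓡 m) p).symm)
        (extChartAt (𝓡 m) p p)
      = dirDeriv (U ×ˢ K) (spaceDir m k) (flowSpeed f gt ℋ F p) (extChartAt (𝓡 m) p p, s) :=
    fun k => (dirDeriv_slice hU hz hsK (h.differentiable_speed hx) (basisM m k)).symm
  have hp2 : ∀ i j, pderiv (basisM m) i (pderiv (basisM m) j
      ((fun x => meanCurvature f gt (F s) x - ℋ x) ∘ (extChartAt (𝓡 m) p).symm))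
        (extChartAt (𝓡 m) p p)
      = dirDeriv (U ×ˢ K) (spaceDir m i) (dirDeriv (U ×ˢ K) (spaceDir m j)
        (flowSpeed f gt ℋ F p)) (extChartAt (𝓡 m) p p, s) := fun i j =>
    (dirDeriv_dirDeriv_slice hU hK hz hsK h.contDiffOn_speed (basisM m i) (basisM m j)).symm
  have key := h.dirDeriv_meanCurvature hx (curvatureMap (chartChristoffel f gt (F s p))
    (flowMap F p (F s p) (extChartAt (𝓡 m) p p, s))
    (flowNormal f gt F p (F s p) (extChartAt (𝓡 m) p p, s))
    (flowNormal f gt F p (F s p) (extChartAt (𝓡 m) p p, s))) fun a => rfl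
  rw [hric, hnorm, flowSpeed_center] at key
  refine key.trans ?_
  unfold laplacian
  simp only [hp1, hp2, hF.christoffelAt_eq hf hf_pos hKJ hK hK' hU hUt hq hz hsK,
    hF.inverseMetric_eq hKJ hU hUt hq hz hsK, neg_neg]

end Evolution

end PrescribedMCF

theorem mainTheorem7 {m : ℕ} {M : Type*} [TopologicalSpace M]
    [ChartedSpace (PrescribedMCF.E m) M] [IsManifold (𝓡 m) ∞ M]
    (gt : Bundle.ContMDiffRiemannianMetric (𝓡 m) ∞ (PrescribedMCF.E m)
      (fun x : M => TangentSpace (𝓡 m) x))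
    (f : ℝ → ℝ) (hf : ContDiff ℝ ∞ f) (hf_pos : ∀ t, 0 < f t)
    (J : Set ℝ) (hJ : J.OrdConnected) (hJ_nontrivial : J.Nontrivial)
    (ℋ : M → ℝ) (F : ℝ → M → ℝ × M) (hF : PrescribedMCF.IsPrescribedMCF f gt J ℋ F)
    (w : ℝ → M → ℝ) (hw : w = fun s p => PrescribedMCF.meanCurvature f gt (F s) p - ℋ p) :
    ∀ s ∈ J, ContMDiff (𝓡 m) 𝓘(ℝ, ℝ) 2 (w s) ∧ ∀ p : M,
      DifferentiableWithinAt ℝ (fun r => w r p) J s ∧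
      derivWithin (fun r => w r p) J s
          + PrescribedMCF.laplacian (𝓡 m) (PrescribedMCF.basisM m)
              (PrescribedMCF.inducedMetric f gt (F s)) (w s) p
        = -w s p * (PrescribedMCF.normSqSFF f gt (F s) p
            + PrescribedMCF.ricciNormal f gt (F s) p) ∧
      derivWithin (fun r => w r p ^ 2) J s
          + PrescribedMCF.laplacian (𝓡 m) (PrescribedMCF.basisM m)
              (PrescribedMCF.inducedMetric f gt (F s)) (fun q => w s q ^ 2) p
        = -2 * w s p ^ 2 * (PrescribedMCF.normSqSFF f gt (F s) p
            + PrescribedMCF.ricciNormal f gt (F s) p)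
          - 2 * PrescribedMCF.gradNormSq (𝓡 m) (PrescribedMCF.basisM m)
              (PrescribedMCF.inducedMetric f gt (F s)) (w s) p := by
  subst hw
  intro s hs
  have hw2 := hF.contMDiff_speed hf hf_pos hJ hJ_nontrivial hs
  refine ⟨hw2, fun p => ?_⟩
  have h1 := hF.hasDerivWithinAt_speed hf hf_pos hJ hJ_nontrivial hs p
  have hJs : UniqueDiffWithinAt ℝ J s :=
    ((PrescribedMCF.uniqueDiffOn_inter_ball hJ hJ_nontrivial hs one_pos).1 s
      ⟨hs, Metric.mem_ball_self one_pos⟩).mono Set.inter_subset_left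
  have hv : ContDiffAt ℝ 2 ((fun q => PrescribedMCF.meanCurvature f gt (F s) q - ℋ q)
      ∘ (extChartAt (𝓡 m) p).symm) (extChartAt (𝓡 m) p p) := by
    rw [← contMDiffAt_iff_contDiffAt]
    refine ContMDiffAt.comp _ (hw2 _) ?_
    exact (contMDiffOn_extChartAt_symm (I := 𝓡 m) (n := 2) p).contMDiffAt
      (extChartAt_target_mem_nhds p)
  refine ⟨h1.differentiableWithinAt, ?_, ?_⟩
  · rw [h1.derivWithin hJs]
    ring
  · rw [PrescribedMCF.laplacian_sq _ _ _ hv, (h1.fun_pow 2).derivWithin hJs]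
    simp only [Nat.cast_ofNat]
    ring
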